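/- Let $k$ be a field, let $G$ be an abelian group and let $R=\sum_{g\in G}R_g\,g$ with $R_g\in\mathbb N$ be a ramification datum. Let $Q=Q(G,R)$ be the Hopf quiver with vertex set $G$ and, for all $x,g\in G$, exactly $R_g$ arrows $x\to gx$. Assume that $Q$ is connected. Let $kQ$ be its path coalgebra, with coproduct $\Delta(a_n\cdots a_1)=\sum_{i=0}^n a_n\cdots a_{i+1}\otimes a_i\cdots a_1$ and graded by path length. A *coquasitriangular Majid algebra* structure on a coalgebra $H$ consists of coalgebra maps $H\otimes H\to H$ and $k\to H$, $1\mapsto 1_H$, with $1_Ha=a=a1_H$, and convolution-invertible maps $\Phi:H^{\otimes3}\to k$ and $\mathcal R:H^{\otimes 2}\to k$ such that (in Sweedler notation) $$a_1(b_1c_1)\Phi(a_2,b_2,c_2)=\Phi(a_1,b_1,c_1)(a_2b_2)c_2,\qquad \Phi(a,1_H,b)=\varepsilon(a)\varepsilon(b),$$ $$\Phi(a_1,b_1,c_1d_1)\Phi(a_2b_2,c_2,d_2)=\Phi(b_1,c_1,d_1)\Phi(a_1,b_2c_2,d_2)\Phi(a_2,b_3,c_3),$$ $$\mathcal R(ab,c)=\Phi(c_1,a_1,b_1)\mathcal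 R(a_2,c_2)\Phi^{-1}(a_3,c_3,b_2)\mathcal R(b_3,c_4)\Phi(a_4,b_4,c_5),$$ $$\mathcal R(a,bc)=\Phi^{-1}(b_1,c_1,a_1)\mathcal R(a_2,c_2)\Phi(b_2,a_3,c_3)\mathcal R(a_4,b_3)\Phi^{-1}(a_5,b_4,c_4),$$ $$b_1a_1\mathcal R(a_2,b_2)=\mathcal R(a_1,b_1)a_2b_2,$$ and such that there is a quasi-antipode, i.e. a coalgebra antimorphism $S:H\to H$ and $\alpha,\beta:H\to k$ with $S(a_1)\alpha(a_2)a_3=\alpha(a)1_H$, $a_1\beta(a_2)S(a_3)=\beta(a)1_H$ and $\Phi(a_1,S(a_3),a_5)\beta(a_2)\alpha(a_4)=\varepsilon(a)=\Phi^{-1}(S(a_1),a_3,S(a_5))\alpha(a_2)\beta(a_4)$. Consider the graded structures of this kind on $kQ$ (product and unit are graded, and $S,\alpha,\beta$ can be chosen graded, $k$ being in degree $0$) such that $\Phi$ and $\mathcal R$ are concentrated in degree $0$ (they vanish on homogeneous arguments that are not all of degree $0$) and such that vertices multiply as in $G$. Identify two of them if there is a graded coalgebra automorphism of $kQ$ that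 fixes every vertex and carries the unit, product, $\Phi$ and $\mathcal R$ of the first to those of the second. **Theorem.** Restricting $\Phi$ and $\mathcal R$ to vertices induces a one-to-one correspondence between the set of these structures, up to this identification, and the set of pairs $(\Phi,\mathcal R)$ in which $\Phi:G\times G\times G\to k\setminus\{0\}$ is a normalized 3-cocycle, i.e. $\Phi(e,1,f)=1$ and $\Phi(e,f,gh)\Phi(ef,g,h)=\Phi(f,g,h)\Phi(e,fg,h)\Phi(e,f,g)$ for all $e,f,g,h\in G$, such that $$\frac{\Phi(eg,f,t)\Phi(g,e,t)\Phi(e,t,f)}{\Phi(eg,t,f)\Phi(g,t,e)\Phi(e,f,t)}=\frac{\Phi(g,e,f)\Phi(g,ef,t)\Phi(t,e,f)}{\Phi(gt,e,f)\Phi(g,t,ef)},\tag{3.1}$$ $$\frac{\Phi(e,g,t)\Phi(eg,f,t)}{\Phi(f,g,t)\Phi(eg,t,f)}=\frac{\Phi(e,g,f)\Phi(e,fg,t)\Phi(g,f,t)}{\Phi(e,gt,f)\Phi(g,t,f)\Phi(f,g,t)}\tag{3.2}$$ for all $e,f,g\in G$ and all $t\in G$ with $R_t\neq0$, and $\mathcal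 R:G\times G\to k$ is a map such that $$\mathcal R(f,gh)=\mathcal R(f,g)\mathcal R(f,h)\frac{\Phi(g,f,h)}{\Phi(g,h,f)\Phi(f,g,h)},\tag{3.3}$$ $$\mathcal R(fg,h)=\mathcal R(f,h)\mathcal R(g,h)\frac{\Phi(h,f,g)\Phi(f,g,h)}{\Phi(f,h,g)},\tag{3.4}$$ $$\mathcal R(g,h)\mathcal R(h,g)=1\tag{3.5}$$ for all $f,g,h\in G$. -/

import Mathlib

open scoped TensorProduct

/-! ### Majid algebras and coquasitriangular structures over a field -/

section Majid

variable (k : Type*) [Field k]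

/-- Linear functionals on a coalgebra `C` with the convolution product of Mathlib:
`(φ * ψ) c = φ c₁ * ψ c₂`, with unit the counit of `C`. -/
abbrev Functional (C : Type*) [AddCommGroup C] [Module k C] : Type _ := WithConv (C →ₗ[k] k)

variable {k}

/-- The pull-back `φ ∘ f` of a functional along a linear map. -/
def Functional.pull {C D : Type*} [AddCommGroup C] [Module k C] [AddCommGroup D] [Module k D]
    (f : D →ₗ[k] C) (φ : Functional k C) : Functional k D :=
  WithConv.toConv (φ.ofConv ∘ₗ f)

section ConvolutionAction

variable {C V : Type*} [AddCommGroup C] [Module k C] [Coalgebra k C] [AddCommGroup V] [Module k V]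

/-- The map `c ↦ φ(c₁) f(c₂)`. -/
noncomputable def convLeft (φ : Functional k C) (f : C →ₗ[k] V) : C →ₗ[k] V :=
  (TensorProduct.lid k V).toLinearMap ∘ₗ TensorProduct.map φ.ofConv f ∘ₗ Coalgebra.comul

/-- The map `c ↦ f(c₁) φ(c₂)`. -/
noncomputable def convRight (f : C →ₗ[k] V) (φ : Functional k C) : C →ₗ[k] V :=
  (TensorProduct.rid k V).toLinearMap ∘ₗ TensorProduct.map f φ.ofConv ∘ₗ Coalgebra.comul

end ConvolutionAction

section Permutations

variable (k) (H : Type*) [AddCommGroup H] [Module k H]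

/-- `a ⊗ b ⊗ c ↦ c ⊗ a ⊗ b` -/
noncomputable def permCAB : H ⊗[k] (H ⊗[k] H) →ₗ[k] H ⊗[k] (H ⊗[k] H) :=
  (TensorProduct.comm k (H ⊗[k] H) H).toLinearMap ∘ₗ (TensorProduct.assoc k H H H).symm.toLinearMap

/-- `a ⊗ b ⊗ c ↦ a ⊗ c ⊗ b` -/
noncomputable def permACB : H ⊗[k] (H ⊗[k] H) →ₗ[k] H ⊗[k] (H ⊗[k] H) :=
  LinearMap.lTensor H (TensorProduct.comm k H H).toLinearMap

/-- `a ⊗ b ⊗ c ↦ b ⊗ c ⊗ a` -/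
noncomputable def permBCA : H ⊗[k] (H ⊗[k] H) →ₗ[k] H ⊗[k] (H ⊗[k] H) :=
  (TensorProduct.assoc k H H H).toLinearMap ∘ₗ (TensorProduct.comm k H (H ⊗[k] H)).toLinearMap

/-- `a ⊗ b ⊗ c ↦ b ⊗ a ⊗ c` -/
noncomputable def permBAC : H ⊗[k] (H ⊗[k] H) →ₗ[k] H ⊗[k] (H ⊗[k] H) :=
  (TensorProduct.leftComm k H H H).toLinearMap

variable [Coalgebra k H]

/-- `a ⊗ x ↦ ε(a) x` -/
noncomputable def dropFirst (V : Type*) [AddCommGroup V] [Module k V] : H ⊗[k] V →ₗ[k] V :=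
  (TensorProduct.lid k V).toLinearMap ∘ₗ LinearMap.rTensor V Coalgebra.counit

/-- `x ⊗ a ↦ ε(a) x` -/
noncomputable def dropLast (V : Type*) [AddCommGroup V] [Module k V] : V ⊗[k] H →ₗ[k] V :=
  (TensorProduct.rid k V).toLinearMap ∘ₗ LinearMap.lTensor V Coalgebra.counit

/-- `a ⊗ b ⊗ c ↦ ε(c) a ⊗ b` -/
noncomputable def keepAB : H ⊗[k] (H ⊗[k] H) →ₗ[k] H ⊗[k] H :=
  LinearMap.lTensor H (dropLast k H H)

/-- `a ⊗ b ⊗ c ↦ ε(b) a ⊗ c` -/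
noncomputable def keepAC : H ⊗[k] (H ⊗[k] H) →ₗ[k] H ⊗[k] H :=
  LinearMap.lTensor H (dropFirst k H H)

/-- `a ⊗ b ⊗ c ↦ ε(a) b ⊗ c` -/
noncomputable def keepBC : H ⊗[k] (H ⊗[k] H) →ₗ[k] H ⊗[k] H :=
  dropFirst k H (H ⊗[k] H)

/-- `a ⊗ b ⊗ c ⊗ d ↦ ε(d) a ⊗ b ⊗ c` -/
noncomputable def keepABC : H ⊗[k] (H ⊗[k] (H ⊗[k] H)) →ₗ[k] H ⊗[k] (H ⊗[k] H) :=
  LinearMap.lTensor H (keepAB k H)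

/-- `a ⊗ b ⊗ c ⊗ d ↦ ε(a) b ⊗ c ⊗ d` -/
noncomputable def keepBCD : H ⊗[k] (H ⊗[k] (H ⊗[k] H)) →ₗ[k] H ⊗[k] (H ⊗[k] H) :=
  dropFirst k H (H ⊗[k] (H ⊗[k] H))

end Permutations

section MultiplyEntries

variable {H : Type*} [AddCommGroup H] [Module k H]

/-- For a multiplication `m` and a vector space `V`: `a ⊗ b ⊗ v ↦ ab ⊗ v`. -/
noncomputable def mulFirstTwo (m : H ⊗[k] H →ₗ[k] H) (V : Type*) [AddCommGroup V] [Module k V] :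
    H ⊗[k] (H ⊗[k] V) →ₗ[k] H ⊗[k] V :=
  LinearMap.rTensor V m ∘ₗ (TensorProduct.assoc k H H V).symm.toLinearMap

end MultiplyEntries

/-- A dual quasi-bialgebra (Majid bialgebra) structure on a coalgebra `H`: coalgebra maps
`H ⊗ H → H` and `k → H` (the latter being the choice of a group-like element `1`) and a
convolution-invertible associator `Φ : H ⊗ H ⊗ H → k`. -/
structure DualQuasiBialgebra (k : Type*) [Field k] (H : Type*) [AddCommGroup H] [Module k H]
    [Coalgebra k H] where
  mul : H ⊗[k] H →ₗc[k] H
  one : H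
  isGroupLike_one : IsGroupLikeElem k one
  Φ : (Functional k (H ⊗[k] (H ⊗[k] H)))ˣ
  one_mul : ∀ a : H, mul (one ⊗ₜ[k] a) = a
  mul_one : ∀ a : H, mul (a ⊗ₜ[k] one) = a
  /-- `a₁(b₁c₁) Φ(a₂,b₂,c₂) = Φ(a₁,b₁,c₁) (a₂b₂)c₂` -/
  quasi_assoc :
    convRight (mul.toLinearMap ∘ₗ LinearMap.lTensor H mul.toLinearMap) Φ.val =
      convLeft Φ.val (mul.toLinearMap ∘ₗ mulFirstTwo mul.toLinearMap H)
  /-- `Φ(a₁,b₁,c₁d₁) Φ(a₂b₂,c₂,d₂) = Φ(b₁,c₁,d₁) Φ(a₁,b₂c₂,d₂) Φ(a₂,b₃,c₃)` -/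
  pentagon :
    Functional.pull (LinearMap.lTensor H (LinearMap.lTensor H mul.toLinearMap)) Φ.val *
        Functional.pull (mulFirstTwo mul.toLinearMap (H ⊗[k] H)) Φ.val =
      Functional.pull (keepBCD k H) Φ.val *
        Functional.pull (LinearMap.lTensor H (mulFirstTwo mul.toLinearMap H)) Φ.val *
        Functional.pull (keepABC k H) Φ.val
  /-- `Φ(a,1,b) = ε(a) ε(b)` -/
  normalized : ∀ a b : H, Φ.val.ofConv (a ⊗ₜ[k] (one ⊗ₜ[k] b)) =
    Coalgebra.counit (R := k) a * Coalgebra.counit (R := k) b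

section Antipode

variable {H : Type*} [AddCommGroup H] [Module k H] [Coalgebra k H]

/-- `a ↦ a₁ ⊗ a₂ ⊗ a₃` -/
noncomputable def comulTwice (k : Type*) [Field k] (H : Type*) [AddCommGroup H] [Module k H]
    [Coalgebra k H] : H →ₗ[k] H ⊗[k] (H ⊗[k] H) :=
  LinearMap.lTensor H Coalgebra.comul ∘ₗ Coalgebra.comul

/-- `(S, α, β)` is a quasi-antipode of the dual quasi-bialgebra `A`. -/
structure DualQuasiBialgebra.IsQuasiAntipode (A : DualQuasiBialgebra k H)
    (S : H →ₗ[k] H) (α β : Functional k H) : Prop where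
  /-- `S` reverses the coproduct. -/
  comul_S : Coalgebra.comul ∘ₗ S =
    (TensorProduct.comm k H H).toLinearMap ∘ₗ TensorProduct.map S S ∘ₗ Coalgebra.comul
  counit_S : (Coalgebra.counit : H →ₗ[k] k) ∘ₗ S = Coalgebra.counit
  /-- `S(a₁) α(a₂) a₃ = α(a) 1` -/
  left_antipode : ∀ a : H,
    (A.mul.toLinearMap ∘ₗ TensorProduct.map S (convLeft α LinearMap.id)) (Coalgebra.comul a) =
      α.ofConv a • A.one
  /-- `a₁ β(a₂) S(a₃) = β(a) 1` -/
  right_antipode : ∀ a : H,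
    (A.mul.toLinearMap ∘ₗ TensorProduct.map LinearMap.id (convLeft β S)) (Coalgebra.comul a) =
      β.ofConv a • A.one
  /-- `Φ(a₁, S(a₃), a₅) β(a₂) α(a₄) = ε(a)` -/
  assoc_antipode : ∀ a : H,
    (A.Φ.val.ofConv ∘ₗ TensorProduct.map LinearMap.id
      (TensorProduct.map (convLeft β S) (convLeft α LinearMap.id))) (comulTwice k H a) =
      Coalgebra.counit a
  /-- `Φ⁻¹(S(a₁), a₃, S(a₅)) α(a₂) β(a₄) = ε(a)` -/
  assoc_inv_antipode : ∀ a : H,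
    (A.Φ⁻¹.val.ofConv ∘ₗ TensorProduct.map S
      (TensorProduct.map (convLeft α LinearMap.id) (convLeft β S))) (comulTwice k H a) =
      Coalgebra.counit a

end Antipode

/-- A coquasitriangular Majid algebra structure on a coalgebra `H`. The quasi-antipode is only
required to exist (it is essentially unique and is not part of the data). -/
structure CoquasitriangularMajidAlgebra (k : Type*) [Field k] (H : Type*) [AddCommGroup H]
    [Module k H] [Coalgebra k H] extends DualQuasiBialgebra k H where
  exists_quasiAntipode : ∃ S α β, toDualQuasiBialgebra.IsQuasiAntipode S α β
  R : (Functional k (H ⊗[k] H))ˣ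
  /-- `R(ab,c) = Φ(c₁,a₁,b₁) R(a₂,c₂) Φ⁻¹(a₃,c₃,b₂) R(b₃,c₄) Φ(a₄,b₄,c₅)` -/
  R_mul_left :
    Functional.pull (mulFirstTwo mul.toLinearMap H) R.val =
      Functional.pull (permCAB k H) Φ.val * Functional.pull (keepAC k H) R.val *
        Functional.pull (permACB k H) Φ⁻¹.val * Functional.pull (keepBC k H) R.val * Φ.val
  /-- `R(a,bc) = Φ⁻¹(b₁,c₁,a₁) R(a₂,c₂) Φ(b₂,a₃,c₃) R(a₄,b₃) Φ⁻¹(a₅,b₄,c₄)` -/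
  R_mul_right :
    Functional.pull (LinearMap.lTensor H mul.toLinearMap) R.val =
      Functional.pull (permBCA k H) Φ⁻¹.val * Functional.pull (keepAC k H) R.val *
        Functional.pull (permBAC k H) Φ.val * Functional.pull (keepAB k H) R.val * Φ⁻¹.val
  /-- `b₁a₁ R(a₂,b₂) = R(a₁,b₁) a₂b₂` -/
  R_comm :
    convRight (mul.toLinearMap ∘ₗ (TensorProduct.comm k H H).toLinearMap) R.val =
      convLeft R.val mul.toLinearMap

end Majid

/-! ### The Hopf quiver `Q(G, ρ)` of an abelian group and its path coalgebra

For `G` abelian the conjugacy classes are singletons, so a ramification datum is a function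
`ρ : G → ℕ`; the quiver has vertex set `G` and, for all `x c : G`, exactly `ρ c` arrows
from `x` to `c * x`. -/

set_option linter.unusedSectionVars false

namespace HopfQuiver

variable {G : Type*} [CommGroup G]

/-- The label `(c, i)` of an arrow `x ⟶ c * x`, with `i` one of the `ρ c` possible indices. -/
abbrev Label (ρ : G → ℕ) : Type _ := Σ c : G, Fin (ρ c)

/-- The arrow with label `(c, i)` that starts at the vertex `src`. -/
structure Arrow (ρ : G → ℕ) where
  src : G
  label : Label ρ

/-- The target `c * x` of the arrow with source `x` and label `(c, i)`. -/
def Arrow.tgt {ρ : G → ℕ} (a : Arrow ρ) : G := a.label.1 * a.src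

/-- The quiver is connected: any two vertices are joined by an unoriented walk of arrows. -/
def Connected (ρ : G → ℕ) : Prop :=
  ∀ x y : G, Relation.EqvGen (fun u v : G => ∃ a : Arrow ρ, a.src = u ∧ a.tgt = v) x y

/-- A path `aₙ ⋯ a₁`. As an arrow is determined by its source and its label, a path is the same
as its source together with the list of labels of `a₁, …, aₙ` (in the order of traversal). The
paths of length `0` are the vertices. -/
@[ext]
structure Path (ρ : G → ℕ) where
  src : G
  labels : List (Label ρ)

namespace Path

variable {ρ : G → ℕ}

/-- The vertex reached from `x` by following the arrows with the given labels. -/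
def walk (x : G) (l : List (Label ρ)) : G := l.foldl (fun y s => s.1 * y) x

/-- The trivial path at a vertex. -/
def vertex (ρ : G → ℕ) (x : G) : Path ρ := ⟨x, []⟩

def length (p : Path ρ) : ℕ := p.labels.length

/-- The end point of a path. -/
def tgt (p : Path ρ) : G := walk p.src p.labels

/-- The initial part `aᵢ ⋯ a₁` of the path `aₙ ⋯ a₁`. -/
def initial (p : Path ρ) (i : ℕ) : Path ρ := ⟨p.src, p.labels.take i⟩

/-- The final part `aₙ ⋯ aᵢ₊₁` of the path `aₙ ⋯ a₁`. -/
def final (p : Path ρ) (i : ℕ) : Path ρ := ⟨(p.initial i).tgt, p.labels.drop i⟩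

theorem length_initial (p : Path ρ) {i : ℕ} (h : i ≤ p.length) : (p.initial i).length = i := by
  simpa [initial, length] using h

theorem length_final (p : Path ρ) (i : ℕ) : (p.final i).length = p.length - i := by
  simp [final, length]

theorem initial_initial (p : Path ρ) (i j : ℕ) :
    (p.initial (i + j)).initial i = p.initial i := by
  simp [initial, List.take_take]

theorem final_final (p : Path ρ) (i j : ℕ) : (p.final i).final j = p.final (i + j) := by
  simp [final, initial, tgt, walk, List.take_add, List.foldl_append]

theorem initial_final (p : Path ρ) (i j : ℕ) :
    (p.final i).initial j = (p.initial (i + j)).final i := by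
  simp [final, initial, tgt, List.take_take, List.drop_take]

theorem initial_length (p : Path ρ) : p.initial p.length = p := by
  simp [initial, length]

theorem final_zero (p : Path ρ) : p.final 0 = p := by
  simp [final, initial, tgt, walk]

end Path

end HopfQuiver

open HopfQuiver in
/-- The path space `kQ`: the vector space with basis the paths of `Q = Q(G, ρ)`. -/
def PathSpace (k : Type*) [Field k] {G : Type*} [CommGroup G] (ρ : G → ℕ) : Type _ :=
  Path ρ →₀ k

namespace PathSpace

open HopfQuiver

variable (k : Type*) [Field k] {G : Type*} [CommGroup G] {ρ : G → ℕ}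

noncomputable instance : AddCommGroup (PathSpace k ρ) := inferInstanceAs (AddCommGroup (Path ρ →₀ k))

noncomputable instance : Module k (PathSpace k ρ) := inferInstanceAs (Module k (Path ρ →₀ k))

/-- The basis of paths. -/
noncomputable def basis (ρ : G → ℕ) : Module.Basis (Path ρ) k (PathSpace k ρ) :=
  ⟨LinearEquiv.refl k (Path ρ →₀ k)⟩

/-- A path as an element of `kQ`. -/
noncomputable def ofPath (p : Path ρ) : PathSpace k ρ := basis k ρ p

/-- A vertex as an element of `kQ`. -/
noncomputable def ofVertex (ρ : G → ℕ) (x : G) : PathSpace k ρ := ofPath k (Path.vertex ρ x)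

/-- The splitting of paths: `Δ(aₙ ⋯ a₁) = ∑ᵢ aₙ ⋯ aᵢ₊₁ ⊗ aᵢ ⋯ a₁`; the counit is `1` on vertices
and `0` on paths of positive length. -/
noncomputable instance : CoalgebraStruct k (PathSpace k ρ) where
  comul := (basis k ρ).constr k fun p =>
    ∑ i ∈ Finset.range (p.length + 1), ofPath k (p.final i) ⊗ₜ[k] ofPath k (p.initial i)
  counit := (basis k ρ).constr k fun p => if p.length = 0 then 1 else 0

theorem comul_ofPath (p : Path ρ) : Coalgebra.comul (R := k) (ofPath k p) =
    ∑ i ∈ Finset.range (p.length + 1), ofPath k (p.final i) ⊗ₜ[k] ofPath k (p.initial i) :=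
  (basis k ρ).constr_basis k _ p

theorem counit_ofPath (p : Path ρ) :
    Coalgebra.counit (R := k) (ofPath k p) = if p.length = 0 then 1 else 0 :=
  (basis k ρ).constr_basis k _ p

noncomputable instance : Coalgebra k (PathSpace k ρ) where
  coassoc := by
    refine (basis k ρ).ext fun p => ?_
    change TensorProduct.assoc k _ _ _ (LinearMap.rTensor _ Coalgebra.comul
      (Coalgebra.comul (ofPath k p))) =
      LinearMap.lTensor _ Coalgebra.comul (Coalgebra.comul (ofPath k p))
    simp only [comul_ofPath, map_sum, LinearMap.rTensor_tmul, LinearMap.lTensor_tmul,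
      TensorProduct.sum_tmul, TensorProduct.tmul_sum, TensorProduct.assoc_tmul]
    rw [Finset.sum_sigma', Finset.sum_sigma']
    refine Finset.sum_bij' (fun x _ => ⟨x.1 + x.2, x.1⟩) (fun x _ => ⟨x.2, x.1 - x.2⟩)
      ?_ ?_ ?_ ?_ ?_
    · rintro ⟨i, j⟩ h
      simp only [Finset.mem_sigma, Finset.mem_range, Path.length_final] at h ⊢
      rw [Path.length_initial] <;> omega
    · rintro ⟨m, i⟩ h
      simp only [Finset.mem_sigma, Finset.mem_range, Path.length_final] at h ⊢
      rw [Path.length_initial _ (by omega)] at h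
      omega
    · rintro ⟨i, j⟩ h
      simp
    · rintro ⟨m, i⟩ h
      simp only [Finset.mem_sigma, Finset.mem_range] at h
      rw [Path.length_initial _ (by omega)] at h
      simp only [Sigma.mk.injEq, heq_eq_eq, and_true]
      omega
    · rintro ⟨i, j⟩ h
      simp only [Path.final_final, Path.initial_final, Path.initial_initial]
  rTensor_counit_comp_comul := by
    refine (basis k ρ).ext fun p => ?_
    change LinearMap.rTensor _ Coalgebra.counit (Coalgebra.comul (ofPath k p)) =
      1 ⊗ₜ[k] ofPath k p
    simp only [comul_ofPath, map_sum, LinearMap.rTensor_tmul, counit_ofPath, Path.length_final]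
    rw [Finset.sum_eq_single_of_mem p.length (by simp)]
    · simp [Path.initial_length]
    · intro i hi hne
      rw [Finset.mem_range] at hi
      rw [if_neg (by omega), TensorProduct.zero_tmul]
  lTensor_counit_comp_comul := by
    refine (basis k ρ).ext fun p => ?_
    change LinearMap.lTensor _ Coalgebra.counit (Coalgebra.comul (ofPath k p)) =
      ofPath k p ⊗ₜ[k] 1
    simp only [comul_ofPath, map_sum, LinearMap.lTensor_tmul, counit_ofPath]
    rw [Finset.sum_eq_single_of_mem 0 (by simp)]
    · simp [Path.final_zero, Path.length_initial]
    · intro i hi hne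
      rw [Finset.mem_range] at hi
      rw [Path.length_initial _ (by omega), if_neg hne, TensorProduct.tmul_zero]

/-- The homogeneous component `kQₙ`, spanned by the paths of length `n`. -/
noncomputable def degree (ρ : G → ℕ) (n : ℕ) : Submodule k (PathSpace k ρ) :=
  Submodule.span k {x | ∃ p : Path ρ, p.length = n ∧ ofPath k p = x}

end PathSpace

/-! ### Graded coquasitriangular Majid algebra structures on `kQ` -/

open PathSpace HopfQuiver

/-- A graded coquasitriangular Majid algebra structure on the path coalgebra `kQ(G, ρ)`, with
associator and coquasitriangular structure concentrated in degree `0`, and with the group `G` as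
group of vertices. -/
structure GradedCQTMajid (k : Type*) [Field k] {G : Type*} [CommGroup G] (ρ : G → ℕ)
    extends CoquasitriangularMajidAlgebra k (PathSpace k ρ) where
  mul_mem_degree : ∀ (m n : ℕ) (x y : PathSpace k ρ), x ∈ degree k ρ m → y ∈ degree k ρ n →
    mul (x ⊗ₜ[k] y) ∈ degree k ρ (m + n)
  one_mem_degree : one ∈ degree k ρ 0
  /-- A quasi-antipode can be chosen homogeneous of degree `0`. -/
  exists_graded_quasiAntipode : ∃ (S : PathSpace k ρ →ₗ[k] PathSpace k ρ)
    (α β : Functional k (PathSpace k ρ)), toDualQuasiBialgebra.IsQuasiAntipode S α β ∧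
      (∀ n, ∀ x ∈ degree k ρ n, S x ∈ degree k ρ n) ∧
      (∀ n, n ≠ 0 → ∀ x ∈ degree k ρ n, α.ofConv x = 0 ∧ β.ofConv x = 0)
  Φ_concentrated : ∀ (l m n : ℕ) (x y z : PathSpace k ρ), x ∈ degree k ρ l → y ∈ degree k ρ m →
    z ∈ degree k ρ n → ¬(l = 0 ∧ m = 0 ∧ n = 0) → Φ.val.ofConv (x ⊗ₜ[k] (y ⊗ₜ[k] z)) = 0
  R_concentrated : ∀ (m n : ℕ) (x y : PathSpace k ρ), x ∈ degree k ρ m → y ∈ degree k ρ n →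
    ¬(m = 0 ∧ n = 0) → R.val.ofConv (x ⊗ₜ[k] y) = 0
  vertex_mul : ∀ g h : G,
    mul (ofVertex k ρ g ⊗ₜ[k] ofVertex k ρ h) = ofVertex k ρ (g * h)

namespace GradedCQTMajid

variable {k : Type*} [Field k] {G : Type*} [CommGroup G] {ρ : G → ℕ}

/-- `F` is an isomorphism from `A` to `B`: a graded coalgebra automorphism of `kQ` that fixes all
vertices and carries unit, product, associator and coquasitriangular structure of `A` to those
of `B`. -/
structure IsIso (A B : GradedCQTMajid k ρ) (F : PathSpace k ρ ≃ₗc[k] PathSpace k ρ) : Prop where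
  map_degree : ∀ n, ∀ x, F x ∈ degree k ρ n ↔ x ∈ degree k ρ n
  map_vertex : ∀ g : G, F (ofVertex k ρ g) = ofVertex k ρ g
  map_one : F A.one = B.one
  map_mul : ∀ x y, F (A.mul (x ⊗ₜ[k] y)) = B.mul (F x ⊗ₜ[k] F y)
  map_Φ : ∀ x y z, B.Φ.val.ofConv (F x ⊗ₜ[k] (F y ⊗ₜ[k] F z)) =
    A.Φ.val.ofConv (x ⊗ₜ[k] (y ⊗ₜ[k] z))
  map_R : ∀ x y, B.R.val.ofConv (F x ⊗ₜ[k] F y) = A.R.val.ofConv (x ⊗ₜ[k] y)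

variable (k ρ) in
/-- Structures are identified if they are isomorphic over `kQ₀ = kG`. -/
def setoid : Setoid (GradedCQTMajid k ρ) where
  r A B := ∃ F, IsIso A B F
  iseqv :=
    { refl := fun A => ⟨CoalgEquiv.refl k _, by constructor <;> simp⟩
      symm := by
        rintro A B ⟨F, h⟩
        refine ⟨F.symm, ?_, ?_, ?_, ?_, ?_, ?_⟩
        · intro n x
          rw [← h.map_degree, CoalgEquiv.apply_symm_apply]
        · intro g
          rw [← h.map_vertex g, CoalgEquiv.symm_apply_apply, h.map_vertex]
        · rw [← h.map_one, CoalgEquiv.symm_apply_apply]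
        · intro x y
          have hm := h.map_mul (F.symm x) (F.symm y)
          simp only [CoalgEquiv.apply_symm_apply] at hm
          rw [← hm, CoalgEquiv.symm_apply_apply]
        · intro x y z
          rw [← h.map_Φ]
          simp
        · intro x y
          rw [← h.map_R]
          simp
      trans := by
        rintro A B C ⟨F, h⟩ ⟨F', h'⟩
        refine ⟨F.trans F', ?_, ?_, ?_, ?_, ?_, ?_⟩
        · intro n x
          simp [h.map_degree, h'.map_degree]
        · intro g
          simp [h.map_vertex, h'.map_vertex]
        · simp [h.map_one, h'.map_one]
        · intro x y
          simp [h.map_mul, h'.map_mul]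
        · intro x y z
          simp [← h.map_Φ, ← h'.map_Φ]
        · intro x y
          simp [← h.map_R, ← h'.map_R] }

end GradedCQTMajid

/-! ### The pairs `(Φ, R)` -/

/-- A normalized 3-cocycle on `G` with values in the multiplicative group of `k`. -/
structure IsNormalizedThreeCocycle {k : Type*} [Field k] {G : Type*} [CommGroup G]
    (Φ : G → G → G → k) : Prop where
  ne_zero : ∀ e f g, Φ e f g ≠ 0
  cocycle : ∀ e f g h,
    Φ e f (g * h) * Φ (e * f) g h = Φ f g h * Φ e (f * g) h * Φ e f g
  normalized : ∀ e f, Φ e 1 f = 1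

/-- The conditions on the pairs `(Φ, R)`. -/
structure IsAdmissiblePair {k : Type*} [Field k] {G : Type*} [CommGroup G] (ρ : G → ℕ)
    (Φ : G → G → G → k) (R : G → G → k) : Prop where
  isCocycle : IsNormalizedThreeCocycle Φ
  right_compat : ∀ e f g t, ρ t ≠ 0 →
    (Φ (e * g) f t * Φ g e t * Φ e t f) / (Φ (e * g) t f * Φ g t e * Φ e f t) =
      (Φ g e f * Φ g (e * f) t * Φ t e f) / (Φ (g * t) e f * Φ g t (e * f))
  bimodule_compat : ∀ e f g t, ρ t ≠ 0 →
    (Φ e g t * Φ (e * g) f t) / (Φ f g t * Φ (e * g) t f) =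
      (Φ e g f * Φ e (f * g) t * Φ g f t) / (Φ e (g * t) f * Φ g t f * Φ f g t)
  R_mul_right : ∀ f g h,
    R f (g * h) = R f g * R f h * (Φ g f h / (Φ g h f * Φ f g h))
  R_mul_left : ∀ f g h,
    R (f * g) h = R f h * R g h * (Φ h f g * Φ f g h / Φ f h g)
  R_symm : ∀ g h, R g h * R h g = 1

/-!
A coalgebra map `f` into a path coalgebra is rigid. The coefficient functional of a path `aₙ ⋯ a₁`
is the convolution product of those of its arrows, so `f` is determined by its coefficients at
paths of length at most `1` (`coalgHom_ext`). Conversely, a linear map to the span of the vertices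
and the arrows that respects sources, targets and a grading that makes the sums finite extends to a
coalgebra map (`exists_coalgHom`). The same argument shows that an identity `f(c₁) Φ(c₂) =
Φ(c₁) g(c₂)` between coalgebra maps `f`, `g` holds as soon as it holds in degrees `0` and `1`
(`convRight_eq_convLeft`). A functional `Φ` concentrated in degree `0` acts on a path by a scalar,
its value at the source or at the target (`HasSource.convRight`, `HasTarget.convLeft`). Therefore
all axioms of a Majid algebra reduce to scalar identities for vertices and for products of one
arrow with vertices.

Given an admissible pair `(Φ, R)`, let a vertex `g` act on the arrow from `x` to `t x` from the left
by the scalar `Φ(g, x, t)`, and from the right by the scalar that the commutation relation for `R`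
then forces, `R(g, t x) R(g, x)⁻¹ Φ(g, x, t)`. These actions extend to a product on `kQ`. Its
quasi-associativity comes down to three identities (`left_left`, `left_right`, `right_right`), which
follow from the cocycle identity and the two hexagon identities; the symmetry `R(g, h) R(h, g) = 1`
is what makes the commutation relation hold for an arrow on either side. The quasi-antipode has
`α = ε` and `β(g) = Φ(g, g⁻¹, g)⁻¹`, and its `S` reverses paths up to scalars. The coefficient of
`S(c₁) c₂` at a path is a sum of products of its coefficients at arrows with other factors
(`sum_sandwich`), so the antipode axioms, too, need only be checked on vertices and arrows.

Conversely, evaluating the axioms at vertices, which are group-like, gives the cocycle and the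
hexagon identities. The commutation relation for the vertex `g` and an arrow shows that
`R(g, x) R(x, g)` is the same at both ends of the arrow, so that it is `1` on a connected quiver
(`vertexR_symm`). The conditions that relate `Φ` to the ramification datum hold for every cocycle on
an abelian group (`right_compat`, `bimodule_compat`).

Finally, a structure is isomorphic to the one attached to its pair: send the arrow from `x` with
label `s` to the product of the vertex `x` with the arrow from `1` with label `s`. Multiplication by
`x⁻¹` shows that this is bijective on arrows, and quasi-associativity and the commutation relation
show that it intertwines the actions of the vertices, hence the products (`exists_isIso`).
-/

/-! ### Convolution with functionals that factor through a projection -/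

section Convolution

variable {k : Type*} [Field k] {C D V : Type*} [AddCommGroup C] [Module k C] [Coalgebra k C]
  [AddCommGroup D] [Module k D] [Coalgebra k D] [AddCommGroup V] [Module k V]

theorem Functional.mul_ofConv (φ ψ : Functional k C) (c : C) :
    (φ * ψ).ofConv c = LinearMap.mul' k k (TensorProduct.map φ.ofConv ψ.ofConv
      (Coalgebra.comul c)) := rfl

theorem Functional.one_ofConv (c : C) :
    (1 : Functional k C).ofConv c = Coalgebra.counit c := rfl

theorem IsGroupLikeElem.functional_mul {c : C} (hc : IsGroupLikeElem k c) (φ ψ : Functional k C) :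
    (φ * ψ).ofConv c = φ.ofConv c * ψ.ofConv c := by
  simp [hc.comul_eq_tmul_self]

theorem IsGroupLikeElem.tmul {c : C} {d : D} (hc : IsGroupLikeElem k c)
    (hd : IsGroupLikeElem k d) : IsGroupLikeElem k (c ⊗ₜ[k] d) where
  counit_eq_one := by simp [hc.counit_eq_one, hd.counit_eq_one]
  comul_eq_tmul_self := by
    rw [TensorProduct.comul_tmul, hc.comul_eq_tmul_self, hd.comul_eq_tmul_self]; rfl

theorem IsGroupLikeElem.inv_functional {c : C} (hc : IsGroupLikeElem k c)
    (φ : (Functional k C)ˣ) : φ⁻¹.val.ofConv c = (φ.val.ofConv c)⁻¹ := by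
  refine eq_inv_of_mul_eq_one_left ?_
  rw [← hc.functional_mul, Units.inv_mul, Functional.one_ofConv, hc.counit_eq_one]

theorem IsGroupLikeElem.functional_ne_zero {c : C} (hc : IsGroupLikeElem k c)
    (φ : (Functional k C)ˣ) : φ.val.ofConv c ≠ 0 := by
  intro h
  have := hc.functional_mul φ.val φ⁻¹.val
  rw [Units.mul_inv, Functional.one_ofConv, hc.counit_eq_one, h, zero_mul] at this
  exact one_ne_zero this

/-- `c₁ ⊗ e(c₂) = c ⊗ s`: up to the kernel of `e`, the element `c` starts at `s`. -/
def HasSource (e : C →ₗ[k] C) (c s : C) : Prop :=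
  LinearMap.lTensor C e (Coalgebra.comul c) = c ⊗ₜ[k] s

/-- `e(c₁) ⊗ c₂ = t ⊗ c`: up to the kernel of `e`, the element `c` ends at `t`. -/
def HasTarget (e : C →ₗ[k] C) (c t : C) : Prop :=
  LinearMap.rTensor C e (Coalgebra.comul c) = t ⊗ₜ[k] c

theorem HasSource.tmul {e : C →ₗ[k] C} {e' : D →ₗ[k] D} {c s : C} {d t : D}
    (hc : HasSource e c s) (hd : HasSource e' d t) :
    HasSource (TensorProduct.map e e') (c ⊗ₜ[k] d) (s ⊗ₜ[k] t) := by
  have key := LinearMap.congr_fun (TensorProduct.tensorTensorTensorComm_comp_map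
    (R := k) LinearMap.id e LinearMap.id e') (Coalgebra.comul c ⊗ₜ[k] Coalgebra.comul d)
  simp only [LinearMap.comp_apply, LinearEquiv.coe_coe, TensorProduct.map_tmul] at key
  unfold HasSource LinearMap.lTensor at *
  rw [TensorProduct.comul_tmul, TensorProduct.AlgebraTensorModule.tensorTensorTensorComm_eq,
    ← TensorProduct.map_id, ← key, hc, hd]
  rfl

theorem HasTarget.tmul {e : C →ₗ[k] C} {e' : D →ₗ[k] D} {c s : C} {d t : D}
    (hc : HasTarget e c s) (hd : HasTarget e' d t) :
    HasTarget (TensorProduct.map e e') (c ⊗ₜ[k] d) (s ⊗ₜ[k] t) := by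
  have key := LinearMap.congr_fun (TensorProduct.tensorTensorTensorComm_comp_map
    (R := k) e LinearMap.id e' LinearMap.id) (Coalgebra.comul c ⊗ₜ[k] Coalgebra.comul d)
  simp only [LinearMap.comp_apply, LinearEquiv.coe_coe, TensorProduct.map_tmul] at key
  unfold HasTarget LinearMap.rTensor at *
  rw [TensorProduct.comul_tmul, TensorProduct.AlgebraTensorModule.tensorTensorTensorComm_eq,
    ← TensorProduct.map_id, ← key, hc, hd]
  rfl

theorem HasSource.convRight {e : C →ₗ[k] C} {c s : C} (hc : HasSource e c s) (f : C →ₗ[k] V)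
    {ψ : Functional k C} (hψ : ψ.ofConv ∘ₗ e = ψ.ofConv) :
    convRight f ψ c = ψ.ofConv s • f c := by
  have : TensorProduct.map f ψ.ofConv = TensorProduct.map f ψ.ofConv ∘ₗ LinearMap.lTensor C e := by
    rw [LinearMap.map_comp_lTensor, hψ]
  rw [_root_.convRight, this]
  simp only [LinearMap.comp_apply]
  rw [show LinearMap.lTensor C e (Coalgebra.comul c) = _ from hc]
  simp

theorem HasTarget.convLeft {e : C →ₗ[k] C} {c t : C} (hc : HasTarget e c t) (f : C →ₗ[k] V)
    {ψ : Functional k C} (hψ : ψ.ofConv ∘ₗ e = ψ.ofConv) :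
    convLeft ψ f c = ψ.ofConv t • f c := by
  have : TensorProduct.map ψ.ofConv f = TensorProduct.map ψ.ofConv f ∘ₗ LinearMap.rTensor C e := by
    rw [LinearMap.map_comp_rTensor, hψ]
  rw [_root_.convLeft, this]
  simp only [LinearMap.comp_apply]
  rw [show LinearMap.rTensor C e (Coalgebra.comul c) = _ from hc]
  simp

theorem convRight_functional (φ ψ : Functional k C) : convRight φ.ofConv ψ = (φ * ψ).ofConv := by
  have : (TensorProduct.rid k k).toLinearMap = LinearMap.mul' k k := by ext; simp
  rw [convRight, this]; rfl

theorem convLeft_functional (φ ψ : Functional k C) : convLeft φ ψ.ofConv = (φ * ψ).ofConv := by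
  have : (TensorProduct.lid k k).toLinearMap = LinearMap.mul' k k := by ext; simp
  rw [convLeft, this]; rfl

theorem comp_convRight {W : Type*} [AddCommGroup W] [Module k W] (g : V →ₗ[k] W) (f : C →ₗ[k] V)
    (ψ : Functional k C) : g ∘ₗ convRight f ψ = convRight (g ∘ₗ f) ψ := by
  have h : g ∘ₗ (TensorProduct.rid k V).toLinearMap =
      (TensorProduct.rid k W).toLinearMap ∘ₗ LinearMap.rTensor k g := by ext; simp
  simp only [convRight]
  rw [← LinearMap.comp_assoc, h, LinearMap.comp_assoc, ← LinearMap.comp_assoc _ _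
    (LinearMap.rTensor k g), LinearMap.rTensor_comp_map]

theorem comp_convLeft {W : Type*} [AddCommGroup W] [Module k W] (g : V →ₗ[k] W) (f : C →ₗ[k] V)
    (ψ : Functional k C) : g ∘ₗ convLeft ψ f = convLeft ψ (g ∘ₗ f) := by
  have h : g ∘ₗ (TensorProduct.lid k V).toLinearMap =
      (TensorProduct.lid k W).toLinearMap ∘ₗ LinearMap.lTensor k g := by ext; simp
  simp only [convLeft]
  rw [← LinearMap.comp_assoc, h, LinearMap.comp_assoc, ← LinearMap.comp_assoc _ _
    (LinearMap.lTensor k g), LinearMap.lTensor_comp_map]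

theorem HasSource.mul {e : C →ₗ[k] C} {c s : C} (hc : HasSource e c s) (φ : Functional k C)
    {ψ : Functional k C} (hψ : ψ.ofConv ∘ₗ e = ψ.ofConv) :
    (φ * ψ).ofConv c = φ.ofConv c * ψ.ofConv s := by
  rw [← convRight_functional, hc.convRight _ hψ, smul_eq_mul, mul_comm]

theorem HasTarget.mul {e : C →ₗ[k] C} {c t : C} (hc : HasTarget e c t) (φ : Functional k C)
    {ψ : Functional k C} (hψ : ψ.ofConv ∘ₗ e = ψ.ofConv) :
    (ψ * φ).ofConv c = ψ.ofConv t * φ.ofConv c := by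
  rw [← convLeft_functional, hc.convLeft _ hψ, smul_eq_mul]

theorem Functional.pull_mul (f : D →ₗc[k] C) (φ ψ : Functional k C) :
    Functional.pull f.toLinearMap (φ * ψ) =
      Functional.pull f.toLinearMap φ * Functional.pull f.toLinearMap ψ :=
  WithConv.ofConv_injective (LinearMap.convMul_comp_coalgHom_distrib φ ψ f)

theorem convRight_one (f : C →ₗ[k] V) : convRight f 1 = f := by
  ext c
  have h := Coalgebra.lTensor_counit_comul (R := k) c
  have : TensorProduct.map f (1 : Functional k C).ofConv =
      LinearMap.rTensor k f ∘ₗ LinearMap.lTensor C Coalgebra.counit := by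
    rw [LinearMap.rTensor_comp_lTensor]; rfl
  simp only [convRight, LinearMap.comp_apply, this, h]
  simp

theorem convLeft_one (f : C →ₗ[k] V) : convLeft 1 f = f := by
  ext c
  have h := Coalgebra.rTensor_counit_comul (R := k) c
  have : TensorProduct.map (1 : Functional k C).ofConv f =
      LinearMap.lTensor k f ∘ₗ LinearMap.rTensor C Coalgebra.counit := by
    rw [LinearMap.lTensor_comp_rTensor]; rfl
  simp only [convLeft, LinearMap.comp_apply, this, h]
  simp

end Convolution

/-! ### Coordinates on the path coalgebra -/

namespace PathSpace

variable (k : Type*) [Field k] {G : Type*} [CommGroup G] {ρ : G → ℕ}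

/-- The coefficient functional of a path. -/
noncomputable def coord (p : Path ρ) : PathSpace k ρ →ₗ[k] k := (basis k ρ).coord p

open Classical in
theorem coord_ofPath (p q : Path ρ) : coord k p (ofPath k q) = if q = p then 1 else 0 := by
  simp [coord, ofPath, Module.Basis.coord_apply, Finsupp.single_apply]

variable {k}

theorem ext_coord {x y : PathSpace k ρ} (h : ∀ p, coord k p x = coord k p y) : x = y :=
  (basis k ρ).ext_elem h

theorem ofPath_mem_degree (p : Path ρ) : ofPath k p ∈ degree k ρ p.length :=
  Submodule.subset_span ⟨p, rfl, rfl⟩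

theorem ofVertex_mem_degree (x : G) : ofVertex k ρ x ∈ degree k ρ 0 :=
  ofPath_mem_degree (Path.vertex ρ x)

theorem mem_degree_iff {n : ℕ} {x : PathSpace k ρ} :
    x ∈ degree k ρ n ↔ ∀ p : Path ρ, p.length ≠ n → coord k p x = 0 := by
  have : {x | ∃ p : Path ρ, p.length = n ∧ ofPath k p = x} =
      basis k ρ '' {p | p.length = n} := by ext; simp [ofPath]
  rw [degree, this, Module.Basis.mem_span_image]
  constructor
  · intro h p hp
    by_contra h0
    exact hp (h (Finsupp.mem_support_iff.2 h0))
  · intro h p hp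
    by_contra h0
    exact Finsupp.mem_support_iff.1 hp (h p h0)

theorem coord_eq_zero_of_mem_degree {n : ℕ} {x : PathSpace k ρ} (hx : x ∈ degree k ρ n)
    {p : Path ρ} (hp : p.length ≠ n) : coord k p x = 0 := mem_degree_iff.1 hx p hp

/-- An element of degree `n ≤ 1` is determined by its coefficients at paths of length `≤ 1`. -/
theorem ext_of_mem_degree {n : ℕ} (hn : n ≤ 1) {x y : PathSpace k ρ} (hx : x ∈ degree k ρ n)
    (hy : y ∈ degree k ρ n) (h : ∀ p : Path ρ, p.length ≤ 1 → coord k p x = coord k p y) :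
    x = y := by
  refine ext_coord fun p => ?_
  by_cases hp : p.length = n
  · exact h p (hp ▸ hn)
  · rw [coord_eq_zero_of_mem_degree hx hp, coord_eq_zero_of_mem_degree hy hp]

theorem counit_eq_zero {x : PathSpace k ρ}
    (h : ∀ p : Path ρ, p.length = 0 → coord k p x = 0) : Coalgebra.counit (R := k) x = 0 := by
  rw [← (basis k ρ).linearCombination_repr x, Finsupp.linearCombination_apply, Finsupp.sum,
    map_sum]
  refine Finset.sum_eq_zero fun p _ => ?_
  rw [map_smul]
  by_cases hp : p.length = 0
  · rw [show (basis k ρ).repr x p = 0 from h p hp, zero_smul]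
  · rw [show Coalgebra.counit (R := k) (basis k ρ p) = 0 from
      (counit_ofPath k p).trans (if_neg hp), smul_zero]

variable (k ρ) in
open Classical in
/-- The projection of `kQ` to its degree zero part. -/
noncomputable def degreeZero : PathSpace k ρ →ₗ[k] PathSpace k ρ :=
  (basis k ρ).constr k fun p => if p.length = 0 then ofPath k p else 0

open Classical in
theorem degreeZero_ofPath (p : Path ρ) :
    degreeZero k ρ (ofPath k p) = if p.length = 0 then ofPath k p else 0 :=
  (basis k ρ).constr_basis k _ p

theorem _root_.HopfQuiver.Path.eq_vertex {p : Path ρ} (h : p.length = 0) :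
    p = Path.vertex ρ p.src := by
  rcases p with ⟨x, l⟩
  simp only [Path.length, List.length_eq_zero_iff] at h
  simp [Path.vertex, h]

@[simp] theorem _root_.HopfQuiver.Path.length_vertex (x : G) : (Path.vertex ρ x).length = 0 := rfl

@[simp] theorem _root_.HopfQuiver.Path.labels_vertex (x : G) : (Path.vertex ρ x).labels = [] := rfl

theorem isGroupLike_ofVertex (x : G) : IsGroupLikeElem k (ofVertex k ρ x) where
  counit_eq_one := by simp [ofVertex, counit_ofPath]
  comul_eq_tmul_self := by
    simp only [ofVertex, comul_ofPath, Path.length_vertex, zero_add, Finset.range_one,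
      Finset.sum_singleton, Path.final_zero]
    rfl

theorem hasSource_ofPath (p : Path ρ) :
    HasSource (degreeZero k ρ) (ofPath k p) (ofVertex k ρ p.src) := by
  classical
  simp only [HasSource, comul_ofPath, map_sum, LinearMap.lTensor_tmul, degreeZero_ofPath]
  rw [Finset.sum_eq_single_of_mem 0 (by simp)]
  · simp [Path.final_zero, ofVertex, Path.initial, Path.vertex, Path.length]
  · intro i hi hne
    rw [Finset.mem_range] at hi
    rw [Path.length_initial _ (by omega), if_neg hne, TensorProduct.tmul_zero]

theorem hasTarget_ofPath (p : Path ρ) :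
    HasTarget (degreeZero k ρ) (ofPath k p) (ofVertex k ρ p.tgt) := by
  classical
  simp only [HasTarget, comul_ofPath, map_sum, LinearMap.rTensor_tmul, degreeZero_ofPath,
    Path.length_final]
  rw [Finset.sum_eq_single_of_mem p.length (by simp)]
  · simp [ofVertex, Path.final, Path.vertex, Path.length]
    simp [Path.initial, Path.tgt]
  · intro i hi hne
    rw [Finset.mem_range] at hi
    rw [if_neg (by omega), TensorProduct.zero_tmul]

open Classical in
theorem coord_mul_coord (q r : Path ρ) :
    (WithConv.toConv (coord k q) * WithConv.toConv (coord k r) : Functional k (PathSpace k ρ)) =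
      if r.tgt = q.src then WithConv.toConv (coord k ⟨r.src, r.labels ++ q.labels⟩) else 0 := by
  refine WithConv.ofConv_injective ((basis k ρ).ext fun p => ?_)
  change (_ : Functional k _).ofConv (ofPath k p) = (_ : Functional k _).ofConv (ofPath k p)
  rw [Functional.mul_ofConv, comul_ofPath]
  simp only [map_sum, TensorProduct.map_tmul, LinearMap.mul'_apply, coord_ofPath]
  have hite : ∀ i ∈ Finset.range (p.length + 1),
      ((if p.final i = q then (1:k) else 0) * if p.initial i = r then 1 else 0) =
      if i = r.length then
        (if r.tgt = q.src ∧ p = ⟨r.src, r.labels ++ q.labels⟩ then 1 else 0) else 0 := by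
    intro i hi
    have hi : i ≤ p.length := by simpa [Nat.lt_succ_iff] using hi
    rw [ite_zero_mul_ite_zero, mul_one, ← ite_and]
    refine if_congr ?_ rfl rfl
    constructor
    · rintro ⟨rfl, rfl⟩
      refine ⟨(Path.length_initial p hi).symm, rfl, ?_⟩
      simp [Path.final, Path.initial]
    · rintro ⟨rfl, h, rfl⟩
      have : (⟨r.src, r.labels ++ q.labels⟩ : Path ρ).initial r.length = r := by
        simp [Path.initial, Path.length]
      refine ⟨?_, this⟩
      rw [Path.final, this, h]
      simp [Path.length]
  rw [Finset.sum_congr rfl hite, Finset.sum_ite_eq']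
  by_cases h : r.tgt = q.src
  · rw [if_pos h]
    simp only [coord_ofPath, h, true_and]
    rw [ite_eq_left_iff]
    intro hlt
    rw [if_neg]
    rintro rfl
    simp [Path.length] at hlt
  · simp [h]

theorem coord_cons (x : G) (s : Label ρ) (l : List (Label ρ)) :
    (WithConv.toConv (coord k ⟨x, s :: l⟩) : Functional k (PathSpace k ρ)) =
      WithConv.toConv (coord k ⟨s.1 * x, l⟩) * WithConv.toConv (coord k ⟨x, [s]⟩) := by
  rw [coord_mul_coord, if_pos (by simp [Path.tgt, Path.walk])]
  rfl

/-! ### Coalgebra maps into the path coalgebra -/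

section Uniqueness

variable {C : Type*} [AddCommGroup C] [Module k C] [Coalgebra k C]

/-- Two coalgebra maps into `kQ` are intertwined by a functional `Φ` as soon as this holds in
degrees `0` and `1`: the coefficient functional of a path is a convolution product of coefficient
functionals of arrows, and `Φ` can be moved past these one at a time. -/
theorem convRight_eq_convLeft (f g : C →ₗc[k] PathSpace k ρ) (Φ : Functional k C)
    (h : ∀ p : Path ρ, p.length ≤ 1 →
      coord k p ∘ₗ convRight f.toLinearMap Φ = coord k p ∘ₗ convLeft Φ g.toLinearMap) :
    convRight f.toLinearMap Φ = convLeft Φ g.toLinearMap := by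
  have key : ∀ (l : List (Label ρ)) (x : G),
      Functional.pull f.toLinearMap (WithConv.toConv (coord k ⟨x, l⟩)) * Φ =
        Φ * Functional.pull g.toLinearMap (WithConv.toConv (coord k ⟨x, l⟩)) := by
    have low : ∀ p : Path ρ, p.length ≤ 1 →
        Functional.pull f.toLinearMap (WithConv.toConv (coord k p)) * Φ =
        Φ * Functional.pull g.toLinearMap (WithConv.toConv (coord k p)) := by
      intro p hp
      have := h p hp
      rw [comp_convRight, comp_convLeft] at this
      refine WithConv.ofConv_injective ?_
      rw [← convRight_functional, ← convLeft_functional]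
      exact this
    intro l
    induction l with
    | nil => exact fun x => low _ (by simp [Path.length])
    | cons s l ih =>
      intro x
      rw [coord_cons, Functional.pull_mul, Functional.pull_mul, mul_assoc,
        low ⟨x, [s]⟩ (by simp [Path.length]), ← mul_assoc, ih, mul_assoc]
  ext c
  refine ext_coord fun p => ?_
  have := key p.labels p.src
  have h1 := LinearMap.congr_fun (comp_convRight (coord k p) f.toLinearMap Φ) c
  have h2 := LinearMap.congr_fun (comp_convLeft (coord k p) g.toLinearMap Φ) c
  simp only [LinearMap.comp_apply] at h1 h2
  rw [h1, h2]
  change convRight (Functional.pull f.toLinearMap (WithConv.toConv (coord k p))).ofConv Φ c =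
    convLeft Φ (Functional.pull g.toLinearMap (WithConv.toConv (coord k p))).ofConv c
  rw [convRight_functional, convLeft_functional]
  exact congrArg (fun φ : Functional k C => φ.ofConv c) this

theorem coalgHom_ext (f g : C →ₗc[k] PathSpace k ρ)
    (h : ∀ p : Path ρ, p.length ≤ 1 → ∀ c, coord k p (f c) = coord k p (g c)) : f = g := by
  have := convRight_eq_convLeft f g 1 fun p hp => by
    rw [convRight_one, convLeft_one]
    exact LinearMap.ext (h p hp)
  rw [convRight_one, convLeft_one] at this
  exact CoalgHom.ext (LinearMap.congr_fun this)

end Uniqueness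

section Existence

/-- The product of the entries `φ₁` along the path with source `x` and the given labels, in the
order in which paths are written. -/
def pathProd {A : Type*} [Mul A] (φ₀ : G → A) (φ₁ : G → Label ρ → A) : G → List (Label ρ) → A
  | x, [] => φ₀ x
  | x, s :: l => pathProd φ₀ φ₁ (s.1 * x) l * φ₁ x s

open Classical in
theorem pathProd_mul_pathProd {A : Type*} [Ring A] (φ₀ : G → A) (φ₁ : G → Label ρ → A)
    (h₀ : ∀ x y, φ₀ x * φ₀ y = if x = y then φ₀ x else 0)
    (h₁ : ∀ x s y, φ₁ x s * φ₀ y = if x = y then φ₁ x s else 0)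
    (l m : List (Label ρ)) (x y : G) :
    pathProd φ₀ φ₁ y m * pathProd φ₀ φ₁ x l =
      if Path.walk x l = y then pathProd φ₀ φ₁ x (l ++ m) else 0 := by
  induction l generalizing x with
  | nil =>
    cases m with
    | nil =>
      simp only [pathProd, Path.walk, List.foldl_nil, h₀, List.append_nil, eq_comm (a := y)]
      split_ifs with h
      · rw [h]
      · rfl
    | cons s m =>
      simp only [pathProd, Path.walk, List.foldl_nil, mul_assoc, h₁, List.nil_append,
        eq_comm (a := y)]
      split_ifs with h
      · rw [h]
      · rw [mul_zero]
  | cons s l ih =>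
    rw [pathProd, ← mul_assoc, ih, ite_mul, zero_mul]
    rfl

variable {C : Type*} [AddCommGroup C] [Module k C] [Coalgebra k C]

theorem finite_paths (x : G) (M : Multiset G) :
    {p : Path ρ | p.src = x ∧ (p.labels.map Sigma.fst : Multiset G) = M}.Finite := by
  classical
  let T : Type _ := Σ c : {c // c ∈ M}, Fin (ρ c)
  let ι : T → Label ρ := fun t => ⟨t.1.1, t.2⟩
  refine ((List.finite_length_eq T (Multiset.card M)).image
    fun l => (⟨x, l.map ι⟩ : Path ρ)).subset ?_
  rintro ⟨_, l⟩ ⟨rfl, hM⟩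
  have hl : ∀ s ∈ l, s.1 ∈ M := by
    intro s hs
    rw [← hM]
    exact Multiset.mem_coe.2 (List.mem_map_of_mem hs)
  refine ⟨l.attach.map fun s => ⟨⟨s.1.1, hl s.1 s.2⟩, s.1.2⟩, ?_, ?_⟩
  · simp [← hM]
  · simp only [List.map_map]
    congr 1
    exact (List.attach_map_subtype_val l)

/-- Existence of coalgebra maps into `kQ`. The source `C` has a basis whose members have a source,
a target (with respect to a projection `e`) and a content that is additive under the coproduct.
A linear map `low` to paths of length at most `1` that preserves these data extends to a
coalgebra map; the coefficient functionals of the extension are convolution products of those of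
`low`. -/
theorem exists_coalgHom {I : Type*} (b : Module.Basis I k C) (e : C →ₗ[k] C) (src tgt : I → C)
    (sv tv : I → G) (content : I → Multiset G)
    (hsrc : ∀ i, HasSource e (b i) (src i)) (htgt : ∀ i, HasTarget e (b i) (tgt i))
    (hcontent : ∀ i, Coalgebra.comul (b i) ∈
      Submodule.span k {z | ∃ j l, content j + content l = content i ∧ b j ⊗ₜ[k] b l = z})
    (low : C →ₗ[k] PathSpace k ρ)
    (hlow_e : ∀ x, coord k ⟨x, []⟩ ∘ₗ low ∘ₗ e = coord k ⟨x, []⟩ ∘ₗ low)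
    (hlow_src : ∀ i, low (src i) = ofVertex k ρ (sv i))
    (hlow_tgt : ∀ i, low (tgt i) = ofVertex k ρ (tv i))
    (hlow : ∀ i (p : Path ρ), p.length ≤ 1 → coord k p (low (b i)) ≠ 0 →
      p.src = sv i ∧ p.tgt = tv i ∧ (p.labels.map Sigma.fst : Multiset G) = content i)
    (hlow_counit : ∀ i, Coalgebra.counit (R := k) (low (b i)) = Coalgebra.counit (R := k) (b i)) :
    ∃ f : C →ₗc[k] PathSpace k ρ,
      (∀ (p : Path ρ), p.length ≤ 1 → ∀ c, coord k p (f c) = coord k p (low c)) ∧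
      ∀ (p : Path ρ) i, coord k p (f (b i)) ≠ 0 →
        p.src = sv i ∧ (p.labels.map Sigma.fst : Multiset G) = content i := by
  classical
  let φ₀ : G → Functional k C := fun x => WithConv.toConv (coord k ⟨x, []⟩ ∘ₗ low)
  let φ₁ : G → Label ρ → Functional k C := fun x s => WithConv.toConv (coord k ⟨x, [s]⟩ ∘ₗ low)
  have hsrc' : ∀ (u : Functional k C) (y : G) i,
      (u * φ₀ y).ofConv (b i) = if sv i = y then u.ofConv (b i) else 0 := by
    intro u y i
    rw [(hsrc i).mul u (ψ := φ₀ y) (hlow_e y)]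
    change _ * coord k _ (low (src i)) = _
    rw [hlow_src, ofVertex, coord_ofPath, mul_ite, mul_one, mul_zero]
    simp [Path.vertex]
  have htgt' : ∀ (u : Functional k C) (y : G) i,
      (φ₀ y * u).ofConv (b i) = if tv i = y then u.ofConv (b i) else 0 := by
    intro u y i
    rw [(htgt i).mul u (ψ := φ₀ y) (hlow_e y)]
    change coord k _ (low (tgt i)) * _ = _
    rw [hlow_tgt, ofVertex, coord_ofPath, ite_mul, one_mul, zero_mul]
    simp [Path.vertex]
  have hext : ∀ u v : Functional k C, (∀ i, u.ofConv (b i) = v.ofConv (b i)) → u = v :=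
    fun u v h => WithConv.ofConv_injective (b.ext h)
  have h₀ : ∀ x y, φ₀ x * φ₀ y = if x = y then φ₀ x else 0 := by
    refine fun x y => hext _ _ fun i => ?_
    rw [hsrc']
    by_cases h : (φ₀ x).ofConv (b i) = 0
    · split_ifs <;> simp [h]
    · rw [← (hlow i ⟨x, []⟩ (by simp [Path.length]) h).1]
      split_ifs <;> rfl
  have h₁ : ∀ x s y, φ₁ x s * φ₀ y = if x = y then φ₁ x s else 0 := by
    refine fun x s y => hext _ _ fun i => ?_
    rw [hsrc']
    by_cases h : (φ₁ x s).ofConv (b i) = 0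
    · split_ifs <;> simp [h]
    · rw [← (hlow i ⟨x, [s]⟩ (by simp [Path.length]) h).1]
      split_ifs <;> rfl
  have h₂ : ∀ x s, φ₀ (s.1 * x) * φ₁ x s = φ₁ x s := by
    refine fun x s => hext _ _ fun i => ?_
    rw [htgt']
    by_cases h : (φ₁ x s).ofConv (b i) = 0
    · split_ifs <;> simp [h]
    · exact if_pos (hlow i ⟨x, [s]⟩ (by simp [Path.length]) h).2.1.symm
  have hmul := pathProd_mul_pathProd φ₀ φ₁ h₀ h₁
  -- the content of a basis element bounds the paths that occur in its image
  have hcont : ∀ (l : List (Label ρ)) (x : G) i, (pathProd φ₀ φ₁ x l).ofConv (b i) ≠ 0 →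
      (l.map Sigma.fst : Multiset G) = content i := by
    intro l
    induction l with
    | nil => exact fun x i h => (hlow i ⟨x, []⟩ (by simp [Path.length]) h).2.2
    | cons s l ih =>
      intro x i h
      by_contra hne
      refine h ?_
      rw [pathProd, Functional.mul_ofConv]
      refine Submodule.span_induction (p := fun z _ => LinearMap.mul' k k (TensorProduct.map
        (pathProd φ₀ φ₁ (s.1 * x) l).ofConv (φ₁ x s).ofConv z) = 0) ?_ ?_ ?_ ?_ (hcontent i)
      · rintro _ ⟨j, m, hjm, rfl⟩
        rw [TensorProduct.map_tmul, LinearMap.mul'_apply]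
        by_contra h0
        have h1 := ih _ _ (left_ne_zero_of_mul h0)
        have h2 := (hlow m ⟨x, [s]⟩ (by simp [Path.length]) (right_ne_zero_of_mul h0)).2.2
        refine hne ?_
        rw [← hjm, ← h1, ← h2, List.map_cons, Multiset.coe_add, Multiset.coe_eq_coe]
        exact (List.perm_append_singleton _ _).symm
      · simp
      · intro u v _ _ hu hv
        rw [map_add, map_add, hu, hv, add_zero]
      · intro a u _ hu
        rw [map_smul, map_smul, hu, smul_zero]
  have hsupp : ∀ i (p : Path ρ), (pathProd φ₀ φ₁ p.src p.labels).ofConv (b i) ≠ 0 →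
      p.src = sv i ∧ (p.labels.map Sigma.fst : Multiset G) = content i := by
    refine fun i p h => ⟨?_, hcont _ _ _ h⟩
    have := hmul [] p.labels p.src p.src
    rw [if_pos (by simp [Path.walk]), List.nil_append] at this
    rw [← this, pathProd, hsrc'] at h
    by_contra hne
    exact h (if_neg fun h => hne h.symm)
  have hfin : ∀ c : C, {p : Path ρ | (pathProd φ₀ φ₁ p.src p.labels).ofConv c ≠ 0}.Finite := by
    intro c
    induction b.mem_span c using Submodule.span_induction with
    | zero => simp
    | add u v _ _ hu hv =>
      refine (hu.union hv).subset fun p hp => ?_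
      by_contra hcon
      simp only [Set.mem_union, Set.mem_ofPred_eq, not_or, not_not] at hcon hp
      exact hp (by rw [map_add, hcon.1, hcon.2, add_zero])
    | smul a u _ hu =>
      refine hu.subset fun p hp => ?_
      simp only [Set.mem_ofPred_eq, map_smul] at hp
      exact right_ne_zero_of_smul hp
    | mem x hx =>
      obtain ⟨i, rfl⟩ := hx
      exact (finite_paths (sv i) (content i)).subset fun p hp => hsupp i p hp
  let f : C →ₗ[k] PathSpace k ρ :=
    { toFun := fun c => (Finsupp.ofSupportFinite
        (fun p : Path ρ => (pathProd φ₀ φ₁ p.src p.labels).ofConv c) (hfin c) : Path ρ →₀ k)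
      map_add' := fun u v => by
        refine ext_coord fun p => ?_
        exact (pathProd φ₀ φ₁ p.src p.labels).ofConv.map_add u v
      map_smul' := fun a u => by
        refine ext_coord fun p => ?_
        exact (pathProd φ₀ φ₁ p.src p.labels).ofConv.map_smul a u }
  have hf : ∀ p c, coord k p (f c) = (pathProd φ₀ φ₁ p.src p.labels).ofConv c := fun p c => rfl
  have hflow : ∀ p : Path ρ, p.length ≤ 1 → ∀ c, coord k p (f c) = coord k p (low c) := by
    rintro ⟨x, _ | ⟨s, _ | ⟨s', l⟩⟩⟩ hp c
    · rfl
    · rw [hf]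
      exact congrArg (fun φ : Functional k C => φ.ofConv c) (h₂ x s)
    · simp [Path.length] at hp
  refine ⟨{ f with
    counit_comp := b.ext fun i => ?_
    map_comp_comul := ?_ }, hflow, fun p i h => hsupp i p h⟩
  · rw [← hlow_counit, LinearMap.comp_apply, ← sub_eq_zero, ← map_sub]
    refine counit_eq_zero fun p hp => ?_
    rw [map_sub, sub_eq_zero]
    exact hflow p (by omega) _
  · refine LinearMap.ext fun c => ?_
    refine ((basis k ρ).tensorProduct (basis k ρ)).ext_elem fun ⟨q, r⟩ => ?_
    have hrepr : ∀ z : PathSpace k ρ ⊗[k] PathSpace k ρ,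
        ((basis k ρ).tensorProduct (basis k ρ)).repr z (q, r) =
          LinearMap.mul' k k (TensorProduct.map (coord k q) (coord k r) z) := by
      intro z
      induction z with
      | zero => simp
      | add u v hu hv => simp [hu, hv]
      | tmul u v => simp [coord, Module.Basis.coord_apply, mul_comm]
    rw [hrepr, hrepr]
    have h1 := congrArg (fun φ : Functional k (PathSpace k ρ) => φ.ofConv (f c))
      (coord_mul_coord (k := k) q r)
    have h2 := congrArg (fun φ : Functional k C => φ.ofConv c)
      (hmul r.labels q.labels r.src q.src)
    simp only [Functional.mul_ofConv] at h1 h2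
    rw [LinearMap.comp_apply, LinearMap.comp_apply]
    refine Eq.trans ?_ (h2.trans (Eq.trans ?_ h1.symm))
    · rw [← LinearMap.comp_apply (TensorProduct.map _ _) (TensorProduct.map _ _),
        ← TensorProduct.map_comp]
      rfl
    · change _ = (ite (Path.walk r.src r.labels = q.src) _ _ : Functional k _).ofConv (f c)
      split_ifs
      · rfl
      · rfl

end Existence

end PathSpace

/-! ### Tensor powers of the path coalgebra -/

namespace PathSpace

section Tensor

variable {k : Type*} [Field k] {G : Type*} [CommGroup G] {ρ : G → ℕ}

variable (k ρ) in
/-- The arrow with source `x` and label `s` as an element of `kQ`. -/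
noncomputable def ofArrow (x : G) (s : Label ρ) : PathSpace k ρ := ofPath k ⟨x, [s]⟩

theorem ofArrow_mem_degree (x : G) (s : Label ρ) : ofArrow k ρ x s ∈ degree k ρ 1 :=
  ofPath_mem_degree ⟨x, [s]⟩

variable (k ρ) in
/-- The basis of `kQ ⊗ kQ` given by pairs of paths. -/
noncomputable def basis₂ : Module.Basis (Path ρ × Path ρ) k (PathSpace k ρ ⊗[k] PathSpace k ρ) :=
  (basis k ρ).tensorProduct (basis k ρ)

variable (k ρ) in
/-- The basis of `kQ ⊗ kQ ⊗ kQ` given by triples of paths. -/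
noncomputable def basis₃ : Module.Basis (Path ρ × Path ρ × Path ρ) k
    (PathSpace k ρ ⊗[k] (PathSpace k ρ ⊗[k] PathSpace k ρ)) :=
  (basis k ρ).tensorProduct (basis₂ k ρ)

theorem basis₂_apply (p q : Path ρ) : basis₂ k ρ (p, q) = ofPath k p ⊗ₜ[k] ofPath k q :=
  Module.Basis.tensorProduct_apply _ _ _ _

theorem basis₃_apply (p q r : Path ρ) :
    basis₃ k ρ (p, q, r) = ofPath k p ⊗ₜ[k] (ofPath k q ⊗ₜ[k] ofPath k r) := by
  rw [basis₃, Module.Basis.tensorProduct_apply, basis₂_apply]; rfl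

variable {V : Type*} [AddCommGroup V] [Module k V]

theorem ext₁ {f g : PathSpace k ρ →ₗ[k] V} (h : ∀ p, f (ofPath k p) = g (ofPath k p)) : f = g :=
  (basis k ρ).ext h

theorem ext₂ {f g : PathSpace k ρ ⊗[k] PathSpace k ρ →ₗ[k] V}
    (h : ∀ p q, f (ofPath k p ⊗ₜ[k] ofPath k q) = g (ofPath k p ⊗ₜ[k] ofPath k q)) : f = g :=
  (basis₂ k ρ).ext fun ⟨p, q⟩ => by rw [basis₂_apply]; exact h p q

theorem ext₃ {f g : PathSpace k ρ ⊗[k] (PathSpace k ρ ⊗[k] PathSpace k ρ) →ₗ[k] V}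
    (h : ∀ p q r, f (ofPath k p ⊗ₜ[k] (ofPath k q ⊗ₜ[k] ofPath k r)) =
      g (ofPath k p ⊗ₜ[k] (ofPath k q ⊗ₜ[k] ofPath k r))) : f = g :=
  (basis₃ k ρ).ext fun ⟨p, q, r⟩ => by rw [basis₃_apply]; exact h p q r

theorem ext₄ {f g : PathSpace k ρ ⊗[k] (PathSpace k ρ ⊗[k] (PathSpace k ρ ⊗[k] PathSpace k ρ))
      →ₗ[k] V}
    (h : ∀ p q r t, f (ofPath k p ⊗ₜ[k] (ofPath k q ⊗ₜ[k] (ofPath k r ⊗ₜ[k] ofPath k t))) =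
      g (ofPath k p ⊗ₜ[k] (ofPath k q ⊗ₜ[k] (ofPath k r ⊗ₜ[k] ofPath k t)))) : f = g :=
  ((basis k ρ).tensorProduct (basis₃ k ρ)).ext fun ⟨p, q, r, t⟩ => by
    rw [Module.Basis.tensorProduct_apply, basis₃_apply]; exact h p q r t

variable (k ρ) in
/-- The projection of `kQ ⊗ kQ` to its degree zero part. -/
noncomputable def degreeZero₂ :
    PathSpace k ρ ⊗[k] PathSpace k ρ →ₗ[k] PathSpace k ρ ⊗[k] PathSpace k ρ :=
  TensorProduct.map (degreeZero k ρ) (degreeZero k ρ)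

variable (k ρ) in
/-- The projection of `kQ ⊗ kQ ⊗ kQ` to its degree zero part. -/
noncomputable def degreeZero₃ : PathSpace k ρ ⊗[k] (PathSpace k ρ ⊗[k] PathSpace k ρ) →ₗ[k]
    PathSpace k ρ ⊗[k] (PathSpace k ρ ⊗[k] PathSpace k ρ) :=
  TensorProduct.map (degreeZero k ρ) (degreeZero₂ k ρ)

variable (k ρ) in
/-- The projection of `kQ ⊗ kQ ⊗ kQ ⊗ kQ` to its degree zero part. -/
noncomputable def degreeZero₄ :
    PathSpace k ρ ⊗[k] (PathSpace k ρ ⊗[k] (PathSpace k ρ ⊗[k] PathSpace k ρ)) →ₗ[k]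
    PathSpace k ρ ⊗[k] (PathSpace k ρ ⊗[k] (PathSpace k ρ ⊗[k] PathSpace k ρ)) :=
  TensorProduct.map (degreeZero k ρ) (degreeZero₃ k ρ)

theorem degreeZero_ofPath_eq_zero {p : Path ρ} (hp : p.length ≠ 0) :
    degreeZero k ρ (ofPath k p) = 0 := by
  rw [degreeZero_ofPath, if_neg hp]

theorem degreeZero_ofPath_eq {p : Path ρ} (hp : p.length = 0) :
    degreeZero k ρ (ofPath k p) = ofPath k p := by
  rw [degreeZero_ofPath, if_pos hp]

theorem comp_degreeZero {ψ : PathSpace k ρ →ₗ[k] V}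
    (h : ∀ p : Path ρ, p.length ≠ 0 → ψ (ofPath k p) = 0) : ψ ∘ₗ degreeZero k ρ = ψ := by
  refine ext₁ fun p => ?_
  rw [LinearMap.comp_apply]
  by_cases hp : p.length = 0
  · rw [degreeZero_ofPath_eq hp]
  · rw [degreeZero_ofPath_eq_zero hp, map_zero, h p hp]

theorem comp_degreeZero₂ {ψ : PathSpace k ρ ⊗[k] PathSpace k ρ →ₗ[k] V}
    (h : ∀ p q : Path ρ, ¬(p.length = 0 ∧ q.length = 0) → ψ (ofPath k p ⊗ₜ[k] ofPath k q) = 0) :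
    ψ ∘ₗ degreeZero₂ k ρ = ψ := by
  refine ext₂ fun p q => ?_
  rw [LinearMap.comp_apply, degreeZero₂, TensorProduct.map_tmul]
  by_cases hp : p.length = 0
  · by_cases hq : q.length = 0
    · rw [degreeZero_ofPath_eq hp, degreeZero_ofPath_eq hq]
    · rw [degreeZero_ofPath_eq_zero hq, TensorProduct.tmul_zero, map_zero, h p q (by tauto)]
  · rw [degreeZero_ofPath_eq_zero hp, TensorProduct.zero_tmul, map_zero, h p q (by tauto)]

theorem comp_degreeZero₃ {ψ : PathSpace k ρ ⊗[k] (PathSpace k ρ ⊗[k] PathSpace k ρ) →ₗ[k] V}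
    (h : ∀ p q r : Path ρ, ¬(p.length = 0 ∧ q.length = 0 ∧ r.length = 0) →
      ψ (ofPath k p ⊗ₜ[k] (ofPath k q ⊗ₜ[k] ofPath k r)) = 0) :
    ψ ∘ₗ degreeZero₃ k ρ = ψ := by
  refine ext₃ fun p q r => ?_
  rw [LinearMap.comp_apply, degreeZero₃, degreeZero₂, TensorProduct.map_tmul,
    TensorProduct.map_tmul]
  by_cases hpqr : p.length = 0 ∧ q.length = 0 ∧ r.length = 0
  · rw [degreeZero_ofPath_eq hpqr.1, degreeZero_ofPath_eq hpqr.2.1,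
      degreeZero_ofPath_eq hpqr.2.2]
  · rw [h p q r hpqr]
    have : p.length ≠ 0 ∨ q.length ≠ 0 ∨ r.length ≠ 0 := by tauto
    rcases this with hp | hp | hp <;> simp [degreeZero_ofPath_eq_zero hp]

theorem comp_degreeZero₄
    {ψ : PathSpace k ρ ⊗[k] (PathSpace k ρ ⊗[k] (PathSpace k ρ ⊗[k] PathSpace k ρ)) →ₗ[k] V}
    (h : ∀ p q r t : Path ρ, ¬(p.length = 0 ∧ q.length = 0 ∧ r.length = 0 ∧ t.length = 0) →
      ψ (ofPath k p ⊗ₜ[k] (ofPath k q ⊗ₜ[k] (ofPath k r ⊗ₜ[k] ofPath k t))) = 0) :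
    ψ ∘ₗ degreeZero₄ k ρ = ψ := by
  refine ext₄ fun p q r t => ?_
  rw [LinearMap.comp_apply, degreeZero₄, degreeZero₃, degreeZero₂, TensorProduct.map_tmul,
    TensorProduct.map_tmul, TensorProduct.map_tmul]
  by_cases hpqr : p.length = 0 ∧ q.length = 0 ∧ r.length = 0 ∧ t.length = 0
  · rw [degreeZero_ofPath_eq hpqr.1, degreeZero_ofPath_eq hpqr.2.1,
      degreeZero_ofPath_eq hpqr.2.2.1, degreeZero_ofPath_eq hpqr.2.2.2]
  · rw [h p q r t hpqr]
    have : p.length ≠ 0 ∨ q.length ≠ 0 ∨ r.length ≠ 0 ∨ t.length ≠ 0 := by tauto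
    rcases this with hp | hp | hp | hp <;> simp [degreeZero_ofPath_eq_zero hp]

theorem hasSource₂ (p q : Path ρ) : HasSource (degreeZero₂ k ρ) (ofPath k p ⊗ₜ[k] ofPath k q)
    (ofVertex k ρ p.src ⊗ₜ[k] ofVertex k ρ q.src) :=
  (hasSource_ofPath p).tmul (hasSource_ofPath q)

theorem hasTarget₂ (p q : Path ρ) : HasTarget (degreeZero₂ k ρ) (ofPath k p ⊗ₜ[k] ofPath k q)
    (ofVertex k ρ p.tgt ⊗ₜ[k] ofVertex k ρ q.tgt) :=
  (hasTarget_ofPath p).tmul (hasTarget_ofPath q)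

theorem hasSource₃ (p q r : Path ρ) :
    HasSource (degreeZero₃ k ρ) (ofPath k p ⊗ₜ[k] (ofPath k q ⊗ₜ[k] ofPath k r))
    (ofVertex k ρ p.src ⊗ₜ[k] (ofVertex k ρ q.src ⊗ₜ[k] ofVertex k ρ r.src)) :=
  (hasSource_ofPath p).tmul (hasSource₂ q r)

theorem hasTarget₃ (p q r : Path ρ) :
    HasTarget (degreeZero₃ k ρ) (ofPath k p ⊗ₜ[k] (ofPath k q ⊗ₜ[k] ofPath k r))
    (ofVertex k ρ p.tgt ⊗ₜ[k] (ofVertex k ρ q.tgt ⊗ₜ[k] ofVertex k ρ r.tgt)) :=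
  (hasTarget_ofPath p).tmul (hasTarget₂ q r)

theorem hasSource₄ (p q r t : Path ρ) : HasSource (degreeZero₄ k ρ)
    (ofPath k p ⊗ₜ[k] (ofPath k q ⊗ₜ[k] (ofPath k r ⊗ₜ[k] ofPath k t)))
    (ofVertex k ρ p.src ⊗ₜ[k] (ofVertex k ρ q.src ⊗ₜ[k]
      (ofVertex k ρ r.src ⊗ₜ[k] ofVertex k ρ t.src))) :=
  (hasSource_ofPath p).tmul (hasSource₃ q r t)

theorem comul_ofPath_tmul (p q : Path ρ) :
    Coalgebra.comul (R := k) (ofPath k p ⊗ₜ[k] ofPath k q) =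
      ∑ i ∈ Finset.range (p.length + 1), ∑ j ∈ Finset.range (q.length + 1),
        (ofPath k (p.final i) ⊗ₜ[k] ofPath k (q.final j)) ⊗ₜ[k]
          (ofPath k (p.initial i) ⊗ₜ[k] ofPath k (q.initial j)) := by
  rw [TensorProduct.comul_tmul, TensorProduct.AlgebraTensorModule.tensorTensorTensorComm_eq,
    comul_ofPath, comul_ofPath, TensorProduct.sum_tmul, map_sum]
  refine Finset.sum_congr rfl fun i _ => ?_
  rw [TensorProduct.tmul_sum, map_sum]
  rfl

/-- Linear maps to `kQ` that are homogeneous on a basis have the same coefficients at paths of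
length at most `1` if they agree on the basis elements of degree at most `1`. -/
theorem coord_comp_eq {C I : Type*} [AddCommGroup C] [Module k C] (b : Module.Basis I k C)
    (deg : I → ℕ) {f g : C →ₗ[k] PathSpace k ρ} (hf : ∀ i, f (b i) ∈ degree k ρ (deg i))
    (hg : ∀ i, g (b i) ∈ degree k ρ (deg i)) (h : ∀ i, deg i ≤ 1 → f (b i) = g (b i))
    (p : Path ρ) (hp : p.length ≤ 1) : coord k p ∘ₗ f = coord k p ∘ₗ g := by
  refine b.ext fun i => ?_
  rw [LinearMap.comp_apply, LinearMap.comp_apply]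
  by_cases hi : deg i ≤ 1
  · rw [h i hi]
  · rw [coord_eq_zero_of_mem_degree (hf i) (by omega),
      coord_eq_zero_of_mem_degree (hg i) (by omega)]

theorem _root_.HopfQuiver.Path.eq_arrow {p : Path ρ} (h : p.length = 1) :
    ∃ x s, p = ⟨x, [s]⟩ := by
  rcases p with ⟨x, l⟩
  obtain ⟨s, rfl⟩ := List.length_eq_one_iff.1 h
  exact ⟨x, s, rfl⟩

/-- A bilinear product on `kQ` that is homogeneous on paths is homogeneous. -/
theorem mem_degree_of_ofPath {m : PathSpace k ρ ⊗[k] PathSpace k ρ →ₗ[k] PathSpace k ρ}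
    (hm : ∀ p q : Path ρ, m (ofPath k p ⊗ₜ[k] ofPath k q) ∈ degree k ρ (p.length + q.length))
    (i j : ℕ) (x y : PathSpace k ρ) (hx : x ∈ degree k ρ i) (hy : y ∈ degree k ρ j) :
    m (x ⊗ₜ[k] y) ∈ degree k ρ (i + j) := by
  induction hx using Submodule.span_induction with
  | zero => simp
  | add u v _ _ hu hv => rw [TensorProduct.add_tmul, map_add]; exact add_mem hu hv
  | smul a u _ hu => rw [← TensorProduct.smul_tmul', map_smul]; exact Submodule.smul_mem _ _ hu
  | mem x hx =>
    obtain ⟨p, rfl, rfl⟩ := hx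
    induction hy using Submodule.span_induction with
    | zero => simp
    | add u v _ _ hu hv => rw [TensorProduct.tmul_add, map_add]; exact add_mem hu hv
    | smul a u _ hu => rw [TensorProduct.tmul_smul, map_smul]; exact Submodule.smul_mem _ _ hu
    | mem y hy =>
      obtain ⟨q, rfl, rfl⟩ := hy
      exact hm p q

end Tensor

/-! ### Extending maps of degree at most one to coalgebra maps -/

section Extension

variable {k : Type*} [Field k] {G : Type*} [CommGroup G] {ρ : G → ℕ}

theorem coe_map_final_add_initial (p : Path ρ) (i : ℕ) :
    ((p.final i).labels.map Sigma.fst : Multiset G) + ((p.initial i).labels.map Sigma.fst) =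
      (p.labels.map Sigma.fst : Multiset G) := by
  rw [add_comm]
  simp only [Path.final, Path.initial, Multiset.coe_add]
  rw [← List.map_append, List.take_append_drop]

theorem length_eq_card (p : Path ρ) :
    p.length = Multiset.card (p.labels.map Sigma.fst : Multiset G) := by
  simp [Path.length]

/-- The product on `kQ` with prescribed, diagonal actions of the vertices on the arrows. -/
theorem exists_product (L : G → G → Label ρ → k) (Rt : G → Label ρ → G → k) :
    ∃ m : PathSpace k ρ ⊗[k] PathSpace k ρ →ₗc[k] PathSpace k ρ,
      (∀ p q : Path ρ, m (ofPath k p ⊗ₜ[k] ofPath k q) ∈ degree k ρ (p.length + q.length)) ∧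
      (∀ x y, m (ofVertex k ρ x ⊗ₜ[k] ofVertex k ρ y) = ofVertex k ρ (x * y)) ∧
      (∀ g x s, m (ofVertex k ρ g ⊗ₜ[k] ofArrow k ρ x s) = L g x s • ofArrow k ρ (g * x) s) ∧
      (∀ x s g, m (ofArrow k ρ x s ⊗ₜ[k] ofVertex k ρ g) = Rt x s g • ofArrow k ρ (x * g) s) := by
  classical
  let lowFun : Path ρ × Path ρ → PathSpace k ρ := fun i =>
    match i with
    | (⟨x, []⟩, ⟨y, []⟩) => ofVertex k ρ (x * y)
    | (⟨x, []⟩, ⟨y, [s]⟩) => L x y s • ofArrow k ρ (x * y) s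
    | (⟨x, [s]⟩, ⟨y, []⟩) => Rt x s y • ofArrow k ρ (x * y) s
    | _ => 0
  let low := (basis₂ k ρ).constr k lowFun
  have hlow : ∀ p q : Path ρ, low (ofPath k p ⊗ₜ[k] ofPath k q) = lowFun (p, q) := by
    intro p q
    rw [← basis₂_apply]
    exact (basis₂ k ρ).constr_basis k _ _
  have hlow₀ : ∀ x y, low (ofVertex k ρ x ⊗ₜ[k] ofVertex k ρ y) = ofVertex k ρ (x * y) :=
    fun x y => hlow _ _
  obtain ⟨f, hf, hf'⟩ := exists_coalgHom (basis₂ k ρ) (degreeZero₂ k ρ)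
    (fun i => ofVertex k ρ i.1.src ⊗ₜ[k] ofVertex k ρ i.2.src)
    (fun i => ofVertex k ρ i.1.tgt ⊗ₜ[k] ofVertex k ρ i.2.tgt)
    (fun i => i.1.src * i.2.src) (fun i => i.1.tgt * i.2.tgt)
    (fun i => (i.1.labels.map Sigma.fst : Multiset G) + i.2.labels.map Sigma.fst)
    (fun ⟨p, q⟩ => by rw [basis₂_apply]; exact hasSource₂ p q)
    (fun ⟨p, q⟩ => by rw [basis₂_apply]; exact hasTarget₂ p q)
    (fun ⟨p, q⟩ => by
      rw [basis₂_apply, comul_ofPath_tmul]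
      refine Submodule.sum_mem _ fun i _ => Submodule.sum_mem _ fun j _ =>
        Submodule.subset_span ⟨(p.final i, q.final j), (p.initial i, q.initial j), ?_, ?_⟩
      · rw [add_add_add_comm, coe_map_final_add_initial, coe_map_final_add_initial]
      · rw [basis₂_apply, basis₂_apply])
    low
    (fun z => by
      rw [← LinearMap.comp_assoc]
      refine comp_degreeZero₂ ?_
      rintro ⟨x, _ | ⟨s, _ | ⟨s', l⟩⟩⟩ ⟨y, _ | ⟨r, _ | ⟨r', m⟩⟩⟩ hpq <;>
        simp [hlow, lowFun, Path.length, ofArrow, coord_ofPath] at hpq ⊢)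
    (fun i => hlow₀ _ _) (fun i => hlow₀ _ _)
    (by
      rintro ⟨⟨x, _ | ⟨s, _ | ⟨s', l⟩⟩⟩, ⟨y, _ | ⟨r, _ | ⟨r', m⟩⟩⟩⟩ p hp h <;>
        simp only [basis₂_apply, hlow, lowFun, ofArrow, ofVertex, map_smul, map_zero, ne_eq,
          not_true_eq_false, coord_ofPath, smul_eq_mul, mul_ite, mul_one, mul_zero,
          ite_eq_right_iff, one_ne_zero, imp_false, not_not, not_forall] at h
      · subst h
        simp [Path.vertex, Path.tgt, Path.walk]
      · obtain ⟨rfl, h⟩ := h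
        simp [Path.tgt, Path.walk, mul_left_comm]
      · obtain ⟨rfl, h⟩ := h
        simp [Path.tgt, Path.walk, mul_assoc])
    (by
      rintro ⟨⟨x, _ | ⟨s, _ | ⟨s', l⟩⟩⟩, ⟨y, _ | ⟨r, _ | ⟨r', m⟩⟩⟩⟩ <;>
        simp [basis₂_apply, hlow, lowFun, ofArrow, ofVertex, counit_ofPath, Path.length])
  have hdeg : ∀ p q : Path ρ,
      f (ofPath k p ⊗ₜ[k] ofPath k q) ∈ degree k ρ (p.length + q.length) := by
    intro p q
    refine mem_degree_iff.2 fun r hr => ?_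
    by_contra h
    rw [← basis₂_apply] at h
    refine hr ?_
    have hc := congrArg Multiset.card (hf' r (p, q) h).2
    rwa [Multiset.card_add, ← length_eq_card, ← length_eq_card, ← length_eq_card] at hc
  refine ⟨f, hdeg, fun x y => ?_, fun g x s => ?_, fun x s g => ?_⟩
  · refine ext_of_mem_degree zero_le_one (hdeg (Path.vertex ρ x) (Path.vertex ρ y))
      (ofVertex_mem_degree _) fun p hp => ?_
    rw [← hlow₀]
    exact hf p hp _
  · refine ext_of_mem_degree le_rfl (hdeg (Path.vertex ρ g) ⟨x, [s]⟩)
      (Submodule.smul_mem _ _ (ofArrow_mem_degree _ _)) fun p hp => ?_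
    exact (hf p hp _).trans (congrArg _ (hlow (Path.vertex ρ g) ⟨x, [s]⟩))
  · refine ext_of_mem_degree le_rfl (hdeg ⟨x, [s]⟩ (Path.vertex ρ g))
      (Submodule.smul_mem _ _ (ofArrow_mem_degree _ _)) fun p hp => ?_
    exact (hf p hp _).trans (congrArg _ (hlow ⟨x, [s]⟩ (Path.vertex ρ g)))

/-- The coalgebra endomorphism of `kQ` that fixes the vertices and acts on the arrows from `x` to
`t * x` by the matrix `M x t`. -/
theorem exists_endomorphism (M : ∀ (_ : G) (t : G), Matrix (Fin (ρ t)) (Fin (ρ t)) k) :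
    ∃ f : PathSpace k ρ →ₗc[k] PathSpace k ρ,
      (∀ n, ∀ z ∈ degree k ρ n, f z ∈ degree k ρ n) ∧
      (∀ x, f (ofVertex k ρ x) = ofVertex k ρ x) ∧
      ∀ x t i, f (ofArrow k ρ x ⟨t, i⟩) = ∑ j, M x t j i • ofArrow k ρ x ⟨t, j⟩ := by
  classical
  let lowFun : Path ρ → PathSpace k ρ := fun i =>
    match i with
    | ⟨x, []⟩ => ofVertex k ρ x
    | ⟨x, [⟨t, i⟩]⟩ => ∑ j, M x t j i • ofArrow k ρ x ⟨t, j⟩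
    | _ => 0
  let low := (basis k ρ).constr k lowFun
  have hlow : ∀ p : Path ρ, low (ofPath k p) = lowFun p :=
    fun p => (basis k ρ).constr_basis k _ _
  have hlow₀ : ∀ x, low (ofVertex k ρ x) = ofVertex k ρ x := fun x => hlow _
  obtain ⟨f, hf, hf'⟩ := exists_coalgHom (basis k ρ) (degreeZero k ρ)
    (fun p => ofVertex k ρ p.src) (fun p => ofVertex k ρ p.tgt) (fun p => p.src) (fun p => p.tgt)
    (fun p => (p.labels.map Sigma.fst : Multiset G))
    hasSource_ofPath hasTarget_ofPath
    (fun p => by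
      change Coalgebra.comul (ofPath k p) ∈ _
      rw [comul_ofPath]
      exact Submodule.sum_mem _ fun i _ =>
        Submodule.subset_span ⟨p.final i, p.initial i, coe_map_final_add_initial p i, rfl⟩)
    low
    (fun z => by
      rw [← LinearMap.comp_assoc]
      refine comp_degreeZero ?_
      rintro ⟨x, _ | ⟨s, _ | ⟨s', l⟩⟩⟩ hpq <;>
        simp [hlow, lowFun, Path.length, ofArrow, coord_ofPath] at hpq ⊢)
    (fun i => hlow₀ _) (fun i => hlow₀ _)
    (by
      intro i p hp h
      change coord k p (low (ofPath k i)) ≠ 0 at h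
      rw [hlow] at h
      rcases i with ⟨x, _ | ⟨⟨t, i⟩, _ | ⟨s', l⟩⟩⟩
      · simp only [lowFun, ofVertex, coord_ofPath] at h
        have : Path.vertex ρ x = p := by
          by_contra hne
          exact h (if_neg hne)
        subst this
        simp [Path.vertex, Path.tgt, Path.walk]
      · simp only [lowFun, map_sum, map_smul] at h
        obtain ⟨j, -, hj⟩ := Finset.exists_ne_zero_of_sum_ne_zero h
        have : (⟨x, [⟨t, j⟩]⟩ : Path ρ) = p := by
          by_contra hne
          rw [ofArrow, coord_ofPath, if_neg hne, smul_zero] at hj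
          exact hj rfl
        subst this
        simp [Path.tgt, Path.walk]
      · exact absurd (map_zero _) h)
    (by
      intro i
      change Coalgebra.counit (low (ofPath k i)) = Coalgebra.counit (ofPath k i)
      rw [hlow]
      rcases i with ⟨x, _ | ⟨s, _ | ⟨s', l⟩⟩⟩ <;>
        simp [lowFun, ofArrow, ofVertex, counit_ofPath, Path.length])
  have hdeg : ∀ n, ∀ z ∈ degree k ρ n, f z ∈ degree k ρ n := by
    intro n z hz
    induction hz using Submodule.span_induction with
    | zero => simp
    | add u v _ _ hu hv => rw [map_add]; exact add_mem hu hv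
    | smul a u _ hu => rw [map_smul]; exact Submodule.smul_mem _ _ hu
    | mem z hz =>
      obtain ⟨p, rfl, rfl⟩ := hz
      refine mem_degree_iff.2 fun r hr => ?_
      by_contra h
      exact hr (by rw [length_eq_card r, (hf' r p h).2, ← length_eq_card])
  refine ⟨f, hdeg, fun x => ?_, fun x t i => ?_⟩
  · refine ext_of_mem_degree zero_le_one (hdeg _ _ (ofVertex_mem_degree _))
      (ofVertex_mem_degree _) fun p hp => ?_
    rw [hf p hp, hlow₀]
  · refine ext_of_mem_degree le_rfl (hdeg _ _ (ofArrow_mem_degree _ _))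
      (Submodule.sum_mem _ fun j _ => Submodule.smul_mem _ _ (ofArrow_mem_degree _ _))
      fun p hp => ?_
    rw [hf p hp]; exact congrArg _ (hlow _)

end Extension

end PathSpace

/-! ### Identities of symmetric abelian cocycles -/

section Cocycle

variable {k : Type*} [Field k] {G : Type*} [CommGroup G] {Φ : G → G → G → k} {R : G → G → k}

namespace IsNormalizedThreeCocycle

theorem one_left (h : IsNormalizedThreeCocycle Φ) (g e : G) : Φ 1 g e = 1 := by
  have := h.cocycle 1 1 g e
  simp only [one_mul, h.normalized, mul_one] at this
  exact mul_left_cancel₀ (h.ne_zero 1 g e) (by rw [mul_one]; exact this.symm)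

theorem one_right (h : IsNormalizedThreeCocycle Φ) (e f : G) : Φ e f 1 = 1 := by
  have := h.cocycle e f 1 1
  simp only [one_mul, h.normalized, mul_one] at this
  exact mul_left_cancel₀ (h.ne_zero e f 1) (by rw [mul_one]; exact this.symm)

/-- The right compatibility condition holds for every cocycle on an abelian group: multiply the
cocycle identities for `(g, e, f, t)` and `(g, t, e, f)` and divide by the one for
`(g, e, t, f)`. -/
theorem right_compat (h : IsNormalizedThreeCocycle Φ) (e f g t : G) :
    (Φ (e * g) f t * Φ g e t * Φ e t f) / (Φ (e * g) t f * Φ g t e * Φ e f t) =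
      (Φ g e f * Φ g (e * f) t * Φ t e f) / (Φ (g * t) e f * Φ g t (e * f)) := by
  have h₁ := h.cocycle g e f t
  have h₂ := h.cocycle g e t f
  have h₃ := h.cocycle g t e f
  have n := h.ne_zero
  rw [mul_comm g e] at h₁ h₂
  rw [mul_comm t f] at h₂
  rw [mul_comm t e] at h₃
  rw [div_eq_div_iff (by simp [n]) (by simp [n])]
  refine mul_left_cancel₀ (mul_ne_zero (n g e (f * t)) (n g (e * t) f)) ?_
  linear_combination
    (Φ g e t * Φ e t f * Φ (g * t) e f * Φ g t (e * f) * Φ g (e * t) f) * h₁ +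
    (-Φ e f t * Φ g (e * f) t * Φ g e f * Φ g t (e * f) * Φ (g * t) e f) * h₂ +
    (Φ e f t * Φ g (e * f) t * Φ g e f * Φ g e (f * t) * Φ (e * g) t f) * h₃

/-- The bimodule condition holds for every cocycle on an abelian group: compare the cocycle
identities for `(e, g, f, t)` and `(e, g, t, f)`. -/
theorem bimodule_compat (h : IsNormalizedThreeCocycle Φ) (e f g t : G) :
    (Φ e g t * Φ (e * g) f t) / (Φ f g t * Φ (e * g) t f) =
      (Φ e g f * Φ e (f * g) t * Φ g f t) / (Φ e (g * t) f * Φ g t f * Φ f g t) := by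
  have h₁ := h.cocycle e g f t
  have h₂ := h.cocycle e g t f
  have n := h.ne_zero
  rw [mul_comm g f] at h₁
  rw [mul_comm t f] at h₂
  rw [div_eq_div_iff (by simp [n]) (by simp [n])]
  linear_combination (Φ f g t * Φ (e * g) t f) * h₁ - (Φ f g t * Φ (e * g) f t) * h₂

end IsNormalizedThreeCocycle

/-- The scalar of the right action of the vertex `g` on the arrow from `x` to `t * x`, relative to
the left action. -/
noncomputable def rightScalar (Φ : G → G → G → k) (R : G → G → k) (x t g : G) : k :=
  R g (t * x) / R g x * Φ g x t

namespace IsAdmissiblePair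

variable {ρ : G → ℕ}

theorem R_ne_zero (h : IsAdmissiblePair ρ Φ R) (g e : G) : R g e ≠ 0 :=
  left_ne_zero_of_mul_eq_one (h.R_symm g e)

theorem R_one_left (h : IsAdmissiblePair ρ Φ R) (g : G) : R 1 g = 1 := by
  have := h.R_mul_left 1 1 g
  simp only [h.isCocycle.normalized, h.isCocycle.one_left, mul_one, div_one] at this
  exact mul_left_cancel₀ (h.R_ne_zero 1 g) (by rw [mul_one]; exact this.symm)

theorem rightScalar_ne_zero (h : IsAdmissiblePair ρ Φ R) (x t g : G) : rightScalar Φ R x t g ≠ 0 :=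
  mul_ne_zero (div_ne_zero (h.R_ne_zero _ _) (h.R_ne_zero _ _)) (h.isCocycle.ne_zero _ _ _)

theorem rightScalar_one (h : IsAdmissiblePair ρ Φ R) (x t : G) : rightScalar Φ R x t 1 = 1 := by
  simp [rightScalar, h.R_one_left, h.isCocycle.one_left]

theorem rightScalar_mul_R (h : IsAdmissiblePair ρ Φ R) (x t g : G) :
    rightScalar Φ R x t g * R g x = R g (t * x) * Φ g x t := by
  have := h.R_ne_zero g x
  rw [rightScalar]; field_simp

theorem R_mul_rightScalar (h : IsAdmissiblePair ρ Φ R) (x t g : G) :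
    R (t * x) g * rightScalar Φ R x t g = Φ g x t * R x g := by
  have h₁ := h.R_symm (t * x) g
  have h₂ := h.R_symm x g
  have := h.R_ne_zero g x
  rw [rightScalar]; field_simp
  linear_combination Φ g x t * h₁ - Φ g x t * h₂

/-- Quasi-associativity of the left action. -/
theorem left_left (h : IsAdmissiblePair ρ Φ R) (g e x t : G) :
    Φ g (e * x) t * Φ e x t * Φ g e x = Φ g e (t * x) * Φ (g * e) x t := by
  have := h.isCocycle.cocycle g e x t
  rw [mul_comm x t] at this
  linear_combination -this

/-- Left actions of `e` and `g` in either order, compared by means of `e * g = g * e`. -/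
theorem left_left_swap (h : IsAdmissiblePair ρ Φ R) (g e x t : G) :
    Φ g (x * e) t * Φ e x t * Φ e g (t * x) * Φ g e x =
      Φ g e (t * x) * Φ e g x * Φ e (g * x) t * Φ g x t := by
  have h₁ := h.isCocycle.cocycle g e x t
  have h₂ := h.isCocycle.cocycle e g x t
  rw [mul_comm x t] at h₁ h₂
  rw [mul_comm e x] at h₁
  rw [mul_comm e g] at h₂
  linear_combination Φ g e (t * x) * h₂ - Φ e g (t * x) * h₁

/-- Compatibility of the left and the right action. -/
theorem left_right (h : IsAdmissiblePair ρ Φ R) (g x t e : G) :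
    Φ g (x * e) t * rightScalar Φ R x t e * Φ g x e =
      Φ g (t * x) e * (rightScalar Φ R (g * x) t e * Φ g x t) := by
  have h₁ := h.left_left_swap g e x t
  have h₂ := h.R_mul_right e g (t * x)
  have h₃ := h.R_mul_right e g x
  have n := h.isCocycle.ne_zero
  have n' := h.R_ne_zero
  rw [rightScalar, rightScalar, mul_left_comm t g x, h₂, h₃]
  have := n g x e
  have := n g (t * x) e
  have := n e g x
  have := n e g (t * x)
  have := n g e x
  have := n' e x
  have := n' e g
  field_simp
  linear_combination R e (t * x) * h₁

/-- Quasi-associativity of the right action. -/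
theorem right_right (h : IsAdmissiblePair ρ Φ R) (x t g e : G) :
    rightScalar Φ R x t (g * e) * Φ x g e =
      Φ (t * x) g e * (rightScalar Φ R (x * g) t e * rightScalar Φ R x t g) := by
  have h₀ := h.isCocycle.cocycle e g x t
  have h₁ := h.R_mul_right e g (t * x)
  have h₂ := h.R_mul_right e g x
  have h₃ := h.R_mul_left g e (t * x)
  have h₄ := h.R_mul_left g e x
  have n := h.isCocycle.ne_zero
  have n' := h.R_ne_zero
  rw [mul_comm x t, mul_comm e g] at h₀
  rw [rightScalar, rightScalar, rightScalar, mul_comm x g, mul_left_comm t g x, h₁, h₂, h₃, h₄]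
  have := n g x e
  have := n g (t * x) e
  have := n e g x
  have := n e g (t * x)
  have := n g e x
  have := n g e (t * x)
  have := n x g e
  have := n (t * x) g e
  have := n' e x
  have := n' g x
  have := n' e g
  have := n' e (t * x)
  have := n' g (t * x)
  field_simp
  linear_combination h₀

end IsAdmissiblePair

end Cocycle

/-! ### Functionals concentrated in degree zero -/

namespace PathSpace

variable {k : Type*} [Field k] {G : Type*} [CommGroup G] {ρ : G → ℕ}

theorem degreeZero_eq_zero {n : ℕ} (hn : n ≠ 0) {x : PathSpace k ρ} (hx : x ∈ degree k ρ n) :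
    degreeZero k ρ x = 0 := by
  induction hx using Submodule.span_induction with
  | zero => simp
  | add u v _ _ hu hv => rw [map_add, hu, hv, add_zero]
  | smul a u _ hu => rw [map_smul, hu, smul_zero]
  | mem x hx =>
    obtain ⟨p, rfl, rfl⟩ := hx
    exact degreeZero_ofPath_eq_zero hn

section Vanishing

variable {V : Type*} [AddCommGroup V] [Module k V]

theorem apply_eq_zero₁ {ψ : PathSpace k ρ →ₗ[k] V} (h : ψ ∘ₗ degreeZero k ρ = ψ) {l : ℕ}
    {x : PathSpace k ρ} (hx : x ∈ degree k ρ l) (hl : l ≠ 0) : ψ x = 0 := by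
  rw [← h, LinearMap.comp_apply, degreeZero_eq_zero hl hx, map_zero]

theorem apply_eq_zero₂ {ψ : PathSpace k ρ ⊗[k] PathSpace k ρ →ₗ[k] V}
    (h : ψ ∘ₗ degreeZero₂ k ρ = ψ) {l m : ℕ} {x y : PathSpace k ρ} (hx : x ∈ degree k ρ l)
    (hy : y ∈ degree k ρ m) (hlm : ¬(l = 0 ∧ m = 0)) : ψ (x ⊗ₜ[k] y) = 0 := by
  rw [← h, LinearMap.comp_apply, degreeZero₂, TensorProduct.map_tmul]
  have : l ≠ 0 ∨ m ≠ 0 := by tauto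
  rcases this with hl | hl
  · simp [degreeZero_eq_zero hl hx]
  · simp [degreeZero_eq_zero hl hy]

theorem apply_eq_zero₃ {ψ : PathSpace k ρ ⊗[k] (PathSpace k ρ ⊗[k] PathSpace k ρ) →ₗ[k] V}
    (h : ψ ∘ₗ degreeZero₃ k ρ = ψ) {l m n : ℕ} {x y z : PathSpace k ρ} (hx : x ∈ degree k ρ l)
    (hy : y ∈ degree k ρ m) (hz : z ∈ degree k ρ n) (hlmn : ¬(l = 0 ∧ m = 0 ∧ n = 0)) :
    ψ (x ⊗ₜ[k] (y ⊗ₜ[k] z)) = 0 := by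
  rw [← h, LinearMap.comp_apply, degreeZero₃, degreeZero₂, TensorProduct.map_tmul,
    TensorProduct.map_tmul]
  have : l ≠ 0 ∨ m ≠ 0 ∨ n ≠ 0 := by tauto
  rcases this with hl | hl | hl
  · simp [degreeZero_eq_zero hl hx]
  · simp [degreeZero_eq_zero hl hy]
  · simp [degreeZero_eq_zero hl hz]

end Vanishing

theorem mul_comp_degreeZero₃
    {φ ψ : Functional k (PathSpace k ρ ⊗[k] (PathSpace k ρ ⊗[k] PathSpace k ρ))}
    (hφ : φ.ofConv ∘ₗ degreeZero₃ k ρ = φ.ofConv) (hψ : ψ.ofConv ∘ₗ degreeZero₃ k ρ = ψ.ofConv) :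
    (φ * ψ).ofConv ∘ₗ degreeZero₃ k ρ = (φ * ψ).ofConv :=
  comp_degreeZero₃ fun p q r hpqr => by
    rw [(hasSource₃ p q r).mul φ hψ, apply_eq_zero₃ hφ (ofPath_mem_degree p)
      (ofPath_mem_degree q) (ofPath_mem_degree r) hpqr, zero_mul]

theorem mul_comp_degreeZero₄
    {φ ψ : Functional k (PathSpace k ρ ⊗[k] (PathSpace k ρ ⊗[k] (PathSpace k ρ ⊗[k]
      PathSpace k ρ)))}
    (hφ : φ.ofConv ∘ₗ degreeZero₄ k ρ = φ.ofConv) (hψ : ψ.ofConv ∘ₗ degreeZero₄ k ρ = ψ.ofConv) :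
    (φ * ψ).ofConv ∘ₗ degreeZero₄ k ρ = (φ * ψ).ofConv :=
  comp_degreeZero₄ fun p q r t hpqr => by
    rw [(hasSource₄ p q r t).mul φ hψ, ← hφ, LinearMap.comp_apply, degreeZero₄, degreeZero₃,
      degreeZero₂, TensorProduct.map_tmul, TensorProduct.map_tmul, TensorProduct.map_tmul]
    have : p.length ≠ 0 ∨ q.length ≠ 0 ∨ r.length ≠ 0 ∨ t.length ≠ 0 := by tauto
    rcases this with hp | hp | hp | hp <;> simp [degreeZero_ofPath_eq_zero hp]

section Ext

variable {V : Type*} [AddCommGroup V] [Module k V]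

theorem ext_vertex₁ {φ ψ : PathSpace k ρ →ₗ[k] V}
    (hφ : φ ∘ₗ degreeZero k ρ = φ) (hψ : ψ ∘ₗ degreeZero k ρ = ψ)
    (h : ∀ x, φ (ofVertex k ρ x) = ψ (ofVertex k ρ x)) : φ = ψ := by
  refine ext₁ fun p => ?_
  by_cases hp : p.length = 0
  · rw [Path.eq_vertex hp]
    exact h _
  · rw [apply_eq_zero₁ hφ (ofPath_mem_degree p) hp, apply_eq_zero₁ hψ (ofPath_mem_degree p) hp]

theorem ext_vertex₂ {φ ψ : PathSpace k ρ ⊗[k] PathSpace k ρ →ₗ[k] V}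
    (hφ : φ ∘ₗ degreeZero₂ k ρ = φ) (hψ : ψ ∘ₗ degreeZero₂ k ρ = ψ)
    (h : ∀ x y, φ (ofVertex k ρ x ⊗ₜ[k] ofVertex k ρ y) =
      ψ (ofVertex k ρ x ⊗ₜ[k] ofVertex k ρ y)) : φ = ψ := by
  refine ext₂ fun p q => ?_
  by_cases hpq : p.length = 0 ∧ q.length = 0
  · rw [Path.eq_vertex hpq.1, Path.eq_vertex hpq.2]
    exact h _ _
  · rw [apply_eq_zero₂ hφ (ofPath_mem_degree p) (ofPath_mem_degree q) hpq,
      apply_eq_zero₂ hψ (ofPath_mem_degree p) (ofPath_mem_degree q) hpq]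

theorem ext_vertex₃ {φ ψ : PathSpace k ρ ⊗[k] (PathSpace k ρ ⊗[k] PathSpace k ρ) →ₗ[k] V}
    (hφ : φ ∘ₗ degreeZero₃ k ρ = φ) (hψ : ψ ∘ₗ degreeZero₃ k ρ = ψ)
    (h : ∀ x y z, φ (ofVertex k ρ x ⊗ₜ[k] (ofVertex k ρ y ⊗ₜ[k] ofVertex k ρ z)) =
      ψ (ofVertex k ρ x ⊗ₜ[k] (ofVertex k ρ y ⊗ₜ[k] ofVertex k ρ z))) : φ = ψ := by
  refine ext₃ fun p q r => ?_
  by_cases hpq : p.length = 0 ∧ q.length = 0 ∧ r.length = 0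
  · rw [Path.eq_vertex hpq.1, Path.eq_vertex hpq.2.1, Path.eq_vertex hpq.2.2]
    exact h _ _ _
  · rw [apply_eq_zero₃ hφ (ofPath_mem_degree p) (ofPath_mem_degree q) (ofPath_mem_degree r) hpq,
      apply_eq_zero₃ hψ (ofPath_mem_degree p) (ofPath_mem_degree q) (ofPath_mem_degree r) hpq]

theorem ext_vertex₄
    {φ ψ : PathSpace k ρ ⊗[k] (PathSpace k ρ ⊗[k] (PathSpace k ρ ⊗[k] PathSpace k ρ)) →ₗ[k] V}
    (hφ : φ ∘ₗ degreeZero₄ k ρ = φ) (hψ : ψ ∘ₗ degreeZero₄ k ρ = ψ)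
    (h : ∀ x y z w, φ (ofVertex k ρ x ⊗ₜ[k] (ofVertex k ρ y ⊗ₜ[k]
        (ofVertex k ρ z ⊗ₜ[k] ofVertex k ρ w))) =
      ψ (ofVertex k ρ x ⊗ₜ[k] (ofVertex k ρ y ⊗ₜ[k] (ofVertex k ρ z ⊗ₜ[k] ofVertex k ρ w)))) :
    φ = ψ := by
  rw [← hφ, ← hψ]
  refine ext₄ fun p q r t => ?_
  rw [LinearMap.comp_apply, LinearMap.comp_apply, degreeZero₄, degreeZero₃,
    degreeZero₂, TensorProduct.map_tmul, TensorProduct.map_tmul, TensorProduct.map_tmul]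
  by_cases hpq : p.length = 0 ∧ q.length = 0 ∧ r.length = 0 ∧ t.length = 0
  · rw [degreeZero_ofPath_eq hpq.1, degreeZero_ofPath_eq hpq.2.1, degreeZero_ofPath_eq hpq.2.2.1,
      degreeZero_ofPath_eq hpq.2.2.2, Path.eq_vertex hpq.1, Path.eq_vertex hpq.2.1,
      Path.eq_vertex hpq.2.2.1, Path.eq_vertex hpq.2.2.2]
    exact h _ _ _ _
  · have : p.length ≠ 0 ∨ q.length ≠ 0 ∨ r.length ≠ 0 ∨ t.length ≠ 0 := by tauto
    rcases this with hp | hp | hp | hp <;> simp [degreeZero_ofPath_eq_zero hp]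

end Ext

open Classical in
variable (k ρ) in
/-- The functional on `kQ` that is concentrated in degree zero and has the given values at
vertices. -/
noncomputable def inflate₁ (f : G → k) : Functional k (PathSpace k ρ) :=
  WithConv.toConv ((basis k ρ).constr k fun p => if p.length = 0 then f p.src else 0)

open Classical in
variable (k ρ) in
/-- The functional on `kQ ⊗ kQ` that is concentrated in degree zero and has the given values at
pairs of vertices. -/
noncomputable def inflate₂ (f : G → G → k) : Functional k (PathSpace k ρ ⊗[k] PathSpace k ρ) :=
  WithConv.toConv ((basis₂ k ρ).constr k fun p =>
    if p.1.length = 0 ∧ p.2.length = 0 then f p.1.src p.2.src else 0)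

open Classical in
variable (k ρ) in
/-- The functional on `kQ ⊗ kQ ⊗ kQ` that is concentrated in degree zero and has the given values
at triples of vertices. -/
noncomputable def inflate₃ (f : G → G → G → k) :
    Functional k (PathSpace k ρ ⊗[k] (PathSpace k ρ ⊗[k] PathSpace k ρ)) :=
  WithConv.toConv ((basis₃ k ρ).constr k fun p =>
    if p.1.length = 0 ∧ p.2.1.length = 0 ∧ p.2.2.length = 0 then f p.1.src p.2.1.src p.2.2.src
    else 0)

theorem inflate₁_vertex (f : G → k) (x : G) : (inflate₁ k ρ f).ofConv (ofVertex k ρ x) = f x :=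
  (Module.Basis.constr_basis _ _ _ _).trans (if_pos rfl)

theorem inflate₂_vertex (f : G → G → k) (x y : G) :
    (inflate₂ k ρ f).ofConv (ofVertex k ρ x ⊗ₜ[k] ofVertex k ρ y) = f x y := by
  rw [ofVertex, ofVertex, ← basis₂_apply]
  exact (Module.Basis.constr_basis _ _ _ _).trans (if_pos ⟨rfl, rfl⟩)

theorem inflate₃_vertex (f : G → G → G → k) (x y z : G) :
    (inflate₃ k ρ f).ofConv (ofVertex k ρ x ⊗ₜ[k] (ofVertex k ρ y ⊗ₜ[k] ofVertex k ρ z)) =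
      f x y z := by
  rw [ofVertex, ofVertex, ofVertex, ← basis₃_apply]
  exact (Module.Basis.constr_basis _ _ _ _).trans (if_pos ⟨rfl, rfl, rfl⟩)

theorem inflate₁_comp (f : G → k) :
    (inflate₁ k ρ f).ofConv ∘ₗ degreeZero k ρ = (inflate₁ k ρ f).ofConv :=
  comp_degreeZero fun _ hp => (Module.Basis.constr_basis _ _ _ _).trans (if_neg hp)

theorem inflate₂_comp (f : G → G → k) :
    (inflate₂ k ρ f).ofConv ∘ₗ degreeZero₂ k ρ = (inflate₂ k ρ f).ofConv :=
  comp_degreeZero₂ fun p q hp => by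
    rw [← basis₂_apply]
    exact (Module.Basis.constr_basis _ _ _ _).trans (if_neg hp)

theorem inflate₃_comp (f : G → G → G → k) :
    (inflate₃ k ρ f).ofConv ∘ₗ degreeZero₃ k ρ = (inflate₃ k ρ f).ofConv :=
  comp_degreeZero₃ fun p q r hp => by
    rw [← basis₃_apply]
    exact (Module.Basis.constr_basis _ _ _ _).trans (if_neg hp)

theorem counit_ofVertex (x : G) : Coalgebra.counit (R := k) (ofVertex k ρ x) = 1 :=
  (isGroupLike_ofVertex x).counit_eq_one

theorem counit_ofPath_eq_zero {p : Path ρ} (hp : p.length ≠ 0) :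
    Coalgebra.counit (R := k) (ofPath k p) = 0 := (counit_ofPath k p).trans (if_neg hp)

theorem counit_comp_degreeZero :
    (Coalgebra.counit : PathSpace k ρ →ₗ[k] k) ∘ₗ degreeZero k ρ = Coalgebra.counit :=
  comp_degreeZero fun _ hp => counit_ofPath_eq_zero hp

theorem isGroupLike₂ (x y : G) : IsGroupLikeElem k (ofVertex k ρ x ⊗ₜ[k] ofVertex k ρ y) :=
  (isGroupLike_ofVertex x).tmul (isGroupLike_ofVertex y)

theorem isGroupLike₃ (x y z : G) :
    IsGroupLikeElem k (ofVertex k ρ x ⊗ₜ[k] (ofVertex k ρ y ⊗ₜ[k] ofVertex k ρ z)) :=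
  (isGroupLike_ofVertex x).tmul (isGroupLike₂ y z)

theorem isGroupLike₄ (x y z w : G) : IsGroupLikeElem k
    (ofVertex k ρ x ⊗ₜ[k] (ofVertex k ρ y ⊗ₜ[k] (ofVertex k ρ z ⊗ₜ[k] ofVertex k ρ w))) :=
  (isGroupLike_ofVertex x).tmul (isGroupLike₃ y z w)

theorem inflate₂_mul (f g : G → G → k) (h : ∀ x y, f x y * g x y = 1) :
    inflate₂ k ρ f * inflate₂ k ρ g = 1 := by
  refine WithConv.ofConv_injective (ext₂ fun p q => ?_)
  rw [(hasSource₂ p q).mul _ (inflate₂_comp g), inflate₂_vertex, Functional.one_ofConv]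
  by_cases hp : p.length = 0 ∧ q.length = 0
  · rw [Path.eq_vertex hp.1, Path.eq_vertex hp.2]
    refine (congrArg (· * _) (inflate₂_vertex f _ _)).trans ((h _ _).trans ?_)
    exact (isGroupLike₂ p.src q.src).counit_eq_one.symm
  · rw [apply_eq_zero₂ (inflate₂_comp f) (ofPath_mem_degree p) (ofPath_mem_degree q) hp, zero_mul,
      TensorProduct.counit_tmul]
    have : p.length ≠ 0 ∨ q.length ≠ 0 := by tauto
    rcases this with hp | hp <;> simp [counit_ofPath_eq_zero hp]

theorem inflate₃_mul (f g : G → G → G → k) (h : ∀ x y z, f x y z * g x y z = 1) :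
    inflate₃ k ρ f * inflate₃ k ρ g = 1 := by
  refine WithConv.ofConv_injective (ext₃ fun p q r => ?_)
  rw [(hasSource₃ p q r).mul _ (inflate₃_comp g), inflate₃_vertex, Functional.one_ofConv]
  by_cases hp : p.length = 0 ∧ q.length = 0 ∧ r.length = 0
  · rw [Path.eq_vertex hp.1, Path.eq_vertex hp.2.1, Path.eq_vertex hp.2.2]
    refine (congrArg (· * _) (inflate₃_vertex f _ _ _)).trans ((h _ _ _).trans ?_)
    exact (isGroupLike₃ p.src q.src r.src).counit_eq_one.symm
  · rw [apply_eq_zero₃ (inflate₃_comp f) (ofPath_mem_degree p) (ofPath_mem_degree q)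
      (ofPath_mem_degree r) hp, zero_mul, TensorProduct.counit_tmul, TensorProduct.counit_tmul]
    have : p.length ≠ 0 ∨ q.length ≠ 0 ∨ r.length ≠ 0 := by tauto
    rcases this with hp | hp | hp <;> simp [counit_ofPath_eq_zero hp]

variable (ρ) in
/-- The convolution-invertible functional with given nonzero values at pairs of vertices. -/
noncomputable def inflateUnit₂ (f : G → G → k) (hf : ∀ x y, f x y ≠ 0) :
    (Functional k (PathSpace k ρ ⊗[k] PathSpace k ρ))ˣ where
  val := inflate₂ k ρ f
  inv := inflate₂ k ρ fun x y => (f x y)⁻¹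
  val_inv := inflate₂_mul _ _ fun x y => mul_inv_cancel₀ (hf x y)
  inv_val := inflate₂_mul _ _ fun x y => inv_mul_cancel₀ (hf x y)

variable (ρ) in
/-- The convolution-invertible functional with given nonzero values at triples of vertices. -/
noncomputable def inflateUnit₃ (f : G → G → G → k) (hf : ∀ x y z, f x y z ≠ 0) :
    (Functional k (PathSpace k ρ ⊗[k] (PathSpace k ρ ⊗[k] PathSpace k ρ)))ˣ where
  val := inflate₃ k ρ f
  inv := inflate₃ k ρ fun x y z => (f x y z)⁻¹
  val_inv := inflate₃_mul _ _ fun x y z => mul_inv_cancel₀ (hf x y z)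
  inv_val := inflate₃_mul _ _ fun x y z => inv_mul_cancel₀ (hf x y z)

end PathSpace

/-! ### Auxiliary coalgebra maps and pulled back functionals -/

section CoalgebraMaps

variable {k : Type*} [Field k] {C D : Type*} [AddCommGroup C] [Module k C] [Coalgebra k C]
  [AddCommGroup D] [Module k D] [Coalgebra k D]

/-- Tensoring with a group-like element on the left is a coalgebra map. -/
noncomputable def IsGroupLikeElem.tmulLeft {c : C} (hc : IsGroupLikeElem k c) :
    D →ₗc[k] C ⊗[k] D where
  toLinearMap := TensorProduct.mk k C D c
  counit_comp := by ext d; simp [hc.counit_eq_one]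
  map_comp_comul := by
    have key : ∀ z : D ⊗[k] D, TensorProduct.map (TensorProduct.mk k C D c)
        (TensorProduct.mk k C D c) z =
        TensorProduct.tensorTensorTensorComm k C C D D ((c ⊗ₜ[k] c) ⊗ₜ[k] z) := by
      intro z
      induction z with
      | zero => simp
      | add u v hu hv => rw [map_add, hu, hv, TensorProduct.tmul_add, map_add]
      | tmul u v => rfl
    ext d
    rw [LinearMap.comp_apply, LinearMap.comp_apply, key, ← hc.comul_eq_tmul_self]
    rfl

/-- Tensoring with a group-like element on the right is a coalgebra map. -/
noncomputable def IsGroupLikeElem.tmulRight {c : C} (hc : IsGroupLikeElem k c) :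
    D →ₗc[k] D ⊗[k] C where
  toLinearMap := (TensorProduct.mk k D C).flip c
  counit_comp := by ext d; simp [hc.counit_eq_one]
  map_comp_comul := by
    have key : ∀ z : D ⊗[k] D, TensorProduct.map ((TensorProduct.mk k D C).flip c)
        ((TensorProduct.mk k D C).flip c) z =
        TensorProduct.tensorTensorTensorComm k D D C C (z ⊗ₜ[k] (c ⊗ₜ[k] c)) := by
      intro z
      induction z with
      | zero => simp
      | add u v hu hv => rw [map_add, hu, hv, TensorProduct.add_tmul, map_add]
      | tmul u v => rfl
    ext d
    rw [LinearMap.comp_apply, LinearMap.comp_apply, key, ← hc.comul_eq_tmul_self]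
    rfl

variable (k C) in
/-- The flip of the tensor factors as a coalgebra map. -/
noncomputable def commCoalgHom : C ⊗[k] C →ₗc[k] C ⊗[k] C where
  toLinearMap := (TensorProduct.comm k C C).toLinearMap
  counit_comp := by ext c d; simp [mul_comm]
  map_comp_comul := by
    have key : ∀ z w : C ⊗[k] C, TensorProduct.map (TensorProduct.comm k C C).toLinearMap
        (TensorProduct.comm k C C).toLinearMap
          (TensorProduct.tensorTensorTensorComm k C C C C (z ⊗ₜ[k] w)) =
        TensorProduct.tensorTensorTensorComm k C C C C (w ⊗ₜ[k] z) := by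
      intro z w
      induction z with
      | zero => simp
      | add u v hu hv => simp only [TensorProduct.add_tmul, TensorProduct.tmul_add, map_add, hu, hv]
      | tmul a b =>
        induction w with
        | zero => simp
        | add u v hu hv =>
          simp only [TensorProduct.add_tmul, TensorProduct.tmul_add, map_add, hu, hv]
        | tmul c d => rfl
    ext c d
    exact key _ _

end CoalgebraMaps

namespace PathSpace

variable {k : Type*} [Field k] {G : Type*} [CommGroup G] {ρ : G → ℕ}

theorem cases_length₂ {P : Path ρ → Path ρ → Prop}
    (h₀ : ∀ x y, P (Path.vertex ρ x) (Path.vertex ρ y))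
    (h₁ : ∀ x s y, P ⟨x, [s]⟩ (Path.vertex ρ y)) (h₂ : ∀ x y s, P (Path.vertex ρ x) ⟨y, [s]⟩)
    (p q : Path ρ) (h : p.length + q.length ≤ 1) : P p q := by
  rcases p with ⟨x, _ | ⟨s, _ | ⟨s', l⟩⟩⟩ <;> rcases q with ⟨y, _ | ⟨t, _ | ⟨t', m⟩⟩⟩ <;>
    first
    | exact h₀ _ _
    | exact h₁ _ _ _
    | exact h₂ _ _ _
    | (exfalso; simp only [Path.length, List.length_cons, List.length_nil] at h; omega)

theorem cases_length₃ {P : Path ρ → Path ρ → Path ρ → Prop}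
    (h₀ : ∀ x y z, P (Path.vertex ρ x) (Path.vertex ρ y) (Path.vertex ρ z))
    (h₁ : ∀ x s y z, P ⟨x, [s]⟩ (Path.vertex ρ y) (Path.vertex ρ z))
    (h₂ : ∀ x y s z, P (Path.vertex ρ x) ⟨y, [s]⟩ (Path.vertex ρ z))
    (h₃ : ∀ x y z s, P (Path.vertex ρ x) (Path.vertex ρ y) ⟨z, [s]⟩)
    (p q r : Path ρ) (h : p.length + (q.length + r.length) ≤ 1) : P p q r := by
  by_cases hp : p.length = 0
  · rw [Path.eq_vertex hp]
    exact cases_length₂ (h₀ _) (h₂ _) (h₃ _) q r (by omega)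
  · rw [Path.eq_vertex (p := q) (by omega), Path.eq_vertex (p := r) (by omega)]
    obtain ⟨x, s, rfl⟩ := Path.eq_arrow (p := p) (by omega)
    exact h₁ _ _ _ _

section Pull

variable {φ : Functional k (PathSpace k ρ ⊗[k] (PathSpace k ρ ⊗[k] PathSpace k ρ))}
  {ψ : Functional k (PathSpace k ρ ⊗[k] PathSpace k ρ)}
  {m : PathSpace k ρ ⊗[k] PathSpace k ρ →ₗ[k] PathSpace k ρ}

theorem pull_permCAB_comp (hφ : φ.ofConv ∘ₗ degreeZero₃ k ρ = φ.ofConv) :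
    (Functional.pull (permCAB k (PathSpace k ρ)) φ).ofConv ∘ₗ degreeZero₃ k ρ =
      (Functional.pull (permCAB k (PathSpace k ρ)) φ).ofConv :=
  comp_degreeZero₃ fun p q r h => apply_eq_zero₃ hφ (ofPath_mem_degree r) (ofPath_mem_degree p)
    (ofPath_mem_degree q) (by tauto)

theorem pull_permACB_comp (hφ : φ.ofConv ∘ₗ degreeZero₃ k ρ = φ.ofConv) :
    (Functional.pull (permACB k (PathSpace k ρ)) φ).ofConv ∘ₗ degreeZero₃ k ρ =
      (Functional.pull (permACB k (PathSpace k ρ)) φ).ofConv :=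
  comp_degreeZero₃ fun p q r h => apply_eq_zero₃ hφ (ofPath_mem_degree p) (ofPath_mem_degree r)
    (ofPath_mem_degree q) (by tauto)

theorem pull_permBCA_comp (hφ : φ.ofConv ∘ₗ degreeZero₃ k ρ = φ.ofConv) :
    (Functional.pull (permBCA k (PathSpace k ρ)) φ).ofConv ∘ₗ degreeZero₃ k ρ =
      (Functional.pull (permBCA k (PathSpace k ρ)) φ).ofConv :=
  comp_degreeZero₃ fun p q r h => apply_eq_zero₃ hφ (ofPath_mem_degree q) (ofPath_mem_degree r)
    (ofPath_mem_degree p) (by tauto)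

theorem pull_permBAC_comp (hφ : φ.ofConv ∘ₗ degreeZero₃ k ρ = φ.ofConv) :
    (Functional.pull (permBAC k (PathSpace k ρ)) φ).ofConv ∘ₗ degreeZero₃ k ρ =
      (Functional.pull (permBAC k (PathSpace k ρ)) φ).ofConv :=
  comp_degreeZero₃ fun p q r h => apply_eq_zero₃ hφ (ofPath_mem_degree q) (ofPath_mem_degree p)
    (ofPath_mem_degree r) (by tauto)

theorem pull_keepAB_ofConv (a b c : PathSpace k ρ) :
    (Functional.pull (keepAB k (PathSpace k ρ)) ψ).ofConv (a ⊗ₜ[k] (b ⊗ₜ[k] c)) =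
      Coalgebra.counit (R := k) c * ψ.ofConv (a ⊗ₜ[k] b) := by
  simp [Functional.pull, keepAB, dropLast]

theorem pull_keepAC_ofConv (a b c : PathSpace k ρ) :
    (Functional.pull (keepAC k (PathSpace k ρ)) ψ).ofConv (a ⊗ₜ[k] (b ⊗ₜ[k] c)) =
      Coalgebra.counit (R := k) b * ψ.ofConv (a ⊗ₜ[k] c) := by
  simp [Functional.pull, keepAC, dropFirst]

theorem pull_keepBC_ofConv (a b c : PathSpace k ρ) :
    (Functional.pull (keepBC k (PathSpace k ρ)) ψ).ofConv (a ⊗ₜ[k] (b ⊗ₜ[k] c)) =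
      Coalgebra.counit (R := k) a * ψ.ofConv (b ⊗ₜ[k] c) := by
  simp [Functional.pull, keepBC, dropFirst]

theorem pull_keepABC_ofConv (a b c d : PathSpace k ρ) :
    (Functional.pull (keepABC k (PathSpace k ρ)) φ).ofConv (a ⊗ₜ[k] (b ⊗ₜ[k] (c ⊗ₜ[k] d))) =
      Coalgebra.counit (R := k) d * φ.ofConv (a ⊗ₜ[k] (b ⊗ₜ[k] c)) := by
  simp [Functional.pull, keepABC, keepAB, dropLast]

theorem pull_keepBCD_ofConv (a b c d : PathSpace k ρ) :
    (Functional.pull (keepBCD k (PathSpace k ρ)) φ).ofConv (a ⊗ₜ[k] (b ⊗ₜ[k] (c ⊗ₜ[k] d))) =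
      Coalgebra.counit (R := k) a * φ.ofConv (b ⊗ₜ[k] (c ⊗ₜ[k] d)) := by
  simp [Functional.pull, keepBCD, dropFirst]

theorem pull_keepAB_comp (hψ : ψ.ofConv ∘ₗ degreeZero₂ k ρ = ψ.ofConv) :
    (Functional.pull (keepAB k (PathSpace k ρ)) ψ).ofConv ∘ₗ degreeZero₃ k ρ =
      (Functional.pull (keepAB k (PathSpace k ρ)) ψ).ofConv :=
  comp_degreeZero₃ fun p q r h => by
    rw [pull_keepAB_ofConv]
    by_cases hr : r.length = 0
    · rw [apply_eq_zero₂ hψ (ofPath_mem_degree p) (ofPath_mem_degree q) (by tauto), mul_zero]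
    · rw [counit_ofPath_eq_zero hr, zero_mul]

theorem pull_keepAC_comp (hψ : ψ.ofConv ∘ₗ degreeZero₂ k ρ = ψ.ofConv) :
    (Functional.pull (keepAC k (PathSpace k ρ)) ψ).ofConv ∘ₗ degreeZero₃ k ρ =
      (Functional.pull (keepAC k (PathSpace k ρ)) ψ).ofConv :=
  comp_degreeZero₃ fun p q r h => by
    rw [pull_keepAC_ofConv]
    by_cases hr : q.length = 0
    · rw [apply_eq_zero₂ hψ (ofPath_mem_degree p) (ofPath_mem_degree r) (by tauto), mul_zero]
    · rw [counit_ofPath_eq_zero hr, zero_mul]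

theorem pull_keepBC_comp (hψ : ψ.ofConv ∘ₗ degreeZero₂ k ρ = ψ.ofConv) :
    (Functional.pull (keepBC k (PathSpace k ρ)) ψ).ofConv ∘ₗ degreeZero₃ k ρ =
      (Functional.pull (keepBC k (PathSpace k ρ)) ψ).ofConv :=
  comp_degreeZero₃ fun p q r h => by
    rw [pull_keepBC_ofConv]
    by_cases hr : p.length = 0
    · rw [apply_eq_zero₂ hψ (ofPath_mem_degree q) (ofPath_mem_degree r) (by tauto), mul_zero]
    · rw [counit_ofPath_eq_zero hr, zero_mul]

theorem pull_keepABC_comp (hφ : φ.ofConv ∘ₗ degreeZero₃ k ρ = φ.ofConv) :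
    (Functional.pull (keepABC k (PathSpace k ρ)) φ).ofConv ∘ₗ degreeZero₄ k ρ =
      (Functional.pull (keepABC k (PathSpace k ρ)) φ).ofConv :=
  comp_degreeZero₄ fun p q r t h => by
    rw [pull_keepABC_ofConv]
    by_cases hr : t.length = 0
    · rw [apply_eq_zero₃ hφ (ofPath_mem_degree p) (ofPath_mem_degree q) (ofPath_mem_degree r)
        (by tauto), mul_zero]
    · rw [counit_ofPath_eq_zero hr, zero_mul]

theorem pull_keepBCD_comp (hφ : φ.ofConv ∘ₗ degreeZero₃ k ρ = φ.ofConv) :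
    (Functional.pull (keepBCD k (PathSpace k ρ)) φ).ofConv ∘ₗ degreeZero₄ k ρ =
      (Functional.pull (keepBCD k (PathSpace k ρ)) φ).ofConv :=
  comp_degreeZero₄ fun p q r t h => by
    rw [pull_keepBCD_ofConv]
    by_cases hr : p.length = 0
    · rw [apply_eq_zero₃ hφ (ofPath_mem_degree q) (ofPath_mem_degree r) (ofPath_mem_degree t)
        (by tauto), mul_zero]
    · rw [counit_ofPath_eq_zero hr, zero_mul]

theorem pull_mulFirstTwo_comp₃ (hψ : ψ.ofConv ∘ₗ degreeZero₂ k ρ = ψ.ofConv)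
    (hm : ∀ p q : Path ρ, m (ofPath k p ⊗ₜ[k] ofPath k q) ∈ degree k ρ (p.length + q.length)) :
    (Functional.pull (mulFirstTwo m (PathSpace k ρ)) ψ).ofConv ∘ₗ degreeZero₃ k ρ =
      (Functional.pull (mulFirstTwo m (PathSpace k ρ)) ψ).ofConv :=
  comp_degreeZero₃ fun p q r h =>
    apply_eq_zero₂ hψ (hm p q) (ofPath_mem_degree r) (by omega)

theorem pull_lTensor_comp₃ (hψ : ψ.ofConv ∘ₗ degreeZero₂ k ρ = ψ.ofConv)
    (hm : ∀ p q : Path ρ, m (ofPath k p ⊗ₜ[k] ofPath k q) ∈ degree k ρ (p.length + q.length)) :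
    (Functional.pull (LinearMap.lTensor (PathSpace k ρ) m) ψ).ofConv ∘ₗ degreeZero₃ k ρ =
      (Functional.pull (LinearMap.lTensor (PathSpace k ρ) m) ψ).ofConv :=
  comp_degreeZero₃ fun p q r h =>
    apply_eq_zero₂ hψ (ofPath_mem_degree p) (hm q r) (by omega)

theorem pull_mulFirstTwo_comp₄ (hφ : φ.ofConv ∘ₗ degreeZero₃ k ρ = φ.ofConv)
    (hm : ∀ p q : Path ρ, m (ofPath k p ⊗ₜ[k] ofPath k q) ∈ degree k ρ (p.length + q.length)) :
    (Functional.pull (mulFirstTwo m (PathSpace k ρ ⊗[k] PathSpace k ρ)) φ).ofConv ∘ₗ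
        degreeZero₄ k ρ =
      (Functional.pull (mulFirstTwo m (PathSpace k ρ ⊗[k] PathSpace k ρ)) φ).ofConv :=
  comp_degreeZero₄ fun p q r t h =>
    apply_eq_zero₃ hφ (hm p q) (ofPath_mem_degree r) (ofPath_mem_degree t) (by omega)

theorem pull_lTensor_mulFirstTwo_comp₄ (hφ : φ.ofConv ∘ₗ degreeZero₃ k ρ = φ.ofConv)
    (hm : ∀ p q : Path ρ, m (ofPath k p ⊗ₜ[k] ofPath k q) ∈ degree k ρ (p.length + q.length)) :
    (Functional.pull (LinearMap.lTensor (PathSpace k ρ) (mulFirstTwo m (PathSpace k ρ))) φ).ofConv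
        ∘ₗ degreeZero₄ k ρ =
      (Functional.pull (LinearMap.lTensor (PathSpace k ρ)
        (mulFirstTwo m (PathSpace k ρ))) φ).ofConv :=
  comp_degreeZero₄ fun p q r t h =>
    apply_eq_zero₃ hφ (ofPath_mem_degree p) (hm q r) (ofPath_mem_degree t) (by omega)

theorem pull_lTensor_lTensor_comp₄ (hφ : φ.ofConv ∘ₗ degreeZero₃ k ρ = φ.ofConv)
    (hm : ∀ p q : Path ρ, m (ofPath k p ⊗ₜ[k] ofPath k q) ∈ degree k ρ (p.length + q.length)) :
    (Functional.pull (LinearMap.lTensor (PathSpace k ρ) (LinearMap.lTensor (PathSpace k ρ) m))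
        φ).ofConv ∘ₗ degreeZero₄ k ρ =
      (Functional.pull (LinearMap.lTensor (PathSpace k ρ) (LinearMap.lTensor (PathSpace k ρ) m))
        φ).ofConv :=
  comp_degreeZero₄ fun p q r t h =>
    apply_eq_zero₃ hφ (ofPath_mem_degree p) (ofPath_mem_degree q) (hm r t) (by omega)

end Pull

end PathSpace

/-! ### The dual quasi-bialgebra attached to an admissible pair -/

section Standard

variable {k : Type*} [Field k] {G : Type*} [CommGroup G] {ρ : G → ℕ}

variable (ρ) in
/-- The product on `kQ` attached to a pair `(Φ, R)`: the vertex `g` acts from the left on the arrow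
from `x` to `t * x` by `Φ(g, x, t)`, and from the right by `rightScalar Φ R x t g`. -/
noncomputable def pairProduct (Φ : G → G → G → k) (R : G → G → k) :
    PathSpace k ρ ⊗[k] PathSpace k ρ →ₗc[k] PathSpace k ρ :=
  (exists_product (fun g x s => Φ g x s.1) fun x s g => rightScalar Φ R x s.1 g).choose

variable (Φ : G → G → G → k) (R : G → G → k)

theorem pairProduct_mem_degree (p q : Path ρ) :
    pairProduct ρ Φ R (ofPath k p ⊗ₜ[k] ofPath k q) ∈ degree k ρ (p.length + q.length) :=
  (exists_product (fun g x s => Φ g x s.1) fun x s g => rightScalar Φ R x s.1 g).choose_spec.1 p q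

theorem pairProduct_vertex_vertex (x y : G) :
    pairProduct ρ Φ R (ofVertex k ρ x ⊗ₜ[k] ofVertex k ρ y) = ofVertex k ρ (x * y) :=
  (exists_product (fun g x s => Φ g x s.1)
    fun x s g => rightScalar Φ R x s.1 g).choose_spec.2.1 x y

theorem pairProduct_vertex_arrow (g x : G) (s : Label ρ) :
    pairProduct ρ Φ R (ofVertex k ρ g ⊗ₜ[k] ofArrow k ρ x s) =
      Φ g x s.1 • ofArrow k ρ (g * x) s :=
  (exists_product (fun g x s => Φ g x s.1)
    fun x s g => rightScalar Φ R x s.1 g).choose_spec.2.2.1 g x s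

theorem pairProduct_arrow_vertex (x : G) (s : Label ρ) (g : G) :
    pairProduct ρ Φ R (ofArrow k ρ x s ⊗ₜ[k] ofVertex k ρ g) =
      rightScalar Φ R x s.1 g • ofArrow k ρ (x * g) s :=
  (exists_product (fun g x s => Φ g x s.1)
    fun x s g => rightScalar Φ R x s.1 g).choose_spec.2.2.2 x s g

variable {Φ R}

namespace IsAdmissiblePair

theorem product_one_mul (h : IsAdmissiblePair ρ Φ R) (a : PathSpace k ρ) :
    pairProduct ρ Φ R (ofVertex k ρ 1 ⊗ₜ[k] a) = a := by
  have hL : ∀ p : Path ρ, pairProduct ρ Φ R (ofVertex k ρ 1 ⊗ₜ[k] ofPath k p) ∈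
      degree k ρ p.length := fun p => by
    have := pairProduct_mem_degree Φ R (Path.vertex ρ 1) p
    rwa [Path.length_vertex, zero_add] at this
  have := coalgHom_ext ((pairProduct ρ Φ R).comp (isGroupLike_ofVertex 1).tmulLeft)
    (CoalgHom.id k _) fun p hp c => LinearMap.congr_fun (coord_comp_eq (basis k ρ) Path.length
      (f := ((pairProduct ρ Φ R).comp (isGroupLike_ofVertex 1).tmulLeft).toLinearMap)
      (g := LinearMap.id) hL ofPath_mem_degree ?_ p hp) c
  · exact CoalgHom.congr_fun this a
  · rintro ⟨x, _ | ⟨s, _ | ⟨s', l⟩⟩⟩ hp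
    · refine (pairProduct_vertex_vertex Φ R 1 x).trans ?_
      rw [one_mul]; rfl
    · refine (pairProduct_vertex_arrow Φ R 1 x s).trans ?_
      rw [one_mul, h.isCocycle.one_left, one_smul]; rfl
    · simp [Path.length] at hp

theorem product_mul_one (h : IsAdmissiblePair ρ Φ R) (a : PathSpace k ρ) :
    pairProduct ρ Φ R (a ⊗ₜ[k] ofVertex k ρ 1) = a := by
  have hL : ∀ p : Path ρ, pairProduct ρ Φ R (ofPath k p ⊗ₜ[k] ofVertex k ρ 1) ∈
      degree k ρ p.length := fun p => pairProduct_mem_degree Φ R p (Path.vertex ρ 1)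
  have := coalgHom_ext ((pairProduct ρ Φ R).comp (isGroupLike_ofVertex 1).tmulRight)
    (CoalgHom.id k _) fun p hp c => LinearMap.congr_fun (coord_comp_eq (basis k ρ) Path.length
      (f := ((pairProduct ρ Φ R).comp (isGroupLike_ofVertex 1).tmulRight).toLinearMap)
      (g := LinearMap.id) hL ofPath_mem_degree ?_ p hp) c
  · exact CoalgHom.congr_fun this a
  · rintro ⟨x, _ | ⟨s, _ | ⟨s', l⟩⟩⟩ hp
    · refine (pairProduct_vertex_vertex Φ R x 1).trans ?_
      rw [mul_one]; rfl
    · refine (pairProduct_arrow_vertex Φ R x s 1).trans ?_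
      rw [mul_one, h.rightScalar_one, one_smul]; rfl
    · simp [Path.length] at hp

theorem product_quasi_assoc (h : IsAdmissiblePair ρ Φ R) :
    convRight ((pairProduct ρ Φ R).toLinearMap ∘ₗ
        LinearMap.lTensor _ (pairProduct ρ Φ R).toLinearMap) (inflate₃ k ρ Φ) =
      convLeft (inflate₃ k ρ Φ) ((pairProduct ρ Φ R).toLinearMap ∘ₗ
        mulFirstTwo (pairProduct ρ Φ R).toLinearMap (PathSpace k ρ)) := by
  set m := pairProduct ρ Φ R with hmdef
  let f : PathSpace k ρ ⊗[k] (PathSpace k ρ ⊗[k] PathSpace k ρ) →ₗc[k] PathSpace k ρ :=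
    m.comp (Coalgebra.TensorProduct.map (CoalgHom.id k _) m)
  let g : PathSpace k ρ ⊗[k] (PathSpace k ρ ⊗[k] PathSpace k ρ) →ₗc[k] PathSpace k ρ :=
    m.comp ((Coalgebra.TensorProduct.map m (CoalgHom.id k _)).comp
      (Coalgebra.TensorProduct.assoc k k _ _ _).symm.toCoalgHom)
  have hf : ∀ a b c, f (a ⊗ₜ[k] (b ⊗ₜ[k] c)) = m (a ⊗ₜ[k] m (b ⊗ₜ[k] c)) := fun _ _ _ => rfl
  have hg : ∀ a b c, g (a ⊗ₜ[k] (b ⊗ₜ[k] c)) = m (m (a ⊗ₜ[k] b) ⊗ₜ[k] c) := fun _ _ _ => rfl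
  have hdeg := mem_degree_of_ofPath (m := m.toLinearMap) (pairProduct_mem_degree Φ R)
  have key : ∀ p q r : Path ρ, p.length + (q.length + r.length) ≤ 1 →
      Φ p.src q.src r.src • f (ofPath k p ⊗ₜ[k] (ofPath k q ⊗ₜ[k] ofPath k r)) =
      Φ p.tgt q.tgt r.tgt • g (ofPath k p ⊗ₜ[k] (ofPath k q ⊗ₜ[k] ofPath k r)) := by
    refine cases_length₃ ?_ ?_ ?_ ?_
    · intro x y z
      rw [hf, hg]
      change _ • m (ofVertex k ρ x ⊗ₜ[k] m (ofVertex k ρ y ⊗ₜ[k] ofVertex k ρ z)) =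
        _ • m (m (ofVertex k ρ x ⊗ₜ[k] ofVertex k ρ y) ⊗ₜ[k] ofVertex k ρ z)
      simp only [hmdef, pairProduct_vertex_vertex, mul_assoc]
      rfl
    · intro x s y z
      rw [hf, hg]
      change Φ x y z • m (ofArrow k ρ x s ⊗ₜ[k] m (ofVertex k ρ y ⊗ₜ[k] ofVertex k ρ z)) =
        Φ (s.1 * x) y z • m (m (ofArrow k ρ x s ⊗ₜ[k] ofVertex k ρ y) ⊗ₜ[k] ofVertex k ρ z)
      simp only [hmdef, pairProduct_vertex_vertex, pairProduct_arrow_vertex,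
        ← TensorProduct.smul_tmul', map_smul, smul_smul, mul_assoc]
      congr 1
      linear_combination h.right_right x s.1 y z
    · intro x y s z
      rw [hf, hg]
      change Φ x y z • m (ofVertex k ρ x ⊗ₜ[k] m (ofArrow k ρ y s ⊗ₜ[k] ofVertex k ρ z)) =
        Φ x (s.1 * y) z • m (m (ofVertex k ρ x ⊗ₜ[k] ofArrow k ρ y s) ⊗ₜ[k] ofVertex k ρ z)
      simp only [hmdef, pairProduct_vertex_arrow, pairProduct_arrow_vertex,
        ← TensorProduct.smul_tmul', TensorProduct.tmul_smul, map_smul, smul_smul, mul_assoc]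
      congr 1
      linear_combination h.left_right x y s.1 z
    · intro x y z s
      rw [hf, hg]
      change Φ x y z • m (ofVertex k ρ x ⊗ₜ[k] m (ofVertex k ρ y ⊗ₜ[k] ofArrow k ρ z s)) =
        Φ x y (s.1 * z) • m (m (ofVertex k ρ x ⊗ₜ[k] ofVertex k ρ y) ⊗ₜ[k] ofArrow k ρ z s)
      simp only [hmdef, pairProduct_vertex_arrow, pairProduct_vertex_vertex,
        TensorProduct.tmul_smul, map_smul, smul_smul, mul_assoc]
      congr 1
      linear_combination h.left_left x y z s.1
  have hR : ∀ p q r : Path ρ, convRight f.toLinearMap (inflate₃ k ρ Φ) (basis₃ k ρ (p, q, r)) =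
      Φ p.src q.src r.src • f (ofPath k p ⊗ₜ[k] (ofPath k q ⊗ₜ[k] ofPath k r)) := by
    intro p q r
    rw [basis₃_apply, (hasSource₃ p q r).convRight _ (inflate₃_comp Φ), inflate₃_vertex]
    rfl
  have hL : ∀ p q r : Path ρ, convLeft (inflate₃ k ρ Φ) g.toLinearMap (basis₃ k ρ (p, q, r)) =
      Φ p.tgt q.tgt r.tgt • g (ofPath k p ⊗ₜ[k] (ofPath k q ⊗ₜ[k] ofPath k r)) := by
    intro p q r
    rw [basis₃_apply, (hasTarget₃ p q r).convLeft _ (inflate₃_comp Φ), inflate₃_vertex]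
    rfl
  refine convRight_eq_convLeft f g _ (coord_comp_eq (basis₃ k ρ)
    (fun i => i.1.length + (i.2.1.length + i.2.2.length)) ?_ ?_ ?_)
  · rintro ⟨p, q, r⟩
    rw [hR]
    exact Submodule.smul_mem _ _ (hdeg _ _ _ _ (ofPath_mem_degree p)
      (pairProduct_mem_degree Φ R q r))
  · rintro ⟨p, q, r⟩
    rw [hL]
    exact Submodule.smul_mem _ _ (add_assoc p.length q.length r.length ▸
      hdeg _ _ _ _ (pairProduct_mem_degree Φ R p q) (ofPath_mem_degree r))
  · rintro ⟨p, q, r⟩ hpqr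
    rw [hR, hL]
    exact key p q r hpqr

theorem product_comm (h : IsAdmissiblePair ρ Φ R) :
    convRight ((pairProduct ρ Φ R).toLinearMap ∘ₗ (TensorProduct.comm k _ _).toLinearMap)
      (inflate₂ k ρ R) = convLeft (inflate₂ k ρ R) (pairProduct ρ Φ R).toLinearMap := by
  set m := pairProduct ρ Φ R with hmdef
  have hR : ∀ p q : Path ρ, convRight (m.comp (commCoalgHom k _)).toLinearMap (inflate₂ k ρ R)
      (basis₂ k ρ (p, q)) = R p.src q.src • m (ofPath k q ⊗ₜ[k] ofPath k p) := by
    intro p q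
    rw [basis₂_apply, (hasSource₂ p q).convRight _ (inflate₂_comp R), inflate₂_vertex]
    rfl
  have hL : ∀ p q : Path ρ, convLeft (inflate₂ k ρ R) m.toLinearMap
      (basis₂ k ρ (p, q)) = R p.tgt q.tgt • m (ofPath k p ⊗ₜ[k] ofPath k q) := by
    intro p q
    rw [basis₂_apply, (hasTarget₂ p q).convLeft _ (inflate₂_comp R), inflate₂_vertex]
    rfl
  have key : ∀ p q : Path ρ, p.length + q.length ≤ 1 →
      R p.src q.src • m (ofPath k q ⊗ₜ[k] ofPath k p) =
      R p.tgt q.tgt • m (ofPath k p ⊗ₜ[k] ofPath k q) := by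
    refine cases_length₂ ?_ ?_ ?_
    · intro x y
      change R x y • m (ofVertex k ρ y ⊗ₜ[k] ofVertex k ρ x) =
        R x y • m (ofVertex k ρ x ⊗ₜ[k] ofVertex k ρ y)
      simp only [hmdef, pairProduct_vertex_vertex, mul_comm x y]
    · intro x s y
      change R x y • m (ofVertex k ρ y ⊗ₜ[k] ofArrow k ρ x s) =
        R (s.1 * x) y • m (ofArrow k ρ x s ⊗ₜ[k] ofVertex k ρ y)
      simp only [hmdef, pairProduct_vertex_arrow, pairProduct_arrow_vertex, mul_comm x y,
        smul_smul]
      congr 1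
      linear_combination -h.R_mul_rightScalar x s.1 y
    · intro x y s
      change R x y • m (ofArrow k ρ y s ⊗ₜ[k] ofVertex k ρ x) =
        R x (s.1 * y) • m (ofVertex k ρ x ⊗ₜ[k] ofArrow k ρ y s)
      simp only [hmdef, pairProduct_vertex_arrow, pairProduct_arrow_vertex, mul_comm y x,
        smul_smul]
      congr 1
      linear_combination h.rightScalar_mul_R y s.1 x
  refine convRight_eq_convLeft (m.comp (commCoalgHom k _)) m _ (coord_comp_eq (basis₂ k ρ)
    (fun i => i.1.length + i.2.length) ?_ ?_ ?_)
  · rintro ⟨p, q⟩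
    rw [hR]
    exact Submodule.smul_mem _ _ (add_comm q.length p.length ▸ pairProduct_mem_degree Φ R q p)
  · rintro ⟨p, q⟩
    rw [hL]
    exact Submodule.smul_mem _ _ (pairProduct_mem_degree Φ R p q)
  · rintro ⟨p, q⟩ hpq
    rw [hR, hL]
    exact key p q hpq

theorem product_pentagon (h : IsAdmissiblePair ρ Φ R) :
    Functional.pull (LinearMap.lTensor _ (LinearMap.lTensor _ (pairProduct ρ Φ R).toLinearMap))
          (inflate₃ k ρ Φ) *
        Functional.pull (mulFirstTwo (pairProduct ρ Φ R).toLinearMap _) (inflate₃ k ρ Φ) =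
      Functional.pull (keepBCD k _) (inflate₃ k ρ Φ) *
        Functional.pull (LinearMap.lTensor _ (mulFirstTwo (pairProduct ρ Φ R).toLinearMap _))
          (inflate₃ k ρ Φ) *
        Functional.pull (keepABC k _) (inflate₃ k ρ Φ) := by
  have hΦ := inflate₃_comp (k := k) (ρ := ρ) Φ
  have hm := pairProduct_mem_degree (ρ := ρ) Φ R
  refine WithConv.ofConv_injective (ext_vertex₄
    (mul_comp_degreeZero₄ (pull_lTensor_lTensor_comp₄ hΦ hm) (pull_mulFirstTwo_comp₄ hΦ hm))
    (mul_comp_degreeZero₄ (mul_comp_degreeZero₄ (pull_keepBCD_comp hΦ)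
      (pull_lTensor_mulFirstTwo_comp₄ hΦ hm)) (pull_keepABC_comp hΦ)) fun x y z w => ?_)
  have hg := isGroupLike₄ (k := k) (ρ := ρ) x y z w
  rw [hg.functional_mul, hg.functional_mul, hg.functional_mul, pull_keepBCD_ofConv,
    pull_keepABC_ofConv, counit_ofVertex, counit_ofVertex, one_mul, one_mul, inflate₃_vertex,
    inflate₃_vertex]
  change (inflate₃ k ρ Φ).ofConv (ofVertex k ρ x ⊗ₜ[k] (ofVertex k ρ y ⊗ₜ[k]
      pairProduct ρ Φ R (ofVertex k ρ z ⊗ₜ[k] ofVertex k ρ w))) *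
    (inflate₃ k ρ Φ).ofConv (pairProduct ρ Φ R (ofVertex k ρ x ⊗ₜ[k] ofVertex k ρ y) ⊗ₜ[k]
      (ofVertex k ρ z ⊗ₜ[k] ofVertex k ρ w)) = _ * (inflate₃ k ρ Φ).ofConv (ofVertex k ρ x ⊗ₜ[k]
      (pairProduct ρ Φ R (ofVertex k ρ y ⊗ₜ[k] ofVertex k ρ z) ⊗ₜ[k] ofVertex k ρ w)) * _
  simp only [pairProduct_vertex_vertex, inflate₃_vertex]
  exact h.isCocycle.cocycle x y z w

theorem product_normalized (h : IsAdmissiblePair ρ Φ R) (a b : PathSpace k ρ) :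
    (inflate₃ k ρ Φ).ofConv (a ⊗ₜ[k] (ofVertex k ρ 1 ⊗ₜ[k] b)) =
      Coalgebra.counit (R := k) a * Coalgebra.counit (R := k) b := by
  have : (inflate₃ k ρ Φ).ofConv ∘ₗ LinearMap.lTensor _ (TensorProduct.mk k _ _ (ofVertex k ρ 1)) =
      LinearMap.mul' k k ∘ₗ TensorProduct.map Coalgebra.counit Coalgebra.counit := by
    refine ext_vertex₂ (comp_degreeZero₂ fun p q hpq => apply_eq_zero₃ (inflate₃_comp Φ)
      (ofPath_mem_degree p) (ofVertex_mem_degree 1) (ofPath_mem_degree q) (by tauto))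
      (comp_degreeZero₂ fun p q hpq => ?_) fun x y => ?_
    · have : p.length ≠ 0 ∨ q.length ≠ 0 := by tauto
      rcases this with hp | hp <;> simp [counit_ofPath_eq_zero hp]
    · simp [inflate₃_vertex, counit_ofVertex, h.isCocycle.normalized]
  exact LinearMap.congr_fun this (a ⊗ₜ[k] b)

/-- The dual quasi-bialgebra attached to an admissible pair. -/
noncomputable def dualQuasiBialgebra (h : IsAdmissiblePair ρ Φ R) :
    DualQuasiBialgebra k (PathSpace k ρ) where
  mul := pairProduct ρ Φ R
  one := ofVertex k ρ 1
  isGroupLike_one := isGroupLike_ofVertex 1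
  Φ := inflateUnit₃ ρ Φ h.isCocycle.ne_zero
  one_mul := h.product_one_mul
  mul_one := h.product_mul_one
  quasi_assoc := h.product_quasi_assoc
  pentagon := h.product_pentagon
  normalized := h.product_normalized

theorem product_R_mul_left (h : IsAdmissiblePair ρ Φ R) :
    Functional.pull (mulFirstTwo (pairProduct ρ Φ R).toLinearMap _) (inflate₂ k ρ R) =
      Functional.pull (permCAB k _) (inflate₃ k ρ Φ) * Functional.pull (keepAC k _)
        (inflate₂ k ρ R) * Functional.pull (permACB k _) (inflate₃ k ρ fun x y z => (Φ x y z)⁻¹) *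
        Functional.pull (keepBC k _) (inflate₂ k ρ R) * inflate₃ k ρ Φ := by
  have hΦ := inflate₃_comp (k := k) (ρ := ρ) Φ
  have hΦ' := inflate₃_comp (k := k) (ρ := ρ) fun x y z => (Φ x y z)⁻¹
  have hR := inflate₂_comp (k := k) (ρ := ρ) R
  have hm := pairProduct_mem_degree (ρ := ρ) Φ R
  refine WithConv.ofConv_injective (ext_vertex₃ (pull_mulFirstTwo_comp₃ hR hm)
    (mul_comp_degreeZero₃ (mul_comp_degreeZero₃ (mul_comp_degreeZero₃ (mul_comp_degreeZero₃
      (pull_permCAB_comp hΦ) (pull_keepAC_comp hR)) (pull_permACB_comp hΦ'))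
      (pull_keepBC_comp hR)) hΦ) fun x y z => ?_)
  have hg := isGroupLike₃ (k := k) (ρ := ρ) x y z
  simp only [hg.functional_mul, pull_keepAC_ofConv, pull_keepBC_ofConv, counit_ofVertex, one_mul,
    inflate₂_vertex, inflate₃_vertex]
  change (inflate₂ k ρ R).ofConv (pairProduct ρ Φ R (ofVertex k ρ x ⊗ₜ[k] ofVertex k ρ y) ⊗ₜ[k]
      ofVertex k ρ z) =
    (inflate₃ k ρ Φ).ofConv (ofVertex k ρ z ⊗ₜ[k] (ofVertex k ρ x ⊗ₜ[k] ofVertex k ρ y)) * _ *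
    (inflate₃ k ρ fun x y z => (Φ x y z)⁻¹).ofConv
      (ofVertex k ρ x ⊗ₜ[k] (ofVertex k ρ z ⊗ₜ[k] ofVertex k ρ y)) * _ * _
  rw [pairProduct_vertex_vertex, inflate₂_vertex, inflate₃_vertex, inflate₃_vertex, h.R_mul_left]
  ring

theorem product_R_mul_right (h : IsAdmissiblePair ρ Φ R) :
    Functional.pull (LinearMap.lTensor _ (pairProduct ρ Φ R).toLinearMap) (inflate₂ k ρ R) =
      Functional.pull (permBCA k _) (inflate₃ k ρ fun x y z => (Φ x y z)⁻¹) *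
        Functional.pull (keepAC k _) (inflate₂ k ρ R) * Functional.pull (permBAC k _)
        (inflate₃ k ρ Φ) * Functional.pull (keepAB k _) (inflate₂ k ρ R) *
        inflate₃ k ρ fun x y z => (Φ x y z)⁻¹ := by
  have hΦ := inflate₃_comp (k := k) (ρ := ρ) Φ
  have hΦ' := inflate₃_comp (k := k) (ρ := ρ) fun x y z => (Φ x y z)⁻¹
  have hR := inflate₂_comp (k := k) (ρ := ρ) R
  have hm := pairProduct_mem_degree (ρ := ρ) Φ R
  refine WithConv.ofConv_injective (ext_vertex₃ (pull_lTensor_comp₃ hR hm)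
    (mul_comp_degreeZero₃ (mul_comp_degreeZero₃ (mul_comp_degreeZero₃ (mul_comp_degreeZero₃
      (pull_permBCA_comp hΦ') (pull_keepAC_comp hR)) (pull_permBAC_comp hΦ))
      (pull_keepAB_comp hR)) hΦ') fun x y z => ?_)
  have hg := isGroupLike₃ (k := k) (ρ := ρ) x y z
  simp only [hg.functional_mul, pull_keepAC_ofConv, pull_keepAB_ofConv, counit_ofVertex, one_mul,
    inflate₂_vertex, inflate₃_vertex]
  change (inflate₂ k ρ R).ofConv (ofVertex k ρ x ⊗ₜ[k]
      pairProduct ρ Φ R (ofVertex k ρ y ⊗ₜ[k] ofVertex k ρ z)) =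
    (inflate₃ k ρ fun x y z => (Φ x y z)⁻¹).ofConv
      (ofVertex k ρ y ⊗ₜ[k] (ofVertex k ρ z ⊗ₜ[k] ofVertex k ρ x)) * _ *
    (inflate₃ k ρ Φ).ofConv (ofVertex k ρ y ⊗ₜ[k] (ofVertex k ρ x ⊗ₜ[k] ofVertex k ρ z)) * _ * _
  rw [pairProduct_vertex_vertex, inflate₂_vertex, inflate₃_vertex, inflate₃_vertex, h.R_mul_right]
  ring

end IsAdmissiblePair

end Standard

/-! ### The quasi-antipode attached to an admissible pair -/

namespace HopfQuiver.Path

variable {G : Type*} [CommGroup G] {ρ : G → ℕ}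

theorem walk_append (x : G) (l m : List (Label ρ)) : walk x (l ++ m) = walk (walk x l) m :=
  List.foldl_append

theorem walk_eq_prod_mul (x : G) (l : List (Label ρ)) :
    walk x l = (l.map Sigma.fst).prod * x := by
  induction l generalizing x with
  | nil => simp [walk]
  | cons s l ih =>
    change walk (s.1 * x) l = _
    rw [ih, List.map_cons, List.prod_cons, mul_assoc, mul_left_comm]

theorem tgt_final (p : Path ρ) (i : ℕ) : (p.final i).tgt = p.tgt := by
  simp only [final, initial, tgt]
  rw [← walk_append, List.take_append_drop]

/-- The path with inverted vertices that traverses the labels of `p` backwards. -/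
def reverse (p : Path ρ) : Path ρ := ⟨p.tgt⁻¹, p.labels.reverse⟩

theorem length_reverse (p : Path ρ) : p.reverse.length = p.length := by simp [reverse, length]

theorem initial_reverse (p : Path ρ) (i : ℕ) :
    p.reverse.initial (p.length - i) = (p.final i).reverse := by
  rw [reverse, reverse, tgt_final]
  simp [initial, final, length, List.take_reverse]
  omega

theorem final_reverse (p : Path ρ) {i : ℕ} (h : i ≤ p.length) :
    p.reverse.final (p.length - i) = (p.initial i).reverse := by
  rw [final, initial_reverse]
  refine Path.ext ?_ ?_
  · simp only [reverse, tgt]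
    rw [walk_eq_prod_mul, List.map_reverse, List.prod_reverse, walk_eq_prod_mul (p.final i).src,
      mul_inv_rev, mul_comm, mul_assoc, inv_mul_cancel, mul_one]
    rfl
  · simp only [reverse, initial, length] at h ⊢
    rw [List.drop_reverse, Nat.sub_sub_self h]

/-- Regrouping the splittings of a path into four parts: the two middle parts form a path together,
and the sum over all ways to split the latter vanishes. -/
theorem sum_sandwich {k : Type*} [Field k] (H N : Path ρ → Path ρ → k)
    (hH : ∀ q : Path ρ, ∑ J ∈ Finset.range (q.length + 1), H (q.final J) (q.initial J) = 0)
    (p : Path ρ) :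
    ∑ J ∈ Finset.range (p.length + 1), ∑ i ∈ Finset.range ((p.final J).length + 1),
      ∑ j ∈ Finset.range ((p.initial J).length + 1),
        H ((p.final J).initial i) ((p.initial J).final j) *
          N ((p.final J).final i) ((p.initial J).initial j) = 0 := by
  have key : ∑ K ∈ Finset.range (p.length + 1), ∑ j ∈ Finset.range (K + 1),
      (∑ t ∈ Finset.range (((p.initial K).final j).length + 1),
        H (((p.initial K).final j).final t) (((p.initial K).final j).initial t)) *
          N (p.final K) (p.initial j) = 0 :=
    Finset.sum_eq_zero fun K _ => Finset.sum_eq_zero fun j _ => by rw [hH, zero_mul]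
  rw [← key]
  simp only [Finset.sum_mul]
  simp only [Finset.sum_sigma']
  -- In terms of the cutting points `j ≤ J ≤ K` of `p`, with `i = K - J` and `t = J - j`.
  refine Finset.sum_bij' (fun a _ => ⟨a.1 + a.2.1, a.2.2, a.1 - a.2.2⟩)
    (fun b _ => ⟨b.2.1 + b.2.2, b.1 - (b.2.1 + b.2.2), b.2.1⟩) ?_ ?_ ?_ ?_ ?_
  · rintro ⟨J, i, j⟩ h
    simp only [Finset.mem_sigma, Finset.mem_range, length_final] at h ⊢
    obtain ⟨h₁, h₂, h₃⟩ := h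
    rw [length_initial _ (by omega)] at h₃
    rw [length_initial _ (by omega)]
    omega
  · rintro ⟨K, j, t⟩ h
    simp only [Finset.mem_sigma, Finset.mem_range, length_final] at h ⊢
    obtain ⟨h₁, h₂, h₃⟩ := h
    rw [length_initial _ (by omega)] at h₃
    rw [length_initial _ (by omega)]
    omega
  · rintro ⟨J, i, j⟩ h
    simp only [Finset.mem_sigma, Finset.mem_range, length_final] at h ⊢
    obtain ⟨h₁, h₂, h₃⟩ := h
    rw [length_initial _ (by omega)] at h₃
    simp only [Sigma.mk.injEq, heq_eq_eq, and_true]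
    omega
  · rintro ⟨K, j, t⟩ h
    simp only [Finset.mem_sigma, Finset.mem_range, length_final] at h ⊢
    obtain ⟨h₁, h₂, h₃⟩ := h
    rw [length_initial _ (by omega)] at h₃
    rw [show j + t + (K - (j + t)) = K by omega, Nat.add_sub_cancel_left]
  · rintro ⟨J, i, j⟩ h
    simp only [Finset.mem_sigma, Finset.mem_range, length_final] at h ⊢
    obtain ⟨h₁, h₂, h₃⟩ := h
    rw [length_initial _ (by omega)] at h₃
    obtain ⟨t, rfl⟩ : ∃ t, J = j + t := ⟨J - j, by omega⟩
    rw [Nat.add_sub_cancel_left, final_final, initial_final, initial_initial, final_final,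
      initial_final, initial_initial]

end HopfQuiver.Path

section Scalars

variable {k : Type*} [Field k] {G : Type*} [CommGroup G] {ρ : G → ℕ} {Φ : G → G → G → k}
  {R : G → G → k}

/-- The scalar by which the antipode acts on the arrow from `x` to `t * x`. -/
noncomputable def antipodeScalar (Φ : G → G → G → k) (R : G → G → k) (x t : G) : k :=
  -(Φ (t * x)⁻¹ x t / rightScalar Φ R (t * x)⁻¹ t x)

namespace IsAdmissiblePair

/-- The coefficient of `S(c₁) c₂` vanishes for an arrow `c`. -/
theorem antipodeScalar_left (h : IsAdmissiblePair ρ Φ R) (x t : G) :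
    antipodeScalar Φ R x t * rightScalar Φ R (t * x)⁻¹ t x + Φ (t * x)⁻¹ x t = 0 := by
  have := h.rightScalar_ne_zero (t * x)⁻¹ t x
  rw [antipodeScalar]
  field_simp
  ring

/-- The coefficient of `c₁ β(c₂) S(c₃)` vanishes for an arrow `c`. -/
theorem antipodeScalar_right (h : IsAdmissiblePair ρ Φ R) (x t : G) :
    (Φ x x⁻¹ x)⁻¹ * rightScalar Φ R x t x⁻¹ +
      (Φ (t * x) (t * x)⁻¹ (t * x))⁻¹ * (antipodeScalar Φ R x t * Φ (t * x) (t * x)⁻¹ t) = 0 := by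
  have hA := h.left_right (t * x) (t * x)⁻¹ t x
  have hB := h.right_right x t x⁻¹ x
  have hC := h.left_left (t * x) (t * x)⁻¹ x t
  have e₁ : t * (t * x)⁻¹ = x⁻¹ := by rw [mul_inv, mul_inv_cancel_left]
  rw [e₁, mul_inv_cancel] at hA
  rw [inv_mul_cancel, mul_inv_cancel, h.rightScalar_one, one_mul] at hB
  rw [mul_inv_cancel, h.isCocycle.one_left, mul_one] at hC
  have n₁ := h.rightScalar_ne_zero (t * x)⁻¹ t x
  have n₂ := h.isCocycle.ne_zero x x⁻¹ x
  have n₃ := h.isCocycle.ne_zero (t * x) (t * x)⁻¹ (t * x)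
  rw [antipodeScalar]
  generalize (t * x)⁻¹ = y' at *
  field_simp
  linear_combination (-rightScalar Φ R x t x⁻¹ * rightScalar Φ R y' t x) * hC +
    (rightScalar Φ R x t x⁻¹ * Φ y' x t) * hA - (Φ y' x t * Φ (t * x) y' t) * hB

/-- The antipode condition that involves `Φ⁻¹`, for `β(g) = Φ(g, g⁻¹, g)⁻¹`, at a vertex. -/
theorem mul_inv_cocycle (h : IsAdmissiblePair ρ Φ R) (g : G) : Φ g⁻¹ g g⁻¹ * Φ g g⁻¹ g = 1 := by
  have := h.isCocycle.cocycle g g⁻¹ g g⁻¹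
  rw [mul_inv_cancel, inv_mul_cancel, h.isCocycle.one_right, h.isCocycle.one_left,
    h.isCocycle.normalized] at this
  linear_combination -this

end IsAdmissiblePair

end Scalars

section Antipode

variable {k : Type*} [Field k] {G : Type*} [CommGroup G] {ρ : G → ℕ} (Φ : G → G → G → k)
  (R : G → G → k)

/-- The scalar by which the antipode acts on a path, the product of those of its arrows. -/
noncomputable def pathScalar : G → List (Label ρ) → k
  | _, [] => 1
  | x, s :: l => pathScalar (s.1 * x) l * antipodeScalar Φ R x s.1

theorem pathScalar_append (x : G) (l m : List (Label ρ)) :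
    pathScalar Φ R x (l ++ m) = pathScalar Φ R (Path.walk x l) m * pathScalar Φ R x l := by
  induction l generalizing x with
  | nil => simp [pathScalar, Path.walk]
  | cons s l ih =>
    rw [List.cons_append, pathScalar, pathScalar, ih, mul_assoc]
    rfl

variable (ρ) in
/-- The antipode of the dual quasi-bialgebra attached to `(Φ, R)`: it reverses paths, inverts
vertices and multiplies by a scalar. -/
noncomputable def pairAntipode : PathSpace k ρ →ₗ[k] PathSpace k ρ :=
  (basis k ρ).constr k fun p => pathScalar Φ R p.src p.labels • ofPath k p.reverse

theorem pairAntipode_ofPath (p : Path ρ) : pairAntipode ρ Φ R (ofPath k p) =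
    pathScalar Φ R p.src p.labels • ofPath k p.reverse :=
  (basis k ρ).constr_basis k _ p

theorem pairAntipode_vertex (x : G) :
    pairAntipode ρ Φ R (ofVertex k ρ x) = ofVertex k ρ x⁻¹ :=
  (pairAntipode_ofPath Φ R _).trans (one_smul k _)

theorem pairAntipode_arrow (x : G) (s : Label ρ) : pairAntipode ρ Φ R (ofArrow k ρ x s) =
    antipodeScalar Φ R x s.1 • ofArrow k ρ (s.1 * x)⁻¹ s := by
  refine (pairAntipode_ofPath Φ R _).trans ?_
  rw [pathScalar, pathScalar, one_mul]
  rfl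

theorem pairAntipode_ofPath_mem_degree (p : Path ρ) :
    pairAntipode ρ Φ R (ofPath k p) ∈ degree k ρ p.length := by
  rw [pairAntipode_ofPath, ← Path.length_reverse]
  exact Submodule.smul_mem _ _ (ofPath_mem_degree _)

theorem pairAntipode_mem_degree (n : ℕ) (x : PathSpace k ρ) (hx : x ∈ degree k ρ n) :
    pairAntipode ρ Φ R x ∈ degree k ρ n := by
  induction hx using Submodule.span_induction with
  | zero => simp
  | add u v _ _ hu hv => rw [map_add]; exact add_mem hu hv
  | smul a u _ hu => rw [map_smul]; exact Submodule.smul_mem _ _ hu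
  | mem z hz =>
    obtain ⟨p, rfl, rfl⟩ := hz
    exact pairAntipode_ofPath_mem_degree Φ R p

theorem comul_pairAntipode (p : Path ρ) :
    Coalgebra.comul (R := k) (pairAntipode ρ Φ R (ofPath k p)) =
      ∑ i ∈ Finset.range (p.length + 1), pairAntipode ρ Φ R (ofPath k (p.initial i)) ⊗ₜ[k]
        pairAntipode ρ Φ R (ofPath k (p.final i)) := by
  rw [pairAntipode_ofPath, map_smul, comul_ofPath, Path.length_reverse, ← Finset.sum_range_reflect,
    Finset.smul_sum]
  refine Finset.sum_congr rfl fun i hi => ?_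
  have hi : i ≤ p.length := by simpa [Nat.lt_succ_iff] using hi
  rw [Nat.add_sub_cancel, Path.initial_reverse, Path.final_reverse _ hi, pairAntipode_ofPath,
    pairAntipode_ofPath, TensorProduct.smul_tmul_smul, mul_comm]
  congr 1
  have := pathScalar_append Φ R p.src (p.labels.take i) (p.labels.drop i)
  rwa [List.take_append_drop] at this

end Antipode

section Convolution

variable {k : Type*} [Field k] {G : Type*} [CommGroup G] {ρ : G → ℕ} {Φ : G → G → G → k}
  {R : G → G → k}

theorem comul_pairAntipode_tmul (q r : Path ρ) :
    Coalgebra.comul (R := k) (pairAntipode ρ Φ R (ofPath k q) ⊗ₜ[k] ofPath k r) =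
      ∑ i ∈ Finset.range (q.length + 1), ∑ j ∈ Finset.range (r.length + 1),
        (pairAntipode ρ Φ R (ofPath k (q.initial i)) ⊗ₜ[k] ofPath k (r.final j)) ⊗ₜ[k]
          (pairAntipode ρ Φ R (ofPath k (q.final i)) ⊗ₜ[k] ofPath k (r.initial j)) := by
  rw [TensorProduct.comul_tmul, TensorProduct.AlgebraTensorModule.tensorTensorTensorComm_eq,
    comul_pairAntipode, comul_ofPath, TensorProduct.sum_tmul, map_sum]
  refine Finset.sum_congr rfl fun i _ => ?_
  rw [TensorProduct.tmul_sum, map_sum]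
  rfl

theorem comul_tmul_pairAntipode (q r : Path ρ) :
    Coalgebra.comul (R := k) (ofPath k q ⊗ₜ[k] pairAntipode ρ Φ R (ofPath k r)) =
      ∑ i ∈ Finset.range (q.length + 1), ∑ j ∈ Finset.range (r.length + 1),
        (ofPath k (q.final i) ⊗ₜ[k] pairAntipode ρ Φ R (ofPath k (r.initial j))) ⊗ₜ[k]
          (ofPath k (q.initial i) ⊗ₜ[k] pairAntipode ρ Φ R (ofPath k (r.final j))) := by
  rw [TensorProduct.comul_tmul, TensorProduct.AlgebraTensorModule.tensorTensorTensorComm_eq,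
    comul_pairAntipode, comul_ofPath, TensorProduct.sum_tmul, map_sum]
  refine Finset.sum_congr rfl fun i _ => ?_
  rw [TensorProduct.tmul_sum, map_sum]
  rfl

/-- `S(c₁) c₂ = ε(c) 1`. The coefficient of `S(c₁) c₂` at the path `a p`, with `a` its last arrow,
is the sum of the products of the coefficient of `S(c₂) c₃` at `a` and that of `S(c₁) c₄` at `p`,
so it suffices to consider the coefficients at arrows. -/
theorem IsAdmissiblePair.sum_antipode_mul (h : IsAdmissiblePair ρ Φ R) (p : Path ρ)
    (hp : p.length ≠ 0) : ∑ J ∈ Finset.range (p.length + 1), pairProduct ρ Φ R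
      (pairAntipode ρ Φ R (ofPath k (p.final J)) ⊗ₜ[k] ofPath k (p.initial J)) = 0 := by
  have hdeg : ∀ p : Path ρ, ∑ J ∈ Finset.range (p.length + 1), pairProduct ρ Φ R
      (pairAntipode ρ Φ R (ofPath k (p.final J)) ⊗ₜ[k] ofPath k (p.initial J)) ∈
        degree k ρ p.length := by
    refine fun p => Submodule.sum_mem _ fun J hJ => ?_
    have hJ : J ≤ p.length := by simpa [Nat.lt_succ_iff] using hJ
    have := mem_degree_of_ofPath (m := (pairProduct ρ Φ R).toLinearMap)
      (pairProduct_mem_degree Φ R) _ _ _ _ (pairAntipode_ofPath_mem_degree Φ R (p.final J))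
      (ofPath_mem_degree (k := k) (p.initial J))
    rwa [Path.length_final, Path.length_initial _ hJ, Nat.sub_add_cancel hJ] at this
  have hone : ∀ (x : G) (s : Label ρ) (q : Path ρ), ∑ J ∈ Finset.range (q.length + 1),
      coord k ⟨x, [s]⟩ (pairProduct ρ Φ R
      (pairAntipode ρ Φ R (ofPath k (q.final J)) ⊗ₜ[k] ofPath k (q.initial J))) = 0 := by
    intro x s q
    rw [← map_sum]
    by_cases hq : q.length = 1
    · obtain ⟨y, t, rfl⟩ := Path.eq_arrow hq
      convert map_zero (coord k _)
      rw [hq, Finset.sum_range_succ, Finset.sum_range_one]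
      change pairProduct ρ Φ R (pairAntipode ρ Φ R (ofArrow k ρ y t) ⊗ₜ[k] ofVertex k ρ y) +
        pairProduct ρ Φ R (pairAntipode ρ Φ R (ofVertex k ρ (t.1 * y)) ⊗ₜ[k] ofArrow k ρ y t) = 0
      rw [pairAntipode_arrow, pairAntipode_vertex, ← TensorProduct.smul_tmul', map_smul,
        pairProduct_arrow_vertex, pairProduct_vertex_arrow, smul_smul, ← add_smul,
        h.antipodeScalar_left, zero_smul]
    · exact coord_eq_zero_of_mem_degree (hdeg q) (Ne.symm hq)
  refine ext_coord fun r => ?_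
  rw [map_zero]
  by_cases hr : r.length = p.length
  swap
  · exact coord_eq_zero_of_mem_degree (hdeg p) hr
  obtain ⟨x, l⟩ := r
  -- The last arrow of `r` is split off.
  obtain ⟨l, s, rfl⟩ : ∃ l' s, l = l' ++ [s] := by
    rcases List.eq_nil_or_concat l with rfl | ⟨l', s, rfl⟩
    · exact absurd hr.symm hp
    · exact ⟨l', s, by simp⟩
  have hsplit := (coord_mul_coord (k := k) (⟨Path.walk x l, [s]⟩ : Path ρ) ⟨x, l⟩).trans
    (if_pos rfl)
  have hmul : ∀ z, coord k ⟨x, l ++ [s]⟩ (pairProduct ρ Φ R z) =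
      (Functional.pull (pairProduct ρ Φ R).toLinearMap
          (WithConv.toConv (coord k ⟨Path.walk x l, [s]⟩)) *
        Functional.pull (pairProduct ρ Φ R).toLinearMap
          (WithConv.toConv (coord k ⟨x, l⟩))).ofConv z := by
    intro z
    rw [← Functional.pull_mul, hsplit]
    rfl
  rw [map_sum]
  refine Eq.trans (Finset.sum_congr rfl fun J _ => ?_)
    (Path.sum_sandwich (fun q r => coord k ⟨Path.walk x l, [s]⟩ (pairProduct ρ Φ R
      (pairAntipode ρ Φ R (ofPath k q) ⊗ₜ[k] ofPath k r)))
      (fun q r => coord k ⟨x, l⟩ (pairProduct ρ Φ R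
      (pairAntipode ρ Φ R (ofPath k q) ⊗ₜ[k] ofPath k r))) (hone _ s) p)
  rw [hmul, Functional.mul_ofConv, comul_pairAntipode_tmul]
  simp only [map_sum, TensorProduct.map_tmul, LinearMap.mul'_apply]
  rfl

/-- `c₁ β(c₂) S(c₃) = β(c) 1`, by the argument of `sum_antipode_mul` with the first arrow in place
of the last one. -/
theorem IsAdmissiblePair.sum_mul_antipode (h : IsAdmissiblePair ρ Φ R) (p : Path ρ)
    (hp : p.length ≠ 0) : ∑ J ∈ Finset.range (p.length + 1),
      (Φ (p.initial J).tgt (p.initial J).tgt⁻¹ (p.initial J).tgt)⁻¹ • pairProduct ρ Φ R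
      (ofPath k (p.final J) ⊗ₜ[k] pairAntipode ρ Φ R (ofPath k (p.initial J))) = 0 := by
  have hdeg : ∀ p : Path ρ, ∑ J ∈ Finset.range (p.length + 1),
      (Φ (p.initial J).tgt (p.initial J).tgt⁻¹ (p.initial J).tgt)⁻¹ • pairProduct ρ Φ R
      (ofPath k (p.final J) ⊗ₜ[k] pairAntipode ρ Φ R (ofPath k (p.initial J))) ∈
        degree k ρ p.length := by
    refine fun p => Submodule.sum_mem _ fun J hJ => Submodule.smul_mem _ _ ?_
    have hJ : J ≤ p.length := by simpa [Nat.lt_succ_iff] using hJ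
    have := mem_degree_of_ofPath (m := (pairProduct ρ Φ R).toLinearMap)
      (pairProduct_mem_degree Φ R) _ _ _ _ (ofPath_mem_degree (k := k) (p.final J))
      (pairAntipode_ofPath_mem_degree Φ R (p.initial J))
    rwa [Path.length_final, Path.length_initial _ hJ, Nat.sub_add_cancel hJ] at this
  have hone : ∀ (x : G) (s : Label ρ) (q : Path ρ), ∑ J ∈ Finset.range (q.length + 1),
      (Φ (q.initial J).tgt (q.initial J).tgt⁻¹ (q.initial J).tgt)⁻¹ *
      coord k ⟨x, [s]⟩ (pairProduct ρ Φ R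
      (ofPath k (q.final J) ⊗ₜ[k] pairAntipode ρ Φ R (ofPath k (q.initial J)))) = 0 := by
    intro x s q
    refine (Finset.sum_congr rfl fun J _ => (map_smul (coord k _) _ _).symm).trans ?_
    rw [← map_sum]
    by_cases hq : q.length = 1
    · obtain ⟨y, t, rfl⟩ := Path.eq_arrow hq
      convert map_zero (coord k _)
      rw [hq, Finset.sum_range_succ, Finset.sum_range_one]
      change (Φ y y⁻¹ y)⁻¹ • pairProduct ρ Φ R
          (ofArrow k ρ y t ⊗ₜ[k] pairAntipode ρ Φ R (ofVertex k ρ y)) +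
        (Φ (t.1 * y) (t.1 * y)⁻¹ (t.1 * y))⁻¹ • pairProduct ρ Φ R
          (ofVertex k ρ (t.1 * y) ⊗ₜ[k] pairAntipode ρ Φ R (ofArrow k ρ y t)) = 0
      rw [pairAntipode_arrow, pairAntipode_vertex, TensorProduct.tmul_smul, map_smul,
        pairProduct_arrow_vertex, pairProduct_vertex_arrow, smul_smul, smul_smul, smul_smul,
        mul_inv_cancel, mul_inv_cancel, ← add_smul, mul_assoc, h.antipodeScalar_right, zero_smul]
    · exact coord_eq_zero_of_mem_degree (hdeg q) (Ne.symm hq)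
  refine ext_coord fun r => ?_
  rw [map_zero]
  by_cases hr : r.length = p.length
  swap
  · exact coord_eq_zero_of_mem_degree (hdeg p) hr
  obtain ⟨x, _ | ⟨s, l⟩⟩ := r
  · exact absurd hr.symm hp
  have hmul : ∀ z, coord k ⟨x, s :: l⟩ (pairProduct ρ Φ R z) =
      (Functional.pull (pairProduct ρ Φ R).toLinearMap
          (WithConv.toConv (coord k ⟨s.1 * x, l⟩)) *
        Functional.pull (pairProduct ρ Φ R).toLinearMap
          (WithConv.toConv (coord k ⟨x, [s]⟩))).ofConv z := by
    intro z
    rw [← Functional.pull_mul, ← coord_cons]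
    rfl
  rw [map_sum]
  refine Eq.trans (Finset.sum_congr rfl fun J _ => ?_)
    (Path.sum_sandwich (fun q r => (Φ r.tgt r.tgt⁻¹ r.tgt)⁻¹ * coord k ⟨x, [s]⟩
      (pairProduct ρ Φ R (ofPath k q ⊗ₜ[k] pairAntipode ρ Φ R (ofPath k r))))
      (fun q r => coord k ⟨s.1 * x, l⟩ (pairProduct ρ Φ R
      (ofPath k q ⊗ₜ[k] pairAntipode ρ Φ R (ofPath k r)))) (hone x s) p)
  rw [map_smul, hmul, Functional.mul_ofConv, comul_tmul_pairAntipode]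
  simp only [map_sum, TensorProduct.map_tmul, LinearMap.mul'_apply, Path.tgt_final, smul_eq_mul,
    Finset.mul_sum]
  refine Finset.sum_congr rfl fun i _ => Finset.sum_congr rfl fun j _ => ?_
  rw [mul_assoc, mul_comm (coord k ⟨x, [s]⟩ _)]
  rfl

end Convolution

section GradedStructure

variable {k : Type*} [Field k] {G : Type*} [CommGroup G] {ρ : G → ℕ} {Φ : G → G → G → k}
  {R : G → G → k}

theorem comulTwice_ofPath (p : Path ρ) : comulTwice k (PathSpace k ρ) (ofPath k p) =
    ∑ i ∈ Finset.range (p.length + 1), ∑ j ∈ Finset.range ((p.initial i).length + 1),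
      ofPath k (p.final i) ⊗ₜ[k] (ofPath k ((p.initial i).final j) ⊗ₜ[k]
        ofPath k ((p.initial i).initial j)) := by
  simp only [comulTwice, LinearMap.comp_apply, comul_ofPath, map_sum, LinearMap.lTensor_tmul,
    TensorProduct.tmul_sum]

theorem comulTwice_ofVertex (x : G) : comulTwice k (PathSpace k ρ) (ofVertex k ρ x) =
    ofVertex k ρ x ⊗ₜ[k] (ofVertex k ρ x ⊗ₜ[k] ofVertex k ρ x) := by
  simp only [comulTwice, LinearMap.comp_apply, (isGroupLike_ofVertex x).comul_eq_tmul_self,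
    LinearMap.lTensor_tmul]

/-- A functional concentrated in degree zero stays so when it is evaluated at the three parts of
an element, modified by homogeneous maps. -/
theorem comp_comulTwice_comp
    {φ : PathSpace k ρ ⊗[k] (PathSpace k ρ ⊗[k] PathSpace k ρ) →ₗ[k] k}
    (hφ : φ ∘ₗ degreeZero₃ k ρ = φ) {f g h : PathSpace k ρ →ₗ[k] PathSpace k ρ}
    (hf : ∀ p : Path ρ, f (ofPath k p) ∈ degree k ρ p.length)
    (hg : ∀ p : Path ρ, g (ofPath k p) ∈ degree k ρ p.length)
    (hh : ∀ p : Path ρ, h (ofPath k p) ∈ degree k ρ p.length) :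
    ((φ ∘ₗ TensorProduct.map f (TensorProduct.map g h)) ∘ₗ comulTwice k _) ∘ₗ degreeZero k ρ =
      (φ ∘ₗ TensorProduct.map f (TensorProduct.map g h)) ∘ₗ comulTwice k _ :=
  comp_degreeZero fun p hp => by
    rw [LinearMap.comp_apply, comulTwice_ofPath, map_sum]
    refine Finset.sum_eq_zero fun i hi => ?_
    rw [map_sum]
    refine Finset.sum_eq_zero fun j hj => apply_eq_zero₃ hφ (hf _) (hg _) (hh _) ?_
    rw [Finset.mem_range] at hi hj
    have hi' := Path.length_initial p (show i ≤ p.length by omega)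
    rw [Path.length_final, Path.length_final,
      Path.length_initial (p.initial i) (show j ≤ (p.initial i).length by omega)]
    omega

namespace IsAdmissiblePair

theorem isQuasiAntipode (h : IsAdmissiblePair ρ Φ R) :
    h.dualQuasiBialgebra.IsQuasiAntipode (pairAntipode ρ Φ R) 1
      (inflate₁ k ρ fun g => (Φ g g⁻¹ g)⁻¹) := by
  have hβ := inflate₁_comp (k := k) (ρ := ρ) fun g => (Φ g g⁻¹ g)⁻¹
  have hconv : ∀ p : Path ρ, convLeft (inflate₁ k ρ fun g => (Φ g g⁻¹ g)⁻¹)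
      (pairAntipode ρ Φ R) (ofPath k p) =
        (Φ p.tgt p.tgt⁻¹ p.tgt)⁻¹ • pairAntipode ρ Φ R (ofPath k p) := fun p => by
    rw [(hasTarget_ofPath p).convLeft _ hβ, inflate₁_vertex]
  have hconvv : ∀ x : G, convLeft (inflate₁ k ρ fun g => (Φ g g⁻¹ g)⁻¹)
      (pairAntipode ρ Φ R) (ofVertex k ρ x) = (Φ x x⁻¹ x)⁻¹ • ofVertex k ρ x⁻¹ := fun x =>
    (hconv (Path.vertex ρ x)).trans (congrArg _ (pairAntipode_vertex Φ R x))
  have hdeg : ∀ p : Path ρ, convLeft (inflate₁ k ρ fun g => (Φ g g⁻¹ g)⁻¹)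
      (pairAntipode ρ Φ R) (ofPath k p) ∈ degree k ρ p.length := fun p => by
    rw [hconv]
    exact Submodule.smul_mem _ _ (pairAntipode_ofPath_mem_degree Φ R p)
  refine ⟨ext₁ fun p => ?_, ext₁ fun p => ?_, fun a => ?_, fun a => ?_, fun a => ?_, fun a => ?_⟩
  · rw [LinearMap.comp_apply, comul_pairAntipode, LinearMap.comp_apply, LinearMap.comp_apply,
      comul_ofPath, map_sum, map_sum]
    rfl
  · rw [LinearMap.comp_apply, pairAntipode_ofPath, map_smul, counit_ofPath, counit_ofPath,
      Path.length_reverse]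
    split_ifs with hp
    · rw [Path.eq_vertex hp]
      exact mul_one _
    · exact smul_zero _
  · refine LinearMap.congr_fun (f := (h.dualQuasiBialgebra.mul.toLinearMap ∘ₗ TensorProduct.map
      (pairAntipode ρ Φ R) (convLeft 1 LinearMap.id)) ∘ₗ Coalgebra.comul)
      (g := LinearMap.toSpanSingleton k _ (ofVertex k ρ 1) ∘ₗ (Coalgebra.counit))
      (ext₁ fun p => ?_) a
    rw [convLeft_one, LinearMap.comp_apply, LinearMap.comp_apply, LinearMap.comp_apply]
    by_cases hp : p.length = 0
    · rw [Path.eq_vertex hp]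
      change pairProduct ρ Φ R (TensorProduct.map _ _ (Coalgebra.comul (ofVertex k ρ p.src))) =
        Coalgebra.counit (R := k) (ofVertex k ρ p.src) • ofVertex k ρ 1
      rw [(isGroupLike_ofVertex p.src).comul_eq_tmul_self, TensorProduct.map_tmul,
        pairAntipode_vertex, counit_ofVertex, one_smul, LinearMap.id_apply,
        pairProduct_vertex_vertex, inv_mul_cancel]
    · rw [counit_ofPath_eq_zero hp, map_zero, comul_ofPath, map_sum, map_sum]
      exact h.sum_antipode_mul p hp
  · refine LinearMap.congr_fun (f := (h.dualQuasiBialgebra.mul.toLinearMap ∘ₗ TensorProduct.map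
      LinearMap.id (convLeft (inflate₁ k ρ fun g => (Φ g g⁻¹ g)⁻¹) (pairAntipode ρ Φ R))) ∘ₗ
        Coalgebra.comul)
      (g := LinearMap.toSpanSingleton k _ (ofVertex k ρ 1) ∘ₗ
        (inflate₁ k ρ fun g => (Φ g g⁻¹ g)⁻¹).ofConv)
      (ext₁ fun p => ?_) a
    rw [LinearMap.comp_apply, LinearMap.comp_apply, LinearMap.comp_apply]
    by_cases hp : p.length = 0
    · rw [Path.eq_vertex hp]
      change pairProduct ρ Φ R (TensorProduct.map _ _ (Coalgebra.comul (ofVertex k ρ p.src))) =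
        (inflate₁ k ρ fun g => (Φ g g⁻¹ g)⁻¹).ofConv (ofVertex k ρ p.src) • ofVertex k ρ 1
      rw [(isGroupLike_ofVertex p.src).comul_eq_tmul_self, TensorProduct.map_tmul,
        hconvv, inflate₁_vertex, LinearMap.id_apply, TensorProduct.tmul_smul, map_smul,
        pairProduct_vertex_vertex, mul_inv_cancel]
    · rw [apply_eq_zero₁ hβ (ofPath_mem_degree p) hp, map_zero, comul_ofPath, map_sum, map_sum]
      refine (Finset.sum_congr rfl fun J _ => ?_).trans (h.sum_mul_antipode p hp)
      rw [TensorProduct.map_tmul, hconv, TensorProduct.tmul_smul, map_smul]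
      rfl
  · rw [convLeft_one]
    refine LinearMap.congr_fun (ext_vertex₁ (comp_comulTwice_comp (inflate₃_comp Φ)
      (f := LinearMap.id) (h := LinearMap.id) ofPath_mem_degree hdeg ofPath_mem_degree)
      counit_comp_degreeZero fun x => ?_) a
    rw [LinearMap.comp_apply, comulTwice_ofVertex, LinearMap.comp_apply, TensorProduct.map_tmul,
      TensorProduct.map_tmul, hconvv, LinearMap.id_apply, ← TensorProduct.smul_tmul',
      TensorProduct.tmul_smul, map_smul, inflate₃_vertex, counit_ofVertex, smul_eq_mul,
      inv_mul_cancel₀ (h.isCocycle.ne_zero _ _ _)]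
  · rw [convLeft_one]
    refine LinearMap.congr_fun (ext_vertex₁ (comp_comulTwice_comp
      (g := LinearMap.id) (inflate₃_comp fun x y z => (Φ x y z)⁻¹)
      (pairAntipode_ofPath_mem_degree Φ R) ofPath_mem_degree hdeg)
      counit_comp_degreeZero fun x => ?_) a
    rw [LinearMap.comp_apply, comulTwice_ofVertex, LinearMap.comp_apply, TensorProduct.map_tmul,
      TensorProduct.map_tmul, hconvv, LinearMap.id_apply, pairAntipode_vertex,
      TensorProduct.tmul_smul, TensorProduct.tmul_smul, map_smul, inflate₃_vertex,
      counit_ofVertex, smul_eq_mul, ← mul_inv, mul_comm, h.mul_inv_cocycle, inv_one]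

/-- The graded coquasitriangular Majid algebra attached to an admissible pair. -/
noncomputable def gradedCQTMajid (h : IsAdmissiblePair ρ Φ R) : GradedCQTMajid k ρ where
  toDualQuasiBialgebra := h.dualQuasiBialgebra
  exists_quasiAntipode := ⟨_, _, _, h.isQuasiAntipode⟩
  R := inflateUnit₂ ρ R h.R_ne_zero
  R_mul_left := h.product_R_mul_left
  R_mul_right := h.product_R_mul_right
  R_comm := h.product_comm
  mul_mem_degree := mem_degree_of_ofPath (pairProduct_mem_degree Φ R)
  one_mem_degree := ofVertex_mem_degree 1
  exists_graded_quasiAntipode := ⟨_, _, _, h.isQuasiAntipode, pairAntipode_mem_degree Φ R,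
    fun _ hn _ hx => ⟨apply_eq_zero₁ counit_comp_degreeZero hx hn,
      apply_eq_zero₁ (inflate₁_comp _) hx hn⟩⟩
  Φ_concentrated := fun _ _ _ _ _ _ hx hy hz h => apply_eq_zero₃ (inflate₃_comp Φ) hx hy hz h
  R_concentrated := fun _ _ _ _ hx hy h => apply_eq_zero₂ (inflate₂_comp R) hx hy h
  vertex_mul := pairProduct_vertex_vertex Φ R

end IsAdmissiblePair

end GradedStructure

/-! ### The pair of a graded coquasitriangular Majid algebra -/

namespace GradedCQTMajid

variable {k : Type*} [Field k] {G : Type*} [CommGroup G] {ρ : G → ℕ} (A : GradedCQTMajid k ρ)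

/-- The restriction of the associator to vertices. -/
noncomputable def vertexΦ (f g h : G) : k :=
  A.Φ.val.ofConv (ofVertex k ρ f ⊗ₜ[k] (ofVertex k ρ g ⊗ₜ[k] ofVertex k ρ h))

/-- The restriction of the coquasitriangular structure to vertices. -/
noncomputable def vertexR (g h : G) : k := A.R.val.ofConv (ofVertex k ρ g ⊗ₜ[k] ofVertex k ρ h)

theorem Φ_comp : A.Φ.val.ofConv ∘ₗ degreeZero₃ k ρ = A.Φ.val.ofConv :=
  comp_degreeZero₃ fun p q r => A.Φ_concentrated _ _ _ _ _ _ (ofPath_mem_degree p)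
    (ofPath_mem_degree q) (ofPath_mem_degree r)

theorem R_comp : A.R.val.ofConv ∘ₗ degreeZero₂ k ρ = A.R.val.ofConv :=
  comp_degreeZero₂ fun p q => A.R_concentrated _ _ _ _ (ofPath_mem_degree p)
    (ofPath_mem_degree q)

theorem mul_ofPath_mem_degree (p q : Path ρ) :
    A.mul (ofPath k p ⊗ₜ[k] ofPath k q) ∈ degree k ρ (p.length + q.length) :=
  A.mul_mem_degree _ _ _ _ (ofPath_mem_degree p) (ofPath_mem_degree q)

theorem one_eq : A.one = ofVertex k ρ 1 := by
  have h : ∀ z ∈ degree k ρ 0, A.mul (z ⊗ₜ[k] ofVertex k ρ 1) = z := by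
    intro z hz
    induction hz using Submodule.span_induction with
    | zero => simp
    | add u v _ _ hu hv => rw [TensorProduct.add_tmul, map_add, hu, hv]
    | smul a u _ hu => rw [← TensorProduct.smul_tmul', map_smul, hu]
    | mem x hx =>
      obtain ⟨p, hp, rfl⟩ := hx
      rw [Path.eq_vertex hp]
      exact (A.vertex_mul _ _).trans (by rw [mul_one]; rfl)
  rw [← h A.one A.one_mem_degree, A.one_mul]

theorem quasi_assoc_ofPath (p q r : Path ρ) :
    A.vertexΦ p.src q.src r.src • A.mul (ofPath k p ⊗ₜ[k] A.mul (ofPath k q ⊗ₜ[k] ofPath k r)) =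
      A.vertexΦ p.tgt q.tgt r.tgt •
        A.mul (A.mul (ofPath k p ⊗ₜ[k] ofPath k q) ⊗ₜ[k] ofPath k r) := by
  have := LinearMap.congr_fun A.quasi_assoc (ofPath k p ⊗ₜ[k] (ofPath k q ⊗ₜ[k] ofPath k r))
  rw [(hasSource₃ p q r).convRight _ A.Φ_comp, (hasTarget₃ p q r).convLeft _ A.Φ_comp] at this
  exact this

theorem R_comm_ofPath (p q : Path ρ) :
    A.vertexR p.src q.src • A.mul (ofPath k q ⊗ₜ[k] ofPath k p) =
      A.vertexR p.tgt q.tgt • A.mul (ofPath k p ⊗ₜ[k] ofPath k q) := by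
  have := LinearMap.congr_fun A.R_comm (ofPath k p ⊗ₜ[k] ofPath k q)
  rw [(hasSource₂ p q).convRight _ A.R_comp, (hasTarget₂ p q).convLeft _ A.R_comp] at this
  exact this

theorem isNormalizedThreeCocycle : IsNormalizedThreeCocycle A.vertexΦ where
  ne_zero e f g := (isGroupLike₃ e f g).functional_ne_zero A.Φ
  cocycle e f g h := by
    have := congrArg (fun φ => φ.ofConv (ofVertex k ρ e ⊗ₜ[k] (ofVertex k ρ f ⊗ₜ[k]
      (ofVertex k ρ g ⊗ₜ[k] ofVertex k ρ h)))) A.pentagon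
    have hg := isGroupLike₄ (k := k) (ρ := ρ) e f g h
    simp only [hg.functional_mul, pull_keepBCD_ofConv, pull_keepABC_ofConv, counit_ofVertex,
      one_mul] at this
    change A.Φ.val.ofConv (ofVertex k ρ e ⊗ₜ[k] (ofVertex k ρ f ⊗ₜ[k]
      A.mul (ofVertex k ρ g ⊗ₜ[k] ofVertex k ρ h))) *
    A.Φ.val.ofConv (A.mul (ofVertex k ρ e ⊗ₜ[k] ofVertex k ρ f) ⊗ₜ[k]
      (ofVertex k ρ g ⊗ₜ[k] ofVertex k ρ h)) = _ * A.Φ.val.ofConv (ofVertex k ρ e ⊗ₜ[k]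
      (A.mul (ofVertex k ρ f ⊗ₜ[k] ofVertex k ρ g) ⊗ₜ[k] ofVertex k ρ h)) * _ at this
    simp only [A.vertex_mul] at this
    exact this
  normalized e f := by
    have := A.normalized (ofVertex k ρ e) (ofVertex k ρ f)
    rwa [one_eq, counit_ofVertex, counit_ofVertex, mul_one] at this

theorem vertexR_ne_zero (g h : G) : A.vertexR g h ≠ 0 :=
  (isGroupLike₂ g h).functional_ne_zero A.R

theorem vertexR_mul_right (f g h : G) : A.vertexR f (g * h) = A.vertexR f g * A.vertexR f h *
    (A.vertexΦ g f h / (A.vertexΦ g h f * A.vertexΦ f g h)) := by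
  have := congrArg (fun φ => φ.ofConv (ofVertex k ρ f ⊗ₜ[k] (ofVertex k ρ g ⊗ₜ[k]
    ofVertex k ρ h))) A.R_mul_right
  have hg := isGroupLike₃ (k := k) (ρ := ρ) f g h
  simp only [hg.functional_mul, pull_keepAC_ofConv, pull_keepAB_ofConv, counit_ofVertex,
    one_mul, hg.inv_functional] at this
  change A.R.val.ofConv (ofVertex k ρ f ⊗ₜ[k] A.mul (ofVertex k ρ g ⊗ₜ[k] ofVertex k ρ h)) =
    A.Φ⁻¹.val.ofConv (ofVertex k ρ g ⊗ₜ[k] (ofVertex k ρ h ⊗ₜ[k] ofVertex k ρ f)) *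
      A.vertexR f h * A.vertexΦ g f h * A.vertexR f g * (A.vertexΦ f g h)⁻¹ at this
  rw [A.vertex_mul, (isGroupLike₃ g h f).inv_functional] at this
  refine Eq.trans this ?_
  change (A.vertexΦ g h f)⁻¹ * A.vertexR f h * A.vertexΦ g f h * A.vertexR f g *
    (A.vertexΦ f g h)⁻¹ = _
  rw [div_eq_mul_inv, mul_inv]
  ring

theorem vertexR_mul_left (f g h : G) : A.vertexR (f * g) h = A.vertexR f h * A.vertexR g h *
    (A.vertexΦ h f g * A.vertexΦ f g h / A.vertexΦ f h g) := by
  have := congrArg (fun φ => φ.ofConv (ofVertex k ρ f ⊗ₜ[k] (ofVertex k ρ g ⊗ₜ[k]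
    ofVertex k ρ h))) A.R_mul_left
  have hg := isGroupLike₃ (k := k) (ρ := ρ) f g h
  simp only [hg.functional_mul, pull_keepAC_ofConv, pull_keepBC_ofConv, counit_ofVertex,
    one_mul] at this
  change A.R.val.ofConv (A.mul (ofVertex k ρ f ⊗ₜ[k] ofVertex k ρ g) ⊗ₜ[k] ofVertex k ρ h) =
    A.vertexΦ h f g * A.vertexR f h *
      A.Φ⁻¹.val.ofConv (ofVertex k ρ f ⊗ₜ[k] (ofVertex k ρ h ⊗ₜ[k] ofVertex k ρ g)) *
      A.vertexR g h * A.vertexΦ f g h at this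
  rw [A.vertex_mul, (isGroupLike₃ f h g).inv_functional] at this
  refine Eq.trans this ?_
  change _ * (A.vertexΦ f h g)⁻¹ * _ * _ = _
  rw [div_eq_mul_inv]
  ring

theorem vertexR_one_right (g : G) : A.vertexR g 1 = 1 := by
  have h := A.isNormalizedThreeCocycle
  have := A.vertexR_mul_right g 1 1
  rw [mul_one, h.one_left, h.one_left, h.normalized, mul_one, div_one, mul_one] at this
  exact mul_left_cancel₀ (A.vertexR_ne_zero g 1) (by rw [mul_one]; exact this.symm)

theorem vertexR_one_left (g : G) : A.vertexR 1 g = 1 := by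
  have h := A.isNormalizedThreeCocycle
  have := A.vertexR_mul_left 1 1 g
  rw [mul_one, h.one_left, h.one_left, h.normalized, mul_one, div_one, mul_one] at this
  exact mul_left_cancel₀ (A.vertexR_ne_zero 1 g) (by rw [mul_one]; exact this.symm)

/-- Quasi-associativity for two vertices and an arrow. -/
theorem vertex_mul_mul_arrow (g e x : G) (s : Label ρ) : A.vertexΦ g e x •
    A.mul (ofVertex k ρ g ⊗ₜ[k] A.mul (ofVertex k ρ e ⊗ₜ[k] ofArrow k ρ x s)) =
      A.vertexΦ g e (s.1 * x) • A.mul (ofVertex k ρ (g * e) ⊗ₜ[k] ofArrow k ρ x s) := by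
  have := A.quasi_assoc_ofPath (Path.vertex ρ g) (Path.vertex ρ e) ⟨x, [s]⟩
  rw [← A.vertex_mul]
  exact this

theorem one_mul_arrow (x : G) (s : Label ρ) :
    A.mul (ofVertex k ρ 1 ⊗ₜ[k] ofArrow k ρ x s) = ofArrow k ρ x s := by
  rw [← A.one_eq, A.one_mul]

theorem arrow_mul_vertex (x : G) (s : Label ρ) (g : G) :
    A.vertexR g x • A.mul (ofArrow k ρ x s ⊗ₜ[k] ofVertex k ρ g) =
      A.vertexR g (s.1 * x) • A.mul (ofVertex k ρ g ⊗ₜ[k] ofArrow k ρ x s) :=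
  A.R_comm_ofPath (Path.vertex ρ g) ⟨x, [s]⟩

theorem vertex_mul_arrow (x : G) (s : Label ρ) (g : G) :
    A.vertexR x g • A.mul (ofVertex k ρ g ⊗ₜ[k] ofArrow k ρ x s) =
      A.vertexR (s.1 * x) g • A.mul (ofArrow k ρ x s ⊗ₜ[k] ofVertex k ρ g) :=
  A.R_comm_ofPath ⟨x, [s]⟩ (Path.vertex ρ g)

theorem vertex_mul_arrow_ne_zero (g x : G) (s : Label ρ) :
    A.mul (ofVertex k ρ g ⊗ₜ[k] ofArrow k ρ x s) ≠ 0 := by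
  intro h
  have := A.vertex_mul_mul_arrow g⁻¹ g x s
  rw [h, TensorProduct.tmul_zero, map_zero, smul_zero, inv_mul_cancel, A.one_mul_arrow] at this
  exact smul_ne_zero (A.isNormalizedThreeCocycle.ne_zero _ _ _)
    ((basis k ρ).ne_zero ⟨x, [s]⟩) this.symm

/-- The braiding squares to the identity on vertices: by the commutation relation between a vertex
`g` and an arrow from `x` to `y`, the scalar `R(g, x) R(x, g)` does not change along arrows. -/
theorem vertexR_symm (hconn : HopfQuiver.Connected ρ) (g h : G) :
    A.vertexR g h * A.vertexR h g = 1 := by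
  have key : ∀ x y, Relation.EqvGen (fun u v : G => ∃ a : Arrow ρ, a.src = u ∧ a.tgt = v) x y →
      A.vertexR g x * A.vertexR x g = A.vertexR g y * A.vertexR y g := by
    intro x y hxy
    induction hxy with
    | rel u v huv =>
      obtain ⟨⟨u, s⟩, rfl, rfl⟩ := huv
      change A.vertexR g u * A.vertexR u g = A.vertexR g (s.1 * u) * A.vertexR (s.1 * u) g
      refine smul_left_injective k (A.vertex_mul_arrow_ne_zero g u s) ?_
      change _ • _ = _ • _
      rw [mul_smul, A.vertex_mul_arrow, smul_comm, A.arrow_mul_vertex, smul_smul, mul_comm]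
    | refl u => rfl
    | symm u v _ ih => exact ih.symm
    | trans u v w _ _ ih₁ ih₂ => exact ih₁.trans ih₂
  rw [key h 1 (hconn h 1), A.vertexR_one_left, A.vertexR_one_right, mul_one]

theorem isAdmissiblePair (hconn : HopfQuiver.Connected ρ) :
    IsAdmissiblePair ρ A.vertexΦ A.vertexR where
  isCocycle := A.isNormalizedThreeCocycle
  right_compat e f g t _ := A.isNormalizedThreeCocycle.right_compat e f g t
  bimodule_compat e f g t _ := A.isNormalizedThreeCocycle.bimodule_compat e f g t
  R_mul_right := A.vertexR_mul_right
  R_mul_left := A.vertexR_mul_left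
  R_symm := A.vertexR_symm hconn

/-! ### A structure is determined by its pair -/

/-- The left action of a vertex maps an arrow to a combination of arrows with the expected source
and target. -/
theorem vertex_mul_arrow_eq_sum (g x t : G) (i : Fin (ρ t)) :
    A.mul (ofVertex k ρ g ⊗ₜ[k] ofArrow k ρ x ⟨t, i⟩) =
      ∑ j, coord k ⟨g * x, [⟨t, j⟩]⟩ (A.mul (ofVertex k ρ g ⊗ₜ[k] ofArrow k ρ x ⟨t, i⟩)) •
        ofArrow k ρ (g * x) ⟨t, j⟩ := by
  classical
  set z := A.mul (ofVertex k ρ g ⊗ₜ[k] ofArrow k ρ x ⟨t, i⟩) with hz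
  -- The coefficient at a path `p` is the convolution product of those at `p` and at its source or
  -- target; the latter factor is concentrated in degree zero and is evaluated at vertices.
  have hcoord : ∀ y, (coord k ⟨y, []⟩ ∘ₗ A.mul.toLinearMap) ∘ₗ degreeZero₂ k ρ =
      coord k ⟨y, []⟩ ∘ₗ A.mul.toLinearMap := fun y => comp_degreeZero₂ fun p q hpq =>
    coord_eq_zero_of_mem_degree (A.mul_ofPath_mem_degree p q)
      (by simp only [Path.length, List.length_nil] at hpq ⊢; omega)
  have hmul : ∀ p : Path ρ, ∀ c, coord k p (A.mul c) =
      (Functional.pull A.mul.toLinearMap (WithConv.toConv (coord k p))).ofConv c := fun _ _ => rfl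
  have hsrc : ∀ p : Path ρ, coord k p z ≠ 0 → p.src = g * x := by
    intro p hp
    by_contra hne
    have hsplit := (coord_mul_coord (k := k) p ⟨p.src, []⟩).trans (if_pos rfl)
    have hs := hasSource₂ (k := k) (Path.vertex ρ g) (⟨x, [⟨t, i⟩]⟩ : Path ρ)
    refine hp ?_
    rw [hz, hmul]
    change (Functional.pull A.mul.toLinearMap (WithConv.toConv
      (coord k ⟨p.src, [] ++ p.labels⟩))).ofConv _ = 0
    rw [← hsplit, Functional.pull_mul]
    refine (hs.mul _ (hcoord p.src)).trans ?_
    refine mul_eq_zero_of_right _ ?_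
    change coord k _ (A.mul (ofVertex k ρ g ⊗ₜ[k] ofVertex k ρ x)) = 0
    rw [A.vertex_mul, ofVertex, coord_ofPath, if_neg]
    exact fun h => hne (congrArg Path.src h).symm
  have htgt : ∀ p : Path ρ, coord k p z ≠ 0 → p.tgt = g * (t * x) := by
    intro p hp
    by_contra hne
    have hsplit := (coord_mul_coord (k := k) ⟨p.tgt, []⟩ p).trans (if_pos rfl)
    have hs := hasTarget₂ (k := k) (Path.vertex ρ g) (⟨x, [⟨t, i⟩]⟩ : Path ρ)
    refine hp ?_
    rw [hz, hmul]
    rw [List.append_nil] at hsplit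
    change (Functional.pull A.mul.toLinearMap (WithConv.toConv
      (coord k ⟨p.src, p.labels⟩))).ofConv _ = 0
    rw [← hsplit, Functional.pull_mul]
    refine (hs.mul _ (hcoord p.tgt)).trans ?_
    refine mul_eq_zero_of_left ?_ _
    change coord k _ (A.mul (ofVertex k ρ g ⊗ₜ[k] ofVertex k ρ (t * x))) = 0
    rw [A.vertex_mul, ofVertex, coord_ofPath, if_neg]
    exact fun h => hne (congrArg Path.src h).symm
  have hzdeg : z ∈ degree k ρ 1 := A.mul_mem_degree 0 1 _ _ (ofVertex_mem_degree g)
    (ofArrow_mem_degree x ⟨t, i⟩)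
  refine ext_coord fun p => ?_
  rw [map_sum]
  simp only [map_smul, smul_eq_mul, ofArrow, coord_ofPath]
  by_cases hp : coord k p z = 0
  · rw [hp]
    refine (Finset.sum_eq_zero fun j _ => ?_).symm
    split_ifs with h
    · rw [h, hp, zero_mul]
    · exact mul_zero _
  · have hlen : p.length = 1 := by
      by_contra h
      exact hp (coord_eq_zero_of_mem_degree hzdeg h)
    obtain ⟨y, ⟨u, j⟩, rfl⟩ := Path.eq_arrow hlen
    obtain rfl : y = g * x := hsrc _ hp
    obtain rfl : u = t := by
      have := htgt _ hp
      simp only [Path.tgt, Path.walk, List.foldl_cons, List.foldl_nil] at this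
      rw [mul_left_comm g t x] at this
      exact mul_right_cancel this
    rw [Finset.sum_eq_single_of_mem j (Finset.mem_univ j)]
    · simp
    · intro l _ hl
      rw [if_neg, mul_zero]
      intro h
      have h' : (⟨u, l⟩ : Label ρ) = ⟨u, j⟩ := (List.cons.inj (congrArg Path.labels h)).1
      exact hl (eq_of_heq (Sigma.mk.inj h').2)

end GradedCQTMajid

namespace PathSpace

variable {k : Type*} [Field k] {G : Type*} [CommGroup G] {ρ : G → ℕ}

/-- Endomorphisms of `kQ` that act on the arrows by mutually inverse matrices are inverse to each
other. -/
theorem comp_eq_id_of_arrow {f g : PathSpace k ρ →ₗc[k] PathSpace k ρ}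
    {M N : ∀ (_ : G) (t : G), Matrix (Fin (ρ t)) (Fin (ρ t)) k}
    (hf : ∀ n, ∀ z ∈ degree k ρ n, f z ∈ degree k ρ n)
    (hg : ∀ n, ∀ z ∈ degree k ρ n, g z ∈ degree k ρ n)
    (hfv : ∀ x, f (ofVertex k ρ x) = ofVertex k ρ x)
    (hgv : ∀ x, g (ofVertex k ρ x) = ofVertex k ρ x)
    (hfa : ∀ x t i, f (ofArrow k ρ x ⟨t, i⟩) = ∑ j, M x t j i • ofArrow k ρ x ⟨t, j⟩)
    (hga : ∀ x t i, g (ofArrow k ρ x ⟨t, i⟩) = ∑ j, N x t j i • ofArrow k ρ x ⟨t, j⟩)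
    (hMN : ∀ x t, M x t * N x t = 1) : f.comp g = CoalgHom.id k _ := by
  refine coalgHom_ext _ _ fun p hp c => LinearMap.congr_fun (coord_comp_eq (basis k ρ) Path.length
      (f := (f.comp g).toLinearMap) (g := LinearMap.id)
      (fun q => hf _ _ (hg _ _ (ofPath_mem_degree q))) ofPath_mem_degree ?_ p hp) c
  rintro ⟨x, _ | ⟨⟨t, i⟩, _ | ⟨s', l⟩⟩⟩ hq
  · exact (congrArg f (hgv x)).trans (hfv x)
  · refine (congrArg f (hga x t i)).trans ?_
    rw [map_sum]
    simp only [map_smul, hfa, Finset.smul_sum, smul_smul]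
    rw [Finset.sum_comm]
    simp only [← Finset.sum_smul]
    have hsum : ∀ l, ∑ j, N x t j i * M x t l j =
        (1 : Matrix (Fin (ρ t)) (Fin (ρ t)) k) l i := fun l => by
      rw [← hMN x t, Matrix.mul_apply]
      simp only [mul_comm]
    simp only [hsum]
    rw [Finset.sum_eq_single_of_mem i (Finset.mem_univ i) fun l _ hl => by
      rw [Matrix.one_apply_ne hl, zero_smul], Matrix.one_apply_eq, one_smul]
    rfl
  · simp [Path.length] at hq

end PathSpace

namespace GradedCQTMajid

variable {k : Type*} [Field k] {G : Type*} [CommGroup G] {ρ : G → ℕ} (A : GradedCQTMajid k ρ)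

/-- Every structure is isomorphic to the one attached to its pair. The isomorphism sends the arrow
with source `x` and label `s` to the product of the vertex `x` with the arrow that has source `1`
and label `s`. -/
theorem exists_isIso (h : IsAdmissiblePair ρ A.vertexΦ A.vertexR) :
    ∃ F, IsIso h.gradedCQTMajid A F := by
  classical
  have hΦ := A.isNormalizedThreeCocycle
  -- The action of `x` on the arrows with source `1`, and that of `x⁻¹` on the arrows with source
  -- `x`, corrected by the associator so that the two matrices are mutually inverse.
  obtain ⟨M, hM⟩ : ∃ M : ∀ (_ : G) (t : G), Matrix (Fin (ρ t)) (Fin (ρ t)) k, ∀ x t j i,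
      M x t j i = coord k ⟨x, [⟨t, j⟩]⟩ (A.mul (ofVertex k ρ x ⊗ₜ[k] ofArrow k ρ 1 ⟨t, i⟩)) :=
    ⟨fun x t => Matrix.of fun j i => _, fun _ _ _ _ => rfl⟩
  obtain ⟨N, hN⟩ : ∃ N : ∀ (_ : G) (t : G), Matrix (Fin (ρ t)) (Fin (ρ t)) k, ∀ x t j i,
      N x t j i = (A.vertexΦ x⁻¹ x t)⁻¹ * coord k ⟨1, [⟨t, j⟩]⟩
        (A.mul (ofVertex k ρ x⁻¹ ⊗ₜ[k] ofArrow k ρ x ⟨t, i⟩)) :=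
    ⟨fun x t => Matrix.of fun j i => _, fun _ _ _ _ => rfl⟩
  have hMsum : ∀ x t i, A.mul (ofVertex k ρ x ⊗ₜ[k] ofArrow k ρ 1 ⟨t, i⟩) =
      ∑ j, M x t j i • ofArrow k ρ x ⟨t, j⟩ := by
    intro x t i
    have := A.vertex_mul_arrow_eq_sum x 1 t i
    rw [mul_one] at this
    simpa only [hM] using this
  have hNM : ∀ x t, N x t * M x t = 1 := by
    intro x t
    ext l i
    have hq := A.vertex_mul_mul_arrow x⁻¹ x 1 ⟨t, i⟩
    rw [hΦ.one_right, one_smul, inv_mul_cancel, A.one_mul_arrow, mul_one, hMsum,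
      TensorProduct.tmul_sum, map_sum] at hq
    simp only [TensorProduct.tmul_smul, map_smul] at hq
    have hq' := congrArg (coord k ⟨1, [⟨t, l⟩]⟩) hq
    rw [map_sum] at hq'
    simp only [map_smul, smul_eq_mul] at hq'
    rw [Matrix.mul_apply]
    simp only [hN, mul_assoc, ← Finset.mul_sum]
    rw [Finset.sum_congr rfl fun j _ => mul_comm _ (M x t j i), hq', inv_mul_cancel_left₀
      (hΦ.ne_zero _ _ _), ofArrow, coord_ofPath, Matrix.one_apply]
    refine if_congr ?_ rfl rfl
    simp [eq_comm]
  have hMN : ∀ x t, M x t * N x t = 1 := fun x t => mul_eq_one_comm.1 (hNM x t)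
  obtain ⟨f, hf, hfv, hfa⟩ := exists_endomorphism M
  obtain ⟨g, hg, hgv, hga⟩ := exists_endomorphism N
  have hfa' : ∀ x s, f (ofArrow k ρ x s) = A.mul (ofVertex k ρ x ⊗ₜ[k] ofArrow k ρ 1 s) :=
    fun x s => (hfa x s.1 s.2).trans (hMsum x s.1 s.2).symm
  have hfg := comp_eq_id_of_arrow hf hg hfv hgv hfa hga hMN
  have hgf := comp_eq_id_of_arrow hg hf hgv hfv hga hfa hNM
  have hleft : ∀ y x s, A.mul (ofVertex k ρ y ⊗ₜ[k] f (ofArrow k ρ x s)) =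
      A.vertexΦ y x s.1 • f (ofArrow k ρ (y * x) s) := by
    intro y x s
    have := A.vertex_mul_mul_arrow y x 1 s
    rw [hΦ.one_right, one_smul, mul_one] at this
    rw [hfa', hfa', this]
  have hright : ∀ x s y, A.mul (f (ofArrow k ρ x s) ⊗ₜ[k] ofVertex k ρ y) =
      rightScalar A.vertexΦ A.vertexR x s.1 y • f (ofArrow k ρ (x * y) s) := by
    intro x s y
    have : A.vertexR y x • A.mul (f (ofArrow k ρ x s) ⊗ₜ[k] ofVertex k ρ y) =
        A.vertexR y (s.1 * x) • A.mul (ofVertex k ρ y ⊗ₜ[k] f (ofArrow k ρ x s)) := by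
      rcases s with ⟨t, i⟩
      rw [hfa, TensorProduct.sum_tmul, TensorProduct.tmul_sum, map_sum, map_sum, Finset.smul_sum,
        Finset.smul_sum]
      refine Finset.sum_congr rfl fun j _ => ?_
      rw [← TensorProduct.smul_tmul', TensorProduct.tmul_smul, map_smul, map_smul, smul_comm,
        A.arrow_mul_vertex, smul_comm]
    have hne := A.vertexR_ne_zero y x
    rw [hleft, mul_comm y x] at this
    rw [rightScalar, ← inv_smul_smul₀ hne (A.mul _), this, smul_smul, smul_smul]
    congr 1
    ring
  -- Both sides are coalgebra maps, so it suffices to compare them on vertices and on products of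
  -- an arrow and a vertex.
  have hmul : (f.comp (pairProduct ρ A.vertexΦ A.vertexR)) =
      A.mul.comp (Coalgebra.TensorProduct.map f f) := by
    refine coalgHom_ext _ _ fun p hp c => LinearMap.congr_fun (coord_comp_eq (basis₂ k ρ)
      (fun i => i.1.length + i.2.length)
      (f := (f.comp (pairProduct ρ A.vertexΦ A.vertexR)).toLinearMap)
      (g := (A.mul.comp (Coalgebra.TensorProduct.map f f)).toLinearMap) ?_ ?_ ?_ p hp) c
    · rintro ⟨q, r⟩
      rw [basis₂_apply]
      exact hf _ _ (pairProduct_mem_degree _ _ q r)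
    · rintro ⟨q, r⟩
      rw [basis₂_apply]
      exact A.mul_mem_degree _ _ _ _ (hf _ _ (ofPath_mem_degree q)) (hf _ _ (ofPath_mem_degree r))
    · rintro ⟨q, r⟩ hqr
      rw [basis₂_apply]
      change f (pairProduct ρ A.vertexΦ A.vertexR (ofPath k q ⊗ₜ[k] ofPath k r)) =
        A.mul (f (ofPath k q) ⊗ₜ[k] f (ofPath k r))
      refine cases_length₂ (P := fun q r => f (pairProduct ρ A.vertexΦ A.vertexR
        (ofPath k q ⊗ₜ[k] ofPath k r)) = A.mul (f (ofPath k q) ⊗ₜ[k] f (ofPath k r)))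
        ?_ ?_ ?_ q r hqr
      · intro x y
        change f (pairProduct ρ A.vertexΦ A.vertexR (ofVertex k ρ x ⊗ₜ[k] ofVertex k ρ y)) =
          A.mul (f (ofVertex k ρ x) ⊗ₜ[k] f (ofVertex k ρ y))
        rw [pairProduct_vertex_vertex, hfv, hfv, hfv, A.vertex_mul]
      · intro x s y
        change f (pairProduct ρ A.vertexΦ A.vertexR (ofArrow k ρ x s ⊗ₜ[k] ofVertex k ρ y)) =
          A.mul (f (ofArrow k ρ x s) ⊗ₜ[k] f (ofVertex k ρ y))
        rw [pairProduct_arrow_vertex, hfv, hright, map_smul]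
      · intro x y s
        change f (pairProduct ρ A.vertexΦ A.vertexR (ofVertex k ρ x ⊗ₜ[k] ofArrow k ρ y s)) =
          A.mul (f (ofVertex k ρ x) ⊗ₜ[k] f (ofArrow k ρ y s))
        rw [pairProduct_vertex_arrow, hfv, hleft, map_smul]
  refine ⟨CoalgEquiv.ofCoalgHom f g hfg hgf, ?_, hfv, ?_, ?_, ?_, ?_⟩
  · intro n x
    refine ⟨fun hx => ?_, hf n x⟩
    have := hg n _ hx
    rwa [show g ((CoalgEquiv.ofCoalgHom f g hfg hgf) x) = x from CoalgHom.congr_fun hgf x] at this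
  · exact (hfv 1).trans A.one_eq.symm
  · exact fun x y => CoalgHom.congr_fun hmul (x ⊗ₜ[k] y)
  · intro x y z
    refine LinearMap.congr_fun (f := A.Φ.val.ofConv ∘ₗ TensorProduct.map f.toLinearMap
      (TensorProduct.map f.toLinearMap f.toLinearMap)) (g := (inflate₃ k ρ A.vertexΦ).ofConv)
      (ext_vertex₃ (comp_degreeZero₃ fun p q r hpqr => ?_) (inflate₃_comp _) fun x y z => ?_)
      (x ⊗ₜ[k] (y ⊗ₜ[k] z))
    · exact A.Φ_concentrated _ _ _ _ _ _ (hf _ _ (ofPath_mem_degree p))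
        (hf _ _ (ofPath_mem_degree q)) (hf _ _ (ofPath_mem_degree r)) hpqr
    · rw [inflate₃_vertex]
      change A.Φ.val.ofConv (f _ ⊗ₜ[k] (f _ ⊗ₜ[k] f _)) = _
      rw [hfv, hfv, hfv]
      rfl
  · intro x y
    refine LinearMap.congr_fun (f := A.R.val.ofConv ∘ₗ TensorProduct.map f.toLinearMap
      f.toLinearMap) (g := (inflate₂ k ρ A.vertexR).ofConv)
      (ext_vertex₂ (comp_degreeZero₂ fun p q hpq => ?_) (inflate₂_comp _) fun x y => ?_)
      (x ⊗ₜ[k] y)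
    · exact A.R_concentrated _ _ _ _ (hf _ _ (ofPath_mem_degree p))
        (hf _ _ (ofPath_mem_degree q)) hpq
    · rw [inflate₂_vertex]
      change A.R.val.ofConv (f _ ⊗ₜ[k] f _) = _
      rw [hfv, hfv]
      rfl

theorem IsIso.vertexΦ_eq {A B : GradedCQTMajid k ρ} {F : PathSpace k ρ ≃ₗc[k] PathSpace k ρ}
    (h : IsIso A B F) : A.vertexΦ = B.vertexΦ := by
  funext x y z
  have := h.map_Φ (ofVertex k ρ x) (ofVertex k ρ y) (ofVertex k ρ z)
  rw [h.map_vertex, h.map_vertex, h.map_vertex] at this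
  exact this.symm

theorem IsIso.vertexR_eq {A B : GradedCQTMajid k ρ} {F : PathSpace k ρ ≃ₗc[k] PathSpace k ρ}
    (h : IsIso A B F) : A.vertexR = B.vertexR := by
  funext x y
  have := h.map_R (ofVertex k ρ x) (ofVertex k ρ y)
  rw [h.map_vertex, h.map_vertex] at this
  exact this.symm

/-- Restriction to vertices, as a map from isomorphism classes to admissible pairs. -/
noncomputable def restrict (hconn : HopfQuiver.Connected ρ) :
    Quotient (setoid k ρ) → {p : (G → G → G → k) × (G → G → k) // IsAdmissiblePair ρ p.1 p.2} :=
  Quotient.lift (fun A => ⟨(A.vertexΦ, A.vertexR), A.isAdmissiblePair hconn⟩) fun _ _ ⟨_, hF⟩ =>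
    Subtype.ext (Prod.ext hF.vertexΦ_eq hF.vertexR_eq)

theorem restrict_bijective (hconn : HopfQuiver.Connected ρ) :
    Function.Bijective (restrict (k := k) hconn) := by
  let std : {p : (G → G → G → k) × (G → G → k) // IsAdmissiblePair ρ p.1 p.2} →
      Quotient (setoid k ρ) := fun p => Quotient.mk _ p.2.gradedCQTMajid
  refine Function.bijective_iff_has_inverse.2 ⟨std, fun a => ?_, fun p => ?_⟩
  · induction a using Quotient.inductionOn with
    | h A => exact Quotient.sound (A.exists_isIso (A.isAdmissiblePair hconn))
  · refine Subtype.ext (Prod.ext ?_ ?_)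
    · funext x y z
      exact inflate₃_vertex _ x y z
    · funext x y
      exact inflate₂_vertex _ x y

end GradedCQTMajid

theorem theorem3p2 {k : Type*} [Field k] {G : Type*} [CommGroup G] (ρ : G → ℕ)
    (hconn : HopfQuiver.Connected ρ) :
    ∃ e : Quotient (GradedCQTMajid.setoid k ρ) ≃
        {p : (G → G → G → k) × (G → G → k) // IsAdmissiblePair ρ p.1 p.2},
      ∀ A : GradedCQTMajid k ρ,
        (∀ f g h : G, (e (Quotient.mk _ A)).val.1 f g h =
          A.Φ.val.ofConv (PathSpace.ofVertex k ρ f ⊗ₜ[k]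
            (PathSpace.ofVertex k ρ g ⊗ₜ[k] PathSpace.ofVertex k ρ h))) ∧
        (∀ g h : G, (e (Quotient.mk _ A)).val.2 g h =
          A.R.val.ofConv (PathSpace.ofVertex k ρ g ⊗ₜ[k] PathSpace.ofVertex k ρ h)) :=
  ⟨Equiv.ofBijective _ (GradedCQTMajid.restrict_bijective hconn),
    fun _ => ⟨fun _ _ _ => rfl, fun _ _ => rfl⟩⟩
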